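/- A straight line program (SLP) of size $n\ge 1$ over a finite alphabet $\Sigma$ is a sequence of assignments $X_1=\mathit{expr}_1,\dots,X_n=\mathit{expr}_n$, where each $\mathit{expr}_i$ is either a letter of $\Sigma$ or a concatenation $X_\ell X_r$ with $\ell,r<i$; it represents the string derived from $X_n$. For a string $T$ and a nonempty string $p$ let $\mathit{Occ}(T,p)=\{k>0 \mid T[k:k+|p|-1]=p\}$, and for $q\ge 1$ let $$K_q(T_1,T_2)=\sum_{p\in\Sigma^q}|\mathit{Occ}(T_1,p)|\cdot|\mathit{Occ}(T_2,p)|$$ be the $q$-gram spectrum kernel. Claim. Given an integer $q\ge 1$ and two SLPs of sizes $n_1$ and $n_2$ over an integer alphabet $\Sigma=\{0,\dots,\sigma-1\}$ that represent strings $T_1$ and $T_2$, the value $K_q(T_1,T_2)$ can be computed in $O(q(n_1+n_2))$ time on a word RAM. Precisely: there are one fixed program and constants $C,k$ such that for all $\sigma$, all such SLPs, all $q\ge 1$ and every word length $w$ with $(n_1+n_2+|T_1|+|T_2|+q+\sigma)^k\le 2^w$, the program, run on a RAM with $w$-bit words and given the two sequences of assignments together with $n_1,n_2,q,\sigma$,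 halts after at most $C\,q\,(n_1+n_2)$ steps with output $K_q(T_1,T_2)$. Each access to a register or to an array cell, each constant, each test, and each addition, truncated subtraction, multiplication, division, remainder or comparison of words counts as one step; memory outside the input is initially $0$. -/

import Mathlib

/-- A straight line program over the alphabet `A`: a nonempty sequence of assignments, where the
right-hand side of the `i`-th variable is either a letter or a pair of earlier variables.
Variables are numbered from `0`. -/
structure SLP (A : Type) where
  /-- the number of assignments -/
  size : ℕ
  size_pos : 0 < size
  rhs : (i : Fin size) → A ⊕ (Fin i.val × Fin i.val)

namespace SLP

/-- The string derived from the `i`-th variable. -/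
def val {A : Type} (S : SLP A) (i : Fin S.size) : List A :=
  match S.rhs i with
  | Sum.inl a => [a]
  | Sum.inr (l, r) =>
      S.val ⟨l.val, l.isLt.trans i.isLt⟩ ++ S.val ⟨r.val, r.isLt.trans i.isLt⟩
termination_by i.val
decreasing_by
  · exact l.isLt
  · exact r.isLt

/-- The string represented by the program: the one derived from the last variable. -/
def text {A : Type} (S : SLP A) : List A :=
  S.val ⟨S.size - 1, Nat.sub_lt S.size_pos Nat.one_pos⟩

end SLP

/-- The set of (1-based) positions at which the nonempty string `P` occurs in `T`. -/
def Occ {A : Type} [DecidableEq A] (T P : List A) : Finset ℕ :=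
  (Finset.Icc 1 T.length).filter fun k => (T.drop (k - 1)).take P.length = P

/-- The feature vector of `T`: the occurrence frequencies of all `q`-grams. -/
def qgramFeature {A : Type} [DecidableEq A] (q : ℕ) (T : List A) (p : Fin q → A) : ℕ :=
  (Occ T (List.ofFn p)).card

/-- The `q`-gram spectrum kernel, the inner product of the two feature vectors. -/
def spectrumKernel {A : Type} [Fintype A] [DecidableEq A] (q : ℕ) (T₁ T₂ : List A) : ℕ :=
  ∑ p : Fin q → A, qgramFeature q T₁ p * qgramFeature q T₂ p

/-! A word RAM with `w`-bit words, programmed by structured (while) programs.  There are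
registers, and arrays that are addressed by words; a program mentions only finitely many of
both.  Every elementary operation on words takes one step. -/

namespace WordRAM

/-- Elementary binary operations on words. -/
inductive Op where
  | add
  | sub
  | mul
  | div
  | mod
  | lt
  | eq

/-- The result of an operation on `w`-bit words.  Sums and products are reduced modulo `2 ^ w`,
subtraction is truncated at `0`, comparisons return `1` or `0` (again modulo `2 ^ w`). -/
def Op.apply (w : ℕ) (o : Op) (a b : ℕ) : ℕ :=
  (match o with
    | Op.add => a + b
    | Op.sub => a - b
    | Op.mul => a * b
    | Op.div => a / b
    | Op.mod => a % b
    | Op.lt => if a < b then 1 else 0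
    | Op.eq => if a = b then 1 else 0) % 2 ^ w

/-- Expressions: constants, registers, array cells, and operations. -/
inductive Term where
  | const (c : ℕ)
  | reg (r : ℕ)
  | cell (a : ℕ) (idx : Term)
  | op (o : Op) (e₁ e₂ : Term)

/-- Machine states: contents of the registers and of the arrays. -/
structure State where
  reg : ℕ → ℕ
  arr : ℕ → ℕ → ℕ

/-- The value of an expression. -/
def Term.eval (w : ℕ) (s : State) : Term → ℕ
  | Term.const c => c % 2 ^ w
  | Term.reg r => s.reg r
  | Term.cell a idx => s.arr a (idx.eval w s)
  | Term.op o e₁ e₂ => o.apply w (e₁.eval w s) (e₂.eval w s)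

/-- The number of steps for evaluating an expression: one for each constant, register access,
array access and operation in it. -/
def Term.cost : Term → ℕ
  | Term.const _ => 1
  | Term.reg _ => 1
  | Term.cell _ idx => idx.cost + 1
  | Term.op _ e₁ e₂ => e₁.cost + e₂.cost + 1

/-- Programs. -/
inductive Prog where
  | skip
  | assign (r : ℕ) (e : Term)
  | store (a : ℕ) (idx e : Term)
  | seq (p₁ p₂ : Prog)
  | ite (e : Term) (p₁ p₂ : Prog)
  | while (e : Term) (p : Prog)

/-- Write to a register. -/
def State.setReg (s : State) (r v : ℕ) : State :=
  { s with reg := Function.update s.reg r v }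

/-- Write to an array cell. -/
def State.setArr (s : State) (a i v : ℕ) : State :=
  { s with arr := Function.update s.arr a (Function.update (s.arr a) i v) }

/-- `Exec w p s t s'`: on the machine with `w`-bit words, the program `p` started in state `s`
halts in state `s'` after exactly `t` steps.  A test succeeds if its value is nonzero. -/
inductive Exec (w : ℕ) : Prog → State → ℕ → State → Prop
  | skip (s : State) : Exec w Prog.skip s 1 s
  | assign (s : State) (r : ℕ) (e : Term) :
      Exec w (Prog.assign r e) s (e.cost + 1) (s.setReg r (e.eval w s))
  | store (s : State) (a : ℕ) (idx e : Term) :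
      Exec w (Prog.store a idx e) s (idx.cost + e.cost + 1)
        (s.setArr a (idx.eval w s) (e.eval w s))
  | seq {p₁ p₂ : Prog} {s s₁ s₂ : State} {t₁ t₂ : ℕ} :
      Exec w p₁ s t₁ s₁ → Exec w p₂ s₁ t₂ s₂ → Exec w (Prog.seq p₁ p₂) s (t₁ + t₂) s₂
  | ite_true {e : Term} {p₁ p₂ : Prog} {s s' : State} {t : ℕ} :
      e.eval w s ≠ 0 → Exec w p₁ s t s' → Exec w (Prog.ite e p₁ p₂) s (e.cost + 1 + t) s'
  | ite_false {e : Term} {p₁ p₂ : Prog} {s s' : State} {t : ℕ} :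
      e.eval w s = 0 → Exec w p₂ s t s' → Exec w (Prog.ite e p₁ p₂) s (e.cost + 1 + t) s'
  | while_true {e : Term} {p : Prog} {s s₁ s₂ : State} {t₁ t₂ : ℕ} :
      e.eval w s ≠ 0 → Exec w p s t₁ s₁ → Exec w (Prog.while e p) s₁ t₂ s₂ →
      Exec w (Prog.while e p) s (e.cost + 1 + t₁ + t₂) s₂
  | while_false {e : Term} {p : Prog} {s : State} :
      e.eval w s = 0 → Exec w (Prog.while e p) s (e.cost + 1) s

end WordRAM

namespace SLP

/-- The right-hand side of the `i`-th assignment as three words: `(0, a, 0)` for a letter `a`,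
and `(1, l, r)` for the pair of the variables with numbers `l` and `r`. -/
def code {σ : ℕ} (S : SLP (Fin σ)) (i : ℕ) : ℕ × ℕ × ℕ :=
  if h : i < S.size then
    match S.rhs ⟨i, h⟩ with
    | Sum.inl a => (0, a.val, 0)
    | Sum.inr (l, r) => (1, l.val, r.val)
  else (0, 0, 0)

end SLP

/-- The initial state for two programs over the alphabet `{0, …, σ - 1}` and a number `q`.
Registers `0, 1, 2, 3` hold the two sizes, `q` and `σ`; the arrays `0, 1, 2` hold the assignments
of the first program and the arrays `3, 4, 5` those of the second; everything else is `0`. -/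
def kernelInput {σ : ℕ} (S₁ S₂ : SLP (Fin σ)) (q : ℕ) : WordRAM.State where
  reg := fun r =>
    match r with
    | 0 => S₁.size
    | 1 => S₂.size
    | 2 => q
    | 3 => σ
    | _ => 0
  arr := fun a i =>
    match a with
    | 0 => (S₁.code i).1
    | 1 => (S₁.code i).2.1
    | 2 => (S₁.code i).2.2
    | 3 => (S₂.code i).1
    | 4 => (S₂.code i).2.1
    | 5 => (S₂.code i).2.2
    | _ => 0

/-!
The kernel is computed without expanding the two strings.  The assignments of the second program
are appended to those of the first one, and everything happens on the resulting `n = n₁ + n₂`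
variables.

*Few windows.*  An occurrence of a `q`-gram in the string derived from a pair `X_l X_r` lies in the
string of `X_l`, or in that of `X_r`, or crosses the boundary between the two (`occNat_append`).
The crossing ones are seen in the last `q - 1` letters of the left string and the first `q - 1`
letters of the right one.  These letters are written into a slot of length `2 * q` of a word `z`,
one slot for each variable, and they are found in time `O(q)` per variable from the prefixes and
suffixes of length at most `q - 1` of the derived strings (`IsSlots`, `Filled.pair`).  Hence the
number of occurrences in the derived strings satisfies a recursion along the assignments whose
inhomogeneous term is the number of occurrences in a slot (`IsSlots.isAdditive`).  Solving it from
the root gives each variable its multiplicity in the derivation tree; multiplicities are computed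
by passing them on from each pair to its parts, from the last variable to the first
(`IsPartialMultiplicity.step`).  So the number of occurrences of a `q`-gram is the sum of the
multiplicities over its occurrences in the slots (`sum_slots`), and the kernel is the weighted
number of pairs of equal windows of `z`, one in a slot of the first and one in a slot of the second
program (`pairWeight_eq_spectrumKernel`).

*Finding equal windows.*  The `2 * q * n` windows of length `q` of `z` are inserted from left to
right into a compact trie.  This is the construction of a suffix tree with suffix links, truncated
at depth `q` (`CompactTrie.split`, `CompactTrie.addLeaf`): the path of the next window starts at
the suffix link of the last node on the current path, and the letters matched so far, except the
first, need not be compared again.  The one node that has no suffix link yet receives it on the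
path of the next window, at a depth where the trie branches already or is made to branch
(`Search.Inv.len_next_le`, `Search.Inv.settle`, `Search.Inv.fork`).  Every step increases
`Search.potential`, which is `O(q * n)`.  Equal windows end at the same leaf, where the weights of
the windows of the first program are collected (`Search.Ready.finish`).  The edges are found in
constant time because the child of the node `v` for the letter `c` is kept in the cell `v * σ + c`
of an array; since memory is zero initially, this table needs no initialisation.

*The machine.*  Programs are analysed on unbounded natural numbers, together with a bound `B` on
the values stored.  Intermediate results are then below a fixed power of `B + 1`, so that such an
execution is one of the machine with words of `w` bits as soon as this power is at most `2 ^ w`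
(`IdealExec.exec`).  Here `B` is polynomial in the sizes of the programs, the lengths of the
strings, `q` and `σ`, since multiplicities are bounded by the lengths of the strings
(`IsPartialMultiplicity.le`).  Programs without loops are treated by weakest preconditions
(`Runs.of_wp`), loops by an invariant and a measure (`Runs.loop`).

*Memory.*  Registers: `0`–`3` hold `n₁`, `n₂`, `q`, `σ` and `4` holds `n`; `5` and `6` are loop
counters, `7` and `8` are the parts of the current pair, `9` is temporary; `10` and `11` hold the
numbers of windows in all slots and in the slots of the first program; `12`–`17` hold the fields
`i`, `u`, `h`, `hp`, `pd`, `nn` of `Search`, `18` the next node, `19` the parent of the new leaf,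
`20` the leaf of the current window, `21` the sum.  Arrays: `0`–`2` the assignments (`3`–`5` those
of the second program before joining), `6`–`8` the truncated lengths, prefixes and reversed
suffixes, `9`–`11` the slots and the bounds of their valid windows, `12` the multiplicities,
`13`–`17` the fields `len`, `pos`, `sl`, `ch`, `cnt` of `Search`.
-/

-- One list of `simp` lemmas serves all cases of a program.
set_option linter.unusedSimpArgs false

/-! ### A program logic for the word RAM -/

namespace WordRAM

/-! Expressions are written with the usual arithmetic symbols and numerals. -/

instance : Add Term := ⟨Term.op Op.add⟩
instance : Sub Term := ⟨Term.op Op.sub⟩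
instance : Mul Term := ⟨Term.op Op.mul⟩
instance : Div Term := ⟨Term.op Op.div⟩
instance : Mod Term := ⟨Term.op Op.mod⟩
instance (n : ℕ) : OfNat Term n := ⟨Term.const n⟩

infixr:50 " ;; " => Prog.seq
infix:55 " ::= " => Prog.assign

/-- The result of an operation on unbounded natural numbers. -/
def Op.ideal (o : Op) (a b : ℕ) : ℕ :=
  match o with
  | Op.add => a + b
  | Op.sub => a - b
  | Op.mul => a * b
  | Op.div => a / b
  | Op.mod => a % b
  | Op.lt => if a < b then 1 else 0
  | Op.eq => if a = b then 1 else 0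

/-- The value of an expression over unbounded natural numbers, that is, without reduction
modulo `2 ^ w`. -/
def Term.ideal (s : State) : Term → ℕ
  | Term.const c => c
  | Term.reg r => s.reg r
  | Term.cell a idx => s.arr a (idx.ideal s)
  | Term.op o e₁ e₂ => o.ideal (e₁.ideal s) (e₂.ideal s)

/-- A bound on the size of the values of an expression: if all registers and cells hold at most
`B > 0`, then its value and all intermediate results are less than `(B + 1) ^ deg`. -/
def Term.deg : Term → ℕ
  | Term.const c => c + 1
  | Term.reg _ => 1
  | Term.cell _ idx => idx.deg + 1
  | Term.op _ e₁ e₂ => e₁.deg + e₂.deg + 1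

/-- The largest degree of the expressions in a program. -/
def Prog.deg : Prog → ℕ
  | Prog.skip => 0
  | Prog.assign _ e => e.deg
  | Prog.store _ idx e => max idx.deg e.deg
  | Prog.seq p₁ p₂ => max p₁.deg p₂.deg
  | Prog.ite e p₁ p₂ => max e.deg (max p₁.deg p₂.deg)
  | Prog.while e p => max e.deg p.deg

/-- All registers and cells hold at most `B`. -/
structure State.Bounded (B : ℕ) (s : State) : Prop where
  reg : ∀ r, s.reg r ≤ B
  arr : ∀ a i, s.arr a i ≤ B

theorem State.Bounded.setReg {B : ℕ} {s : State} (h : s.Bounded B) (r : ℕ) {v : ℕ} (hv : v ≤ B) :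
    (s.setReg r v).Bounded B := by
  refine ⟨fun r' => ?_, h.arr⟩
  by_cases hr : r' = r
  · subst hr; simpa [State.setReg] using hv
  · simpa [State.setReg, hr] using h.reg r'

theorem State.Bounded.setArr {B : ℕ} {s : State} (h : s.Bounded B) (a i : ℕ) {v : ℕ} (hv : v ≤ B) :
    (s.setArr a i v).Bounded B := by
  refine ⟨h.reg, fun a' i' => ?_⟩
  by_cases ha : a' = a
  · subst ha
    by_cases hi : i' = i
    · subst hi; simpa [State.setArr] using hv
    · simpa [State.setArr, hi] using h.arr a' i'
  · simpa [State.setArr, ha] using h.arr a' i'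

theorem Term.ideal_lt {B : ℕ} {s : State} (hB : 0 < B) (h : s.Bounded B) :
    ∀ e : Term, e.ideal s < (B + 1) ^ e.deg
  | Term.const c => by
      have h1 : c + 1 < 2 ^ (c + 1) := Nat.lt_two_pow_self
      have h2 : 2 ^ (c + 1) ≤ (B + 1) ^ (c + 1) := Nat.pow_le_pow_left (by omega) _
      simp only [Term.ideal, Term.deg]; omega
  | Term.reg r => by
      have := h.reg r
      simp only [Term.ideal, Term.deg, pow_one]; omega
  | Term.cell a idx => by
      have := h.arr a (idx.ideal s)
      simp only [Term.ideal, Term.deg]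
      calc _ < (B + 1) ^ 1 := by rw [pow_one]; omega
        _ ≤ _ := Nat.pow_le_pow_right (by omega) (by omega)
  | Term.op o e₁ e₂ => by
      have h₁ := Term.ideal_lt hB h e₁
      have h₂ := Term.ideal_lt hB h e₂
      set a := e₁.ideal s
      set b := e₂.ideal s
      have hx : 0 < (B + 1) ^ e₁.deg := by positivity
      have hy : 0 < (B + 1) ^ e₂.deg := by positivity
      have hD : (B + 1) ^ (e₁.deg + e₂.deg + 1) =
          (B + 1) ^ e₁.deg * (B + 1) ^ e₂.deg * (B + 1) := by rw [pow_succ, pow_add]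
      simp only [Term.ideal, Term.deg]
      rw [hD]
      set x := (B + 1) ^ e₁.deg
      set y := (B + 1) ^ e₂.deg
      have hxy : x ≤ x * y := Nat.le_mul_of_pos_right _ hy
      have hyx : y ≤ x * y := Nat.le_mul_of_pos_left _ hx
      have hxyB : x * y * 2 ≤ x * y * (B + 1) := Nat.mul_le_mul_left _ (by omega)
      have hone : 1 ≤ x * y := Nat.mul_pos hx hy
      cases o <;> simp only [Op.ideal]
      · change a + b < _; omega
      · change a - b < _; omega
      · change a * b < _
        have : a * b ≤ x * y := Nat.mul_le_mul h₁.le h₂.le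
        omega
      · change a / b < _
        have : a / b ≤ a := Nat.div_le_self _ _
        omega
      · change a % b < _
        have : a % b ≤ a := Nat.mod_le _ _
        omega
      · split_ifs <;> omega
      · split_ifs <;> omega

theorem Op.apply_eq_mod (w : ℕ) (o : Op) (a b : ℕ) : o.apply w a b = o.ideal a b % 2 ^ w := by
  cases o <;> rfl

/-- No overflow occurs if the words are long enough. -/
theorem Term.eval_eq_ideal {B w : ℕ} {s : State} (hB : 0 < B) (h : s.Bounded B) :
    ∀ e : Term, (B + 1) ^ e.deg ≤ 2 ^ w → e.eval w s = e.ideal s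
  | Term.const c => fun hw =>
      Nat.mod_eq_of_lt ((Term.ideal_lt hB h (Term.const c)).trans_le hw)
  | Term.reg _ => fun _ => rfl
  | Term.cell a idx => fun hw => by
      have : (B + 1) ^ idx.deg ≤ 2 ^ w :=
        (Nat.pow_le_pow_right (by omega) (by simp [Term.deg])).trans hw
      simp [Term.eval, Term.ideal, Term.eval_eq_ideal hB h idx this]
  | Term.op o e₁ e₂ => fun hw => by
      have h₁ : (B + 1) ^ e₁.deg ≤ 2 ^ w :=
        (Nat.pow_le_pow_right (by omega) (by simp only [Term.deg]; omega)).trans hw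
      have h₂ : (B + 1) ^ e₂.deg ≤ 2 ^ w :=
        (Nat.pow_le_pow_right (by omega) (by simp only [Term.deg]; omega)).trans hw
      rw [Term.eval, Term.eval_eq_ideal hB h e₁ h₁, Term.eval_eq_ideal hB h e₂ h₂,
        Op.apply_eq_mod]
      exact Nat.mod_eq_of_lt ((Term.ideal_lt hB h (Term.op o e₁ e₂)).trans_le hw)

/-- Executions on unbounded natural numbers in which every stored value is at most `B`. -/
inductive IdealExec (B : ℕ) : Prog → State → ℕ → State → Prop
  | skip (s : State) : IdealExec B Prog.skip s 1 s
  | assign {s : State} {r : ℕ} {e : Term} : e.ideal s ≤ B →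
      IdealExec B (Prog.assign r e) s (e.cost + 1) (s.setReg r (e.ideal s))
  | store {s : State} {a : ℕ} {idx e : Term} : e.ideal s ≤ B →
      IdealExec B (Prog.store a idx e) s (idx.cost + e.cost + 1)
        (s.setArr a (idx.ideal s) (e.ideal s))
  | seq {p₁ p₂ : Prog} {s s₁ s₂ : State} {t₁ t₂ : ℕ} :
      IdealExec B p₁ s t₁ s₁ → IdealExec B p₂ s₁ t₂ s₂ →
      IdealExec B (Prog.seq p₁ p₂) s (t₁ + t₂) s₂
  | ite_true {e : Term} {p₁ p₂ : Prog} {s s' : State} {t : ℕ} :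
      e.ideal s ≠ 0 → IdealExec B p₁ s t s' →
      IdealExec B (Prog.ite e p₁ p₂) s (e.cost + 1 + t) s'
  | ite_false {e : Term} {p₁ p₂ : Prog} {s s' : State} {t : ℕ} :
      e.ideal s = 0 → IdealExec B p₂ s t s' →
      IdealExec B (Prog.ite e p₁ p₂) s (e.cost + 1 + t) s'
  | while_true {e : Term} {p : Prog} {s s₁ s₂ : State} {t₁ t₂ : ℕ} :
      e.ideal s ≠ 0 → IdealExec B p s t₁ s₁ → IdealExec B (Prog.while e p) s₁ t₂ s₂ →
      IdealExec B (Prog.while e p) s (e.cost + 1 + t₁ + t₂) s₂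
  | while_false {e : Term} {p : Prog} {s : State} :
      e.ideal s = 0 → IdealExec B (Prog.while e p) s (e.cost + 1) s

/-- An execution on unbounded numbers whose stored values are at most `B` is an execution on
every machine with sufficiently long words. -/
theorem IdealExec.exec {B w : ℕ} (hB : 0 < B) {p : Prog} {s s' : State} {t : ℕ}
    (h : IdealExec B p s t s') (hs : s.Bounded B) (hw : (B + 1) ^ p.deg ≤ 2 ^ w) :
    Exec w p s t s' ∧ s'.Bounded B := by
  have low : ∀ {d d' : ℕ}, d ≤ d' → (B + 1) ^ d' ≤ 2 ^ w → (B + 1) ^ d ≤ 2 ^ w :=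
    fun hd hw => (Nat.pow_le_pow_right (by omega) hd).trans hw
  induction h with
  | skip s => exact ⟨Exec.skip s, hs⟩
  | @assign s r e he =>
    have h := Exec.assign (w := w) s r e
    rw [Term.eval_eq_ideal hB hs e hw] at h
    exact ⟨h, hs.setReg r he⟩
  | @store s a idx e he =>
    have h := Exec.store (w := w) s a idx e
    rw [Term.eval_eq_ideal hB hs idx (low (le_max_left _ _) hw),
      Term.eval_eq_ideal hB hs e (low (le_max_right _ _) hw)] at h
    exact ⟨h, hs.setArr a _ he⟩
  | seq _ _ ih₁ ih₂ =>
    obtain ⟨e₁, b₁⟩ := ih₁ hs (low (le_max_left _ _) hw)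
    obtain ⟨e₂, b₂⟩ := ih₂ b₁ (low (le_max_right _ _) hw)
    exact ⟨Exec.seq e₁ e₂, b₂⟩
  | @ite_true e p₁ p₂ s s' t he _ ih =>
    obtain ⟨e₁, b₁⟩ := ih hs (low (le_max_of_le_right (le_max_left _ _)) hw)
    rw [← Term.eval_eq_ideal (w := w) hB hs e (low (le_max_left _ _) hw)] at he
    exact ⟨Exec.ite_true he e₁, b₁⟩
  | @ite_false e p₁ p₂ s s' t he _ ih =>
    obtain ⟨e₁, b₁⟩ := ih hs (low (le_max_of_le_right (le_max_right _ _)) hw)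
    rw [← Term.eval_eq_ideal (w := w) hB hs e (low (le_max_left _ _) hw)] at he
    exact ⟨Exec.ite_false he e₁, b₁⟩
  | @while_true e p s s₁ s₂ t₁ t₂ he _ _ ih₁ ih₂ =>
    obtain ⟨e₁, b₁⟩ := ih₁ hs (low (le_max_right _ _) hw)
    obtain ⟨e₂, b₂⟩ := ih₂ b₁ hw
    rw [← Term.eval_eq_ideal (w := w) hB hs e (low (le_max_left _ _) hw)] at he
    exact ⟨Exec.while_true he e₁ e₂, b₂⟩
  | @while_false e p s he =>
    rw [← Term.eval_eq_ideal (w := w) hB hs e (low (le_max_left _ _) hw)] at he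
    exact ⟨Exec.while_false he, hs⟩

/-- Total correctness with a time bound: from the state `s`, the program `p` halts within `T`
steps in a state that satisfies `Q`, and all values that it stores are at most `B`. -/
def Runs (B : ℕ) (p : Prog) (s : State) (T : ℕ) (Q : State → Prop) : Prop :=
  ∃ t s', IdealExec B p s t s' ∧ t ≤ T ∧ Q s'

theorem Runs.mono {B : ℕ} {p : Prog} {s : State} {T T' : ℕ} {Q Q' : State → Prop}
    (h : Runs B p s T Q) (hT : T ≤ T') (hQ : ∀ s', Q s' → Q' s') : Runs B p s T' Q' := by
  obtain ⟨t, s', h₁, h₂, h₃⟩ := h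
  exact ⟨t, s', h₁, h₂.trans hT, hQ _ h₃⟩

theorem Runs.seq {B : ℕ} {p₁ p₂ : Prog} {s : State} {T₁ T₂ : ℕ} {Q₁ Q : State → Prop}
    (h₁ : Runs B p₁ s T₁ Q₁) (h₂ : ∀ s', Q₁ s' → Runs B p₂ s' T₂ Q) :
    Runs B (p₁ ;; p₂) s (T₁ + T₂) Q := by
  obtain ⟨t, s', a₁, a₂, a₃⟩ := h₁
  obtain ⟨t', s'', b₁, b₂, b₃⟩ := h₂ s' a₃
  exact ⟨_, s'', IdealExec.seq a₁ b₁, by omega, b₃⟩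

theorem Runs.ite {B : ℕ} {e : Term} {p₁ p₂ : Prog} {s : State} {T : ℕ} {Q : State → Prop}
    (h₁ : e.ideal s ≠ 0 → Runs B p₁ s T Q) (h₂ : e.ideal s = 0 → Runs B p₂ s T Q) :
    Runs B (Prog.ite e p₁ p₂) s (e.cost + 1 + T) Q := by
  by_cases h : e.ideal s = 0
  · obtain ⟨t, s', a₁, a₂, a₃⟩ := h₂ h
    exact ⟨_, s', IdealExec.ite_false h a₁, by omega, a₃⟩
  · obtain ⟨t, s', a₁, a₂, a₃⟩ := h₁ h
    exact ⟨_, s', IdealExec.ite_true h a₁, by omega, a₃⟩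

/-- The rule for loops: `I` is the invariant, `μ` decreases with every pass, and a pass takes at
most `c` steps. -/
theorem Runs.loop {B : ℕ} {e : Term} {p : Prog} (I : State → Prop) (μ : State → ℕ) (c : ℕ)
    (hstep : ∀ s, I s → e.ideal s ≠ 0 → Runs B p s c (fun s' => I s' ∧ μ s' < μ s))
    {s : State} (hs : I s) {T : ℕ} (hT : (μ s + 1) * (e.cost + 1 + c) ≤ T) :
    Runs B (Prog.while e p) s T (fun s' => I s' ∧ e.ideal s' = 0) := by
  refine Runs.mono ?_ hT fun _ h => h
  clear hT
  induction hm : μ s using Nat.strong_induction_on generalizing s with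
  | _ m ih =>
    subst hm
    by_cases he : e.ideal s = 0
    · refine ⟨_, s, IdealExec.while_false he, ?_, hs, he⟩
      nlinarith
    · obtain ⟨t, s', a₁, a₂, a₃, a₄⟩ := hstep s hs he
      obtain ⟨t', s'', b₁, b₂, b₃⟩ := ih _ a₄ a₃ rfl
      refine ⟨_, s'', IdealExec.while_true he a₁ b₁, ?_, b₃⟩
      have : (μ s' + 1 + 1) * (e.cost + 1 + c) ≤ (μ s + 1) * (e.cost + 1 + c) :=
        Nat.mul_le_mul_right _ (by omega)
      rw [Nat.add_mul (μ s' + 1) 1] at this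
      omega

/-- The weakest precondition of a loop-free program, including the bound `B` on stored values. -/
def Prog.wp (B : ℕ) : Prog → (State → Prop) → State → Prop
  | Prog.skip, Q, s => Q s
  | Prog.assign r e, Q, s => e.ideal s ≤ B ∧ Q (s.setReg r (e.ideal s))
  | Prog.store a idx e, Q, s => e.ideal s ≤ B ∧ Q (s.setArr a (idx.ideal s) (e.ideal s))
  | Prog.seq p₁ p₂, Q, s => p₁.wp B (p₂.wp B Q) s
  | Prog.ite e p₁ p₂, Q, s => if e.ideal s = 0 then p₂.wp B Q s else p₁.wp B Q s
  | Prog.while _ _, _, _ => False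

/-- An upper bound on the running time of a loop-free program.  The value for loops is
irrelevant, as their weakest precondition `Prog.wp` is `False`. -/
def Prog.time : Prog → ℕ
  | Prog.skip => 1
  | Prog.assign _ e => e.cost + 1
  | Prog.store _ idx e => idx.cost + e.cost + 1
  | Prog.seq p₁ p₂ => p₁.time + p₂.time
  | Prog.ite e p₁ p₂ => e.cost + 1 + (p₁.time + p₂.time)
  | Prog.while _ _ => 0

theorem Runs.of_wp {B : ℕ} : ∀ {p : Prog} {s : State} {Q : State → Prop}, p.wp B Q s →
    Runs B p s p.time Q
  | Prog.skip, s, Q, h => ⟨1, s, IdealExec.skip s, le_rfl, h⟩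
  | Prog.assign r e, s, Q, h => ⟨_, _, IdealExec.assign h.1, le_rfl, h.2⟩
  | Prog.store a idx e, s, Q, h => ⟨_, _, IdealExec.store h.1, le_rfl, h.2⟩
  | Prog.seq p₁ p₂, s, Q, h =>
      Runs.seq (Runs.of_wp (p := p₁) h) fun _ h' => Runs.of_wp (p := p₂) h'
  | Prog.ite e p₁ p₂, s, Q, h => by
      simp only [Prog.wp] at h
      refine Runs.ite (fun he => ?_) (fun he => ?_)
      · rw [if_neg he] at h
        exact (Runs.of_wp (p := p₁) h).mono (by omega) fun _ h => h
      · rw [if_pos he] at h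
        exact (Runs.of_wp (p := p₂) h).mono (by omega) fun _ h => h
  | Prog.while _ _, _, _, h => h.elim

section Simp
variable (s : State) (e₁ e₂ : Term)

@[simp] theorem ideal_add : (e₁ + e₂).ideal s = e₁.ideal s + e₂.ideal s := rfl
@[simp] theorem ideal_sub : (e₁ - e₂).ideal s = e₁.ideal s - e₂.ideal s := rfl
@[simp] theorem ideal_mul : (e₁ * e₂).ideal s = e₁.ideal s * e₂.ideal s := rfl
@[simp] theorem ideal_div : (e₁ / e₂).ideal s = e₁.ideal s / e₂.ideal s := rfl
@[simp] theorem ideal_mod : (e₁ % e₂).ideal s = e₁.ideal s % e₂.ideal s := rfl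
@[simp] theorem ideal_lt : (Term.op Op.lt e₁ e₂).ideal s =
    if e₁.ideal s < e₂.ideal s then 1 else 0 := rfl
@[simp] theorem ideal_eq : (Term.op Op.eq e₁ e₂).ideal s =
    if e₁.ideal s = e₂.ideal s then 1 else 0 := rfl
@[simp] theorem ideal_two : (2 : Term).ideal s = 2 := rfl
@[simp] theorem ideal_zero : (0 : Term).ideal s = 0 := rfl
@[simp] theorem ideal_one : (1 : Term).ideal s = 1 := rfl
@[simp] theorem ideal_reg (r : ℕ) : (Term.reg r).ideal s = s.reg r := rfl
@[simp] theorem ideal_cell (a : ℕ) : (Term.cell a e₁).ideal s = s.arr a (e₁.ideal s) := rfl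

@[simp] theorem setReg_reg (r v r' : ℕ) :
    (s.setReg r v).reg r' = if r' = r then v else s.reg r' := by
  simp [State.setReg, Function.update_apply]
@[simp] theorem setReg_arr (r v : ℕ) : (s.setReg r v).arr = s.arr := rfl
@[simp] theorem setArr_reg (a i v : ℕ) : (s.setArr a i v).reg = s.reg := rfl
@[simp] theorem setArr_arr (a i v a' : ℕ) :
    (s.setArr a i v).arr a' = if a' = a then Function.update (s.arr a) i v else s.arr a' := by
  simp [State.setArr, Function.update_apply]

@[simp] theorem wp_skip (B : ℕ) (Q : State → Prop) : Prog.skip.wp B Q s = Q s := rfl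
@[simp] theorem wp_assign (B r : ℕ) (e : Term) (Q : State → Prop) :
    (r ::= e).wp B Q s = (e.ideal s ≤ B ∧ Q (s.setReg r (e.ideal s))) := rfl
@[simp] theorem wp_store (B a : ℕ) (idx e : Term) (Q : State → Prop) :
    (Prog.store a idx e).wp B Q s =
      (e.ideal s ≤ B ∧ Q (s.setArr a (idx.ideal s) (e.ideal s))) := rfl
@[simp] theorem wp_seq (B : ℕ) (p₁ p₂ : Prog) (Q : State → Prop) :
    (p₁ ;; p₂).wp B Q s = p₁.wp B (p₂.wp B Q) s := rfl
@[simp] theorem wp_ite (B : ℕ) (e : Term) (p₁ p₂ : Prog) (Q : State → Prop) :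
    (Prog.ite e p₁ p₂).wp B Q s = if e.ideal s = 0 then p₂.wp B Q s else p₁.wp B Q s := rfl

end Simp

end WordRAM

/-! ### Compact tries of the windows of an infinite word -/

/-- The factors of length `ℓ` of the infinite word `z` at the positions `a` and `b` are equal. -/
def Agree (z : ℕ → ℕ) (a b ℓ : ℕ) : Prop := ∀ t < ℓ, z (a + t) = z (b + t)

namespace Agree
variable {z : ℕ → ℕ} {a b c ℓ m : ℕ}

theorem refl (z : ℕ → ℕ) (a ℓ : ℕ) : Agree z a a ℓ := fun _ _ => rfl
theorem symm (h : Agree z a b ℓ) : Agree z b a ℓ := fun t ht => (h t ht).symm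
theorem trans (h : Agree z a b ℓ) (h' : Agree z b c ℓ) : Agree z a c ℓ :=
  fun t ht => (h t ht).trans (h' t ht)
theorem mono (h : Agree z a b ℓ) (hm : m ≤ ℓ) : Agree z a b m := fun t ht => h t (ht.trans_le hm)
theorem zero : Agree z a b 0 := fun _ ht => absurd ht (Nat.not_lt_zero _)
theorem snoc (h : Agree z a b ℓ) (h' : z (a + ℓ) = z (b + ℓ)) : Agree z a b (ℓ + 1) := by
  intro t ht
  rcases Nat.lt_succ_iff_lt_or_eq.mp ht with h1 | rfl
  · exact h t h1
  · exact h'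
theorem tail (h : Agree z a b ℓ) : Agree z (a + 1) (b + 1) (ℓ - 1) := by
  intro t ht
  have := h (t + 1) (by omega)
  rwa [show a + 1 + t = a + (t + 1) by omega, show b + 1 + t = b + (t + 1) by omega]
end Agree

instance (z : ℕ → ℕ) (a b ℓ : ℕ) : Decidable (Agree z a b ℓ) :=
  inferInstanceAs (Decidable (∀ t < ℓ, z (a + t) = z (b + t)))

/-- A compact trie that contains the windows of length `q` of `z` at the positions below `k`.
The nodes are `0, …, n - 1`, the root is `0`, and the node `v` represents the factor of `z` of
length `len v` at the position `pos v`.  The cell `ch (v * σ + c)` holds the child of `v` along the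
edge that starts with the letter `c`, or `0` if there is none. -/
structure CompactTrie (z : ℕ → ℕ) (q σ k n : ℕ) (len pos ch : ℕ → ℕ) : Prop where
  n_pos : 0 < n
  len_root : len 0 = 0
  len_le : ∀ v < n, len v ≤ q
  pos_lt : ∀ v < n, v ≠ 0 → pos v < k
  /-- different nodes represent different factors -/
  unique : ∀ v < n, ∀ w < n, len v = len w → Agree z (pos v) (pos w) (len v) → v = w
  /-- every inserted window is represented by a node -/
  leaf : ∀ j < k, ∃ v < n, len v = q ∧ Agree z (pos v) j q
  /-- the factor of a child properly extends that of its parent, with the letter of the edge -/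
  child : ∀ v < n, ∀ c < σ, ch (v * σ + c) ≠ 0 →
    ch (v * σ + c) < n ∧ len v < len (ch (v * σ + c)) ∧
      Agree z (pos v) (pos (ch (v * σ + c))) (len v) ∧ z (pos (ch (v * σ + c)) + len v) = c
  /-- if the factor of `y` properly extends that of `v`, then `v` has a child towards `y`, which is
  `y` or lies between `v` and `y` -/
  descend : ∀ v < n, ∀ y < n, len v < len y → Agree z (pos v) (pos y) (len v) →
    ch (v * σ + z (pos y + len v)) ≠ 0 ∧ len (ch (v * σ + z (pos y + len v))) ≤ len y ∧
      Agree z (pos (ch (v * σ + z (pos y + len v)))) (pos y)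
        (len (ch (v * σ + z (pos y + len v))))
  /-- the cells of future nodes are untouched -/
  fresh : ∀ v, n ≤ v → ∀ c < σ, ch (v * σ + c) = 0

/-- The child table is a perfect hash table: different edges have different cells. -/
theorem cell_inj {σ v w c d : ℕ} (hc : c < σ) (hd : d < σ) (h : v * σ + c = w * σ + d) :
    v = w ∧ c = d := by
  have h1 : (v * σ + c) / σ = v := by
    rw [Nat.mul_comm, Nat.mul_add_div (by omega), Nat.div_eq_of_lt hc, Nat.add_zero]
  have h2 : (w * σ + d) / σ = w := by
    rw [Nat.mul_comm, Nat.mul_add_div (by omega), Nat.div_eq_of_lt hd, Nat.add_zero]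
  have : v = w := by rw [← h1, h, h2]
  subst this
  exact ⟨rfl, by omega⟩

theorem update_cell {σ v w c d x : ℕ} {ch : ℕ → ℕ} (hc : c < σ) (hd : d < σ)
    (h : v ≠ w ∨ c ≠ d) : Function.update ch (w * σ + d) x (v * σ + c) = ch (v * σ + c) := by
  refine Function.update_of_ne (fun e => ?_) _ _
  have := cell_inj hc hd e
  omega

namespace CompactTrie
variable {z : ℕ → ℕ} {q σ k n : ℕ} {len pos ch : ℕ → ℕ}

/-- Subdividing the edge from `u` to `w` at depth `h`. -/
theorem split (T : CompactTrie z q σ k n len pos ch) (hz : ∀ x, z x < σ) {u c w h : ℕ}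
    (hu : u < n) (hc : c < σ) (hw : ch (u * σ + c) = w) (hw0 : w ≠ 0) (h1 : len u < h)
    (h2 : h < len w) :
    CompactTrie z q σ k (n + 1) (Function.update len n h) (Function.update pos n (pos w))
      (Function.update (Function.update ch (u * σ + c) n) (n * σ + z (pos w + h)) w) := by
  obtain ⟨hwn, huw, hag, hlet⟩ := T.child u hu c hc (by rw [hw]; exact hw0)
  rw [hw] at hwn huw hag hlet
  set len' := Function.update len n h with hlen'
  set pos' := Function.update pos n (pos w) with hpos'
  set ch' := Function.update (Function.update ch (u * σ + c) n) (n * σ + z (pos w + h)) w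
    with hch'
  have l1 : ∀ v < n, len' v = len v := fun v hv => Function.update_of_ne (by omega) _ _
  have l2 : len' n = h := Function.update_self ..
  have p1 : ∀ v < n, pos' v = pos v := fun v hv => Function.update_of_ne (by omega) _ _
  have p2 : pos' n = pos w := Function.update_self ..
  have c1 : ch' (n * σ + z (pos w + h)) = w := Function.update_self ..
  have c2 : ch' (u * σ + c) = n := by
    rw [hch', update_cell hc (hz _) (by omega), Function.update_self]
  have c3 : ∀ v d, d < σ → (v ≠ n ∨ d ≠ z (pos w + h)) → (v ≠ u ∨ d ≠ c) →
      ch' (v * σ + d) = ch (v * σ + d) := fun v d hd e1 e2 => by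
    rw [hch', update_cell hd (hz _) e1, update_cell hd hc e2]
  clear_value len' pos' ch'
  have hnw : w ≠ n := by omega
  -- no old node lies at the point that becomes the new node
  have nov : ∀ v < n, len v = h → ¬ Agree z (pos v) (pos w) h := by
    intro v hv e ha
    obtain ⟨-, h4, -⟩ := T.descend u hu v hv (by omega)
      (hag.trans (ha.symm.mono (by omega)))
    rw [ha (len u) h1, hlet, hw] at h4
    omega
  refine ⟨by omega, ?_, ?_, ?_, ?_, ?_, ?_, ?_, ?_⟩
  · rw [l1 0 T.n_pos, T.len_root]
  · intro v hv
    rcases Nat.lt_succ_iff_lt_or_eq.mp hv with hv | rfl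
    · rw [l1 v hv]; exact T.len_le v hv
    · rw [l2]; have := T.len_le w hwn; omega
  · intro v hv hv0
    rcases Nat.lt_succ_iff_lt_or_eq.mp hv with hv | rfl
    · rw [p1 v hv]; exact T.pos_lt v hv hv0
    · rw [p2]; exact T.pos_lt w hwn hw0
  · intro v hv y hy
    rcases Nat.lt_succ_iff_lt_or_eq.mp hv with hv | rfl <;>
      rcases Nat.lt_succ_iff_lt_or_eq.mp hy with hy | rfl
    · rw [l1 v hv, l1 y hy, p1 v hv, p1 y hy]; exact T.unique v hv y hy
    · rw [l1 v hv, l2, p1 v hv, p2]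
      intro e ha
      rw [e] at ha
      exact absurd ha (nov v hv e)
    · rw [l1 y hy, l2, p1 y hy, p2]
      intro e ha
      exact absurd ha.symm (nov y hy e.symm)
    · intros; rfl
  · intro j hj
    obtain ⟨v, hv, e, ha⟩ := T.leaf j hj
    exact ⟨v, by omega, by rw [l1 v hv, e], by rw [p1 v hv]; exact ha⟩
  · intro v hv d hd h0
    rcases Nat.lt_succ_iff_lt_or_eq.mp hv with hv | rfl
    · by_cases e : v = u ∧ d = c
      · obtain ⟨rfl, rfl⟩ := e
        rw [c2, l2, p2, l1 v hv, p1 v hv]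
        exact ⟨by omega, h1, hag, hlet⟩
      · have hc3 := c3 v d hd (by omega) (by omega)
        rw [hc3] at h0 ⊢
        obtain ⟨a1, a2, a3, a4⟩ := T.child v hv d hd h0
        rw [l1 v hv, p1 v hv, l1 _ a1, p1 _ a1]
        exact ⟨by omega, a2, a3, a4⟩
    · by_cases e : d = z (pos w + h)
      · subst e
        rw [c1, l2, p2, l1 w hwn, p1 w hwn]
        exact ⟨by omega, h2, Agree.refl _ _ _, rfl⟩
      · rw [c3 v d hd (Or.inr e) (by omega), T.fresh v le_rfl d hd] at h0
        exact absurd rfl h0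
  · intro v hv y hy
    rcases Nat.lt_succ_iff_lt_or_eq.mp hv with hv | rfl <;>
      rcases Nat.lt_succ_iff_lt_or_eq.mp hy with hy | rfl
    · rw [l1 v hv, l1 y hy, p1 v hv, p1 y hy]
      intro hvy ha
      obtain ⟨b1, b2, b3⟩ := T.descend v hv y hy hvy ha
      by_cases e : v = u ∧ z (pos y + len v) = c
      · obtain ⟨rfl, e⟩ := e
        rw [e, hw] at b2 b3
        rw [e, c2, l2, p2]
        exact ⟨by omega, by omega, b3.mono (by omega)⟩
      · have hc3 := c3 v (z (pos y + len v)) (hz _) (by omega) (by omega)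
        rw [hc3]
        obtain ⟨a1, -⟩ := T.child v hv _ (hz _) b1
        rw [l1 _ a1, p1 _ a1]
        exact ⟨b1, b2, b3⟩
    · rw [l1 v hv, l2, p1 v hv, p2]
      intro hvh ha
      obtain ⟨b1, b2, b3⟩ := T.descend v hv w hwn (by omega) ha
      by_cases e : v = u
      · subst e
        rw [hlet, c2, l2, p2]
        exact ⟨by omega, le_rfl, Agree.refl _ _ _⟩
      · have hc3 := c3 v (z (pos w + len v)) (hz _) (by omega) (by omega)
        rw [hc3]
        obtain ⟨a1, -⟩ := T.child v hv _ (hz _) b1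
        rw [l1 _ a1, p1 _ a1]
        refine ⟨b1, ?_, b3⟩
        rcases lt_trichotomy (len v) (len u) with g | g | g
        · obtain ⟨-, d2, -⟩ := T.descend v hv u hu g (ha.trans (hag.symm.mono g.le))
          rw [hag (len v) g] at d2
          omega
        · exact absurd (T.unique v hv u hu g (ha.trans (hag.symm.mono g.le))) e
        · obtain ⟨-, d2, -⟩ := T.descend u hu v hv g (hag.trans (ha.symm.mono g.le))
          rw [ha (len u) g, hlet, hw] at d2
          omega
    · rw [l1 y hy, l2, p1 y hy, p2]
      intro hhy ha
      obtain ⟨-, b2, b3⟩ := T.descend u hu y hy (by omega) (hag.trans (ha.mono h1.le))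
      rw [← ha (len u) h1, hlet, hw] at b2 b3
      rw [← b3 h h2, c1, l1 w hwn, p1 w hwn]
      exact ⟨hw0, b2, b3⟩
    · intro h'; omega
  · intro v hv d hd
    rw [c3 v d hd (by omega) (by omega)]
    exact T.fresh v (by omega) d hd

/-- Adding the window at the position `k` as a new child of the node `x`. -/
theorem addLeaf (T : CompactTrie z q σ k n len pos ch) (hz : ∀ x, z x < σ) {x : ℕ}
    (hx : x < n) (hxq : len x < q) (hag : Agree z (pos x) k (len x))
    (h0 : ch (x * σ + z (k + len x)) = 0) :
    CompactTrie z q σ (k + 1) (n + 1) (Function.update len n q) (Function.update pos n k)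
      (Function.update ch (x * σ + z (k + len x)) n) := by
  set len' := Function.update len n q with hlen'
  set pos' := Function.update pos n k with hpos'
  set ch' := Function.update ch (x * σ + z (k + len x)) n with hch'
  have l1 : ∀ v < n, len' v = len v := fun v hv => Function.update_of_ne (by omega) _ _
  have l2 : len' n = q := Function.update_self ..
  have p1 : ∀ v < n, pos' v = pos v := fun v hv => Function.update_of_ne (by omega) _ _
  have p2 : pos' n = k := Function.update_self ..
  have c1 : ch' (x * σ + z (k + len x)) = n := Function.update_self ..
  have c2 : ∀ v d, d < σ → (v ≠ x ∨ d ≠ z (k + len x)) →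
      ch' (v * σ + d) = ch (v * σ + d) := fun v d hd e1 => by
    rw [hch', update_cell hd (hz _) e1]
  clear_value len' pos' ch'
  have hn := T.n_pos
  -- no old node below `x` agrees with the new window beyond the depth of `x`
  have nov : ∀ v < n, len x < len v → ¬ Agree z (pos v) k (len v) := by
    intro v hv e ha
    obtain ⟨h4, -, -⟩ := T.descend x hx v hv e (hag.trans (ha.symm.mono (by omega)))
    rw [ha (len x) e] at h4
    exact h4 h0
  refine ⟨by omega, ?_, ?_, ?_, ?_, ?_, ?_, ?_, ?_⟩
  · rw [l1 0 T.n_pos, T.len_root]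
  · intro v hv
    rcases Nat.lt_succ_iff_lt_or_eq.mp hv with hv | rfl
    · rw [l1 v hv]; exact T.len_le v hv
    · rw [l2]
  · intro v hv hv0
    rcases Nat.lt_succ_iff_lt_or_eq.mp hv with hv | rfl
    · rw [p1 v hv]; exact (T.pos_lt v hv hv0).trans (Nat.lt_succ_self _)
    · rw [p2]; exact Nat.lt_succ_self _
  · intro v hv y hy
    rcases Nat.lt_succ_iff_lt_or_eq.mp hv with hv | rfl <;>
      rcases Nat.lt_succ_iff_lt_or_eq.mp hy with hy | rfl
    · rw [l1 v hv, l1 y hy, p1 v hv, p1 y hy]; exact T.unique v hv y hy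
    · rw [l1 v hv, l2, p1 v hv, p2]
      intro e ha
      exact absurd ha (nov v hv (by omega))
    · rw [l1 y hy, l2, p1 y hy, p2]
      intro e ha
      rw [e] at ha
      exact absurd ha.symm (nov y hy (by omega))
    · intros; rfl
  · intro j hj
    rcases Nat.lt_succ_iff_lt_or_eq.mp hj with hj | rfl
    · obtain ⟨v, hv, e, ha⟩ := T.leaf j hj
      exact ⟨v, by omega, by rw [l1 v hv, e], by rw [p1 v hv]; exact ha⟩
    · exact ⟨n, by omega, l2, by rw [p2]; exact Agree.refl _ _ _⟩
  · intro v hv d hd hne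
    rcases Nat.lt_succ_iff_lt_or_eq.mp hv with hv | rfl
    · by_cases e : v = x ∧ d = z (k + len x)
      · obtain ⟨rfl, rfl⟩ := e
        rw [c1, l2, p2, l1 v hv, p1 v hv]
        exact ⟨by omega, hxq, hag, rfl⟩
      · have hc := c2 v d hd (by omega)
        rw [hc] at hne ⊢
        obtain ⟨a1, a2, a3, a4⟩ := T.child v hv d hd hne
        rw [l1 v hv, p1 v hv, l1 _ a1, p1 _ a1]
        exact ⟨by omega, a2, a3, a4⟩
    · rw [c2 v d hd (by omega), T.fresh v le_rfl d hd] at hne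
      exact absurd rfl hne
  · intro v hv y hy
    rcases Nat.lt_succ_iff_lt_or_eq.mp hv with hv | rfl <;>
      rcases Nat.lt_succ_iff_lt_or_eq.mp hy with hy | rfl
    · rw [l1 v hv, l1 y hy, p1 v hv, p1 y hy]
      intro hvy ha
      obtain ⟨b1, b2, b3⟩ := T.descend v hv y hy hvy ha
      have e : v ≠ x ∨ z (pos y + len v) ≠ z (k + len x) := by
        by_contra! e
        obtain ⟨rfl, e⟩ := e
        rw [e] at b1
        exact b1 h0
      rw [c2 v _ (hz _) e]
      obtain ⟨a1, -⟩ := T.child v hv _ (hz _) b1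
      rw [l1 _ a1, p1 _ a1]
      exact ⟨b1, b2, b3⟩
    · rw [l1 v hv, l2, p1 v hv, p2]
      intro hvq ha
      rcases lt_trichotomy (len v) (len x) with g | g | g
      · obtain ⟨b1, b2, b3⟩ := T.descend v hv x hx g (ha.trans (hag.symm.mono g.le))
        rw [hag (len v) g] at b1 b2 b3
        rw [c2 v _ (hz _) (Or.inl (by rintro rfl; omega))]
        obtain ⟨a1, -⟩ := T.child v hv _ (hz _) b1
        rw [l1 _ a1, p1 _ a1]
        exact ⟨b1, by omega, b3.trans (hag.mono b2)⟩
      · have := T.unique v hv x hx g (ha.trans (hag.symm.mono g.le))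
        subst this
        rw [c1, l2, p2]
        exact ⟨by omega, le_rfl, Agree.refl _ _ _⟩
      · exact absurd ha (nov v hv g)
    · rw [l1 y hy, l2]
      intro h'
      have := T.len_le y hy
      omega
    · intro h'; omega
  · intro v hv d hd
    rw [c2 v d hd (by omega)]
    exact T.fresh v (by omega) d hd

/-- A window that the trie contains already may be counted as inserted. -/
theorem extend (T : CompactTrie z q σ k n len pos ch) {w : ℕ} (hw : w < n) (hq : len w = q)
    (ha : Agree z (pos w) k q) : CompactTrie z q σ (k + 1) n len pos ch :=
  { T with
    pos_lt := fun v hv h0 => (T.pos_lt v hv h0).trans (Nat.lt_succ_self _)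
    leaf := fun j hj => by
      rcases Nat.lt_succ_iff_lt_or_eq.mp hj with hj | rfl
      · exact T.leaf j hj
      · exact ⟨w, hw, hq, ha⟩ }

end CompactTrie

/-! ### Counting equal windows by truncated suffix tree construction -/

namespace CompactTrie
variable {z : ℕ → ℕ} {q σ k n : ℕ} {len pos ch : ℕ → ℕ}

/-- If the path of the window at `k` leaves the trie at the node `x`, then this window is new. -/
theorem not_agree (T : CompactTrie z q σ k n len pos ch) {x : ℕ}
    (hx : x < n) (hxq : len x < q) (hag : Agree z (pos x) k (len x))
    (h0 : ch (x * σ + z (k + len x)) = 0) {j : ℕ} (hj : j < k) : ¬ Agree z k j q := by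
  intro ha
  obtain ⟨v, hv, e, hvj⟩ := T.leaf j hj
  have hvk : Agree z (pos v) k q := hvj.trans ha.symm
  obtain ⟨h4, -, -⟩ := T.descend x hx v hv (by omega) (hag.trans (hvk.symm.mono hxq.le))
  rw [hvk _ hxq] at h4
  exact h4 h0

/-- If the path from `u` towards the window at `i` agrees with an earlier window `a` to a depth
`h` beyond `u`, then the next edge exists, and it agrees with `a` as far as it reaches. -/
theorem edge (T : CompactTrie z q σ k n len pos ch) {u i a h : ℕ} (hu : u < n)
    (hui : Agree z (pos u) i (len u)) (ha : a < k) (hai : Agree z a i h) (huh : len u < h)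
    (hh : h ≤ q) :
    ch (u * σ + z (i + len u)) ≠ 0 ∧
      Agree z (pos (ch (u * σ + z (i + len u)))) a (len (ch (u * σ + z (i + len u)))) := by
  obtain ⟨y, hy, e, hya⟩ := T.leaf a ha
  have hyi : Agree z (pos y) i h := (hya.mono hh).trans hai
  obtain ⟨h1, h2, h3⟩ := T.descend u hu y hy (by omega) (hui.trans (hyi.symm.mono huh.le))
  rw [hyi _ huh] at h1 h2 h3
  exact ⟨h1, h3.trans (hya.mono (by omega))⟩

end CompactTrie

/-- The total weight of the positions below `m` whose windows are equal to the one at `a`. -/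
def matchWeight (z wt : ℕ → ℕ) (q a m : ℕ) : ℕ :=
  ∑ x ∈ Finset.range m, if Agree z a x q then wt x else 0

/-- The total weight of the pairs of equal windows at positions `y < M ≤ x < i`. -/
def pairWeight (z wt : ℕ → ℕ) (q M i : ℕ) : ℕ :=
  ∑ x ∈ Finset.range i, if M ≤ x then wt x * matchWeight z wt q x M else 0

theorem matchWeight_congr {z wt : ℕ → ℕ} {q a b m : ℕ} (h : Agree z a b q) :
    matchWeight z wt q a m = matchWeight z wt q b m := by
  refine Finset.sum_congr rfl fun x _ => ?_
  have : Agree z a x q ↔ Agree z b x q := ⟨fun g => h.symm.trans g, fun g => h.trans g⟩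
  simp only [this]

/-- A state of the search: the trie with its suffix links `sl` and the weights `cnt` collected at
its leaves, and the state of the insertion of the window at `i`.  The first `h` letters of the
window are known to be in the trie, and `u` is a node on their path.  The node `pd`, if it is not
the root, is the inner node created for the previous window; its suffix link is due at depth `hp`.
The number of nodes is `nn`, and `acc` is the weight of the pairs of equal windows found so far. -/
structure Search where
  len : ℕ → ℕ
  pos : ℕ → ℕ
  sl : ℕ → ℕ
  ch : ℕ → ℕ
  cnt : ℕ → ℕ
  i : ℕ
  u : ℕ
  h : ℕ
  hp : ℕ
  pd : ℕ
  nn : ℕ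
  acc : ℕ

namespace Search

/-- The invariant of the search. -/
structure Inv (z wt : ℕ → ℕ) (q σ M : ℕ) (g : Search) : Prop where
  trie : CompactTrie z q σ g.i g.nn g.len g.pos g.ch
  u_lt : g.u < g.nn
  u_le : g.len g.u ≤ g.h
  u_q : g.len g.u < q
  u_agree : Agree z (g.pos g.u) g.i (g.len g.u)
  h_le : g.h ≤ q
  /-- the matched letters occur at an earlier position, hence they are in the trie -/
  h_occ : g.h = 0 ∨ ∃ a < g.i, Agree z a g.i g.h
  pd_lt : g.pd < g.nn
  /-- the suffix link of an inner node leads to the node without its first letter -/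
  link : ∀ v < g.nn, v ≠ g.pd → 0 < g.len v → g.len v < q →
    g.sl v < g.nn ∧ g.len (g.sl v) + 1 = g.len v ∧
      Agree z (g.pos (g.sl v)) (g.pos v + 1) (g.len (g.sl v))
  /-- the suffix link of the pending node is due on the path of the current window at depth `hp`,
  where an earlier window branches off -/
  pending : g.pd ≠ 0 → g.len g.pd = g.hp + 1 ∧ g.hp + 1 < q ∧
    Agree z (g.pos g.pd + 1) g.i g.hp ∧ g.len g.u ≤ g.hp ∧ g.hp ≤ g.h ∧
      ∃ a < g.i, Agree z a g.i g.hp ∧ z (a + g.hp) ≠ z (g.i + g.hp)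
  nn_le : g.nn ≤ 2 * g.i + 1
  /-- a leaf has collected the weights of the windows of the first `M` positions that end there -/
  cnt_leaf : ∀ v < g.nn, g.len v = q → g.cnt v = matchWeight z wt q (g.pos v) (min g.i M)
  cnt_fresh : ∀ v, g.nn ≤ v → g.cnt v = 0
  acc_eq : g.acc = pairWeight z wt q M g.i

/-- The beginning of the search, with the root as the only node. -/
def init : Search where
  len := fun _ => 0
  pos := fun _ => 0
  sl := fun _ => 0
  ch := fun _ => 0
  cnt := fun _ => 0
  i := 0
  u := 0
  h := 0
  hp := 0
  pd := 0
  nn := 1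
  acc := 0

/-- Every pass through the loop of the search increases this potential: passing on to the next
window increases `i` by `1` and decreases the depths `len u` and `h` by at most `1` each;
following an edge and matching a letter increase one of the two depths. -/
def potential (g : Search) : ℕ := 3 * g.i + g.len g.u + g.h

/-- The next node on the path of the current window. -/
def next (z : ℕ → ℕ) (σ : ℕ) (g : Search) : ℕ := g.ch (g.u * σ + z (g.i + g.len g.u))

/-- Setting the suffix link of the pending node. -/
def settle (g : Search) : Search :=
  { g with sl := Function.update g.sl g.pd g.u, pd := 0 }

/-- Following an edge. -/
def descend (g : Search) (w : ℕ) : Search := { g with u := w }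

/-- Matching one more letter. -/
def extend (g : Search) : Search := { g with h := g.h + 1 }

/-- Subdividing the edge from `u` to `w` at depth `h`. The new node is the target of the suffix
link of the pending node, and becomes the pending node. -/
def fork (z : ℕ → ℕ) (σ : ℕ) (g : Search) (w : ℕ) : Search :=
  { g with
    len := Function.update g.len g.nn g.h
    pos := Function.update g.pos g.nn (g.pos w)
    ch := Function.update (Function.update g.ch (g.u * σ + z (g.i + g.len g.u)) g.nn)
      (g.nn * σ + z (g.pos w + g.h)) w
    sl := Function.update g.sl g.pd g.nn
    pd := g.nn
    nn := g.nn + 1 }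

/-- Adding the current window as a child of the node `x` of depth `h`. -/
def addLeaf (z : ℕ → ℕ) (q σ : ℕ) (g : Search) (x : ℕ) : Search :=
  { g with
    len := Function.update g.len g.nn q
    pos := Function.update g.pos g.nn g.i
    ch := Function.update g.ch (x * σ + z (g.i + g.h)) g.nn
    nn := g.nn + 1 }

/-- Passing on to the next window when the leaf `f` of the current one is known. -/
def finish (wt : ℕ → ℕ) (M : ℕ) (g : Search) (f : ℕ) : Search :=
  { g with
    cnt := if g.i < M then Function.update g.cnt f (g.cnt f + wt g.i) else g.cnt
    acc := if g.i < M then g.acc else g.acc + wt g.i * g.cnt f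
    i := g.i + 1
    u := if g.len g.u = 0 then g.u else g.sl g.u
    h := g.h - 1
    hp := g.h - 1 }

variable {z wt : ℕ → ℕ} {q σ M : ℕ} {g : Search}

theorem inv_init (hq : 0 < q) : init.Inv z wt q σ M where
  trie :=
    { n_pos := Nat.one_pos
      len_root := rfl
      len_le := fun _ _ => Nat.zero_le _
      pos_lt := fun v hv h0 => absurd (Nat.lt_one_iff.mp hv) h0
      unique := fun v hv w hw _ _ => (Nat.lt_one_iff.mp hv).trans (Nat.lt_one_iff.mp hw).symm
      leaf := fun j hj => absurd hj (Nat.not_lt_zero _)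
      child := fun v _ c _ h => absurd rfl h
      descend := fun v _ y _ h => absurd h (Nat.lt_irrefl _)
      fresh := fun _ _ _ _ => rfl }
  u_lt := Nat.one_pos
  u_le := le_rfl
  u_q := hq
  u_agree := Agree.zero
  h_le := Nat.zero_le _
  h_occ := Or.inl rfl
  pd_lt := Nat.one_pos
  link := fun v _ _ h => absurd h (Nat.lt_irrefl _)
  pending := fun h => absurd rfl h
  nn_le := le_rfl
  cnt_leaf := fun v _ _ => by simp [init, matchWeight]
  cnt_fresh := fun _ _ => rfl
  acc_eq := by simp [init, pairWeight]

namespace Inv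

/-- At the depth `hp`, the node `u` on the path is the target of the pending suffix link. -/
theorem settle (I : g.Inv z wt q σ M) (h : g.len g.u = g.hp) : g.settle.Inv z wt q σ M :=
  { I with
    pd_lt := I.trie.n_pos
    link := by
      intro v hv h0 h1 h2
      simp only [Search.settle] at hv h0 h1 h2 ⊢
      by_cases e : v = g.pd
      · subst e
        obtain ⟨a1, -, a3, -⟩ := I.pending h0
        rw [Function.update_self, h]
        refine ⟨I.u_lt, a1.symm, ?_⟩
        rw [← h] at a3 ⊢
        exact I.u_agree.trans a3.symm
      · rw [Function.update_of_ne e]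
        exact I.link v hv e h1 h2
    pending := fun h => absurd rfl h }

/-- The edge to the next node agrees with the current window up to the matched depth. -/
theorem agree_next (I : g.Inv z wt q σ M) (hz : ∀ x, z x < σ) {w : ℕ} (hw : w = g.next z σ)
    (h0 : w ≠ 0) : Agree z (g.pos w) g.i (min (g.len w) g.h) := by
  rw [Search.next] at hw
  rcases Nat.lt_or_ge (g.len g.u) g.h with h | h
  · rcases I.h_occ with h' | ⟨a, ha, hai⟩
    · omega
    · obtain ⟨-, c2⟩ := I.trie.edge I.u_lt I.u_agree ha hai h I.h_le
      rw [← hw] at c2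
      exact (c2.mono (min_le_left _ _)).trans (hai.mono (min_le_right _ _))
  · have h1 : g.len g.u = g.h := le_antisymm I.u_le h
    obtain ⟨-, -, c3, -⟩ := I.trie.child g.u I.u_lt _ (hz _) (hw ▸ h0)
    rw [← hw, h1] at c3
    have h2 := I.u_agree
    rw [h1] at h2
    exact (c3.symm.trans h2).mono (min_le_right _ _)

theorem next_spec (I : g.Inv z wt q σ M) (hz : ∀ x, z x < σ) {w : ℕ} (hw : w = g.next z σ)
    (h0 : w ≠ 0) : w < g.nn ∧ g.len g.u < g.len w ∧
      z (g.pos w + g.len g.u) = z (g.i + g.len g.u) ∧ g.len w ≤ q ∧ g.pos w < g.i := by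
  obtain ⟨c1, c2, -, c4⟩ := I.trie.child g.u I.u_lt _ (hz _) (hw ▸ h0 : g.next z σ ≠ 0)
  rw [Search.next] at hw
  rw [← hw] at c1 c2 c4
  exact ⟨c1, c2, c4, I.trie.len_le w c1, I.trie.pos_lt w c1 h0⟩

/-- While a suffix link is pending, no edge from above its target depth `hp` reaches beyond that
depth within the matched part: the target is a branching point of the trie, hence a node. -/
theorem len_next_le (I : g.Inv z wt q σ M) (hz : ∀ x, z x < σ)
    (hs : g.pd ≠ 0 → g.len g.u ≠ g.hp) {w : ℕ} (hw : w = g.next z σ) (hpd : g.pd ≠ 0) :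
    w ≠ 0 ∧ (g.len w ≤ g.hp ∨ g.hp = g.h) := by
  obtain ⟨-, b2, -, b4, b5, a, b6, b7, b8⟩ := I.pending hpd
  have hlt : g.len g.u < g.hp := lt_of_le_of_ne b4 (hs hpd)
  obtain ⟨c1, c2⟩ := I.trie.edge I.u_lt I.u_agree b6 b7 hlt (by omega)
  rw [← Search.next, ← hw] at c1 c2
  refine ⟨c1, ?_⟩
  by_contra! hcon
  have h2 := I.agree_next hz hw c1 g.hp (by omega)
  exact b8 ((c2 g.hp hcon.1).symm.trans h2)

/-- Going down to a node inside the matched part needs no comparison beyond the first letter. -/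
theorem descend (I : g.Inv z wt q σ M) (hz : ∀ x, z x < σ)
    (hs : g.pd ≠ 0 → g.len g.u ≠ g.hp) {w : ℕ} (hw : w = g.next z σ) (h0 : w ≠ 0)
    (hle : g.len w ≤ g.h) (hq : g.len w ≠ q) : (g.descend w).Inv z wt q σ M := by
  obtain ⟨c1, c2, c3, c4, c5⟩ := I.next_spec hz hw h0
  have ha := I.agree_next hz hw h0
  rw [min_eq_left hle] at ha
  exact
  { I with
    u_lt := c1
    u_le := hle
    u_q := lt_of_le_of_ne c4 hq
    u_agree := ha
    pending := fun hpd => by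
      obtain ⟨b1, b2, b3, b4, b5, b6⟩ := I.pending hpd
      have h' := (I.len_next_le hz hs hw hpd).2
      refine ⟨b1, b2, b3, ?_, b5, b6⟩
      change g.len w ≤ g.hp
      omega }

theorem extend (I : g.Inv z wt q σ M) (hz : ∀ x, z x < σ) {w : ℕ} (hw : w = g.next z σ)
    (h0 : w ≠ 0) (hlt : g.h < g.len w) (he : z (g.pos w + g.h) = z (g.i + g.h)) :
    g.extend.Inv z wt q σ M := by
  obtain ⟨c1, c2, c3, c4, c5⟩ := I.next_spec hz hw h0
  have ha := I.agree_next hz hw h0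
  rw [min_eq_right hlt.le] at ha
  exact
  { I with
    u_le := I.u_le.trans (Nat.le_succ _)
    h_le := by change g.h + 1 ≤ q; omega
    h_occ := Or.inr ⟨g.pos w, c5, ha.snoc he⟩
    pending := fun hpd => by
      obtain ⟨b1, b2, b3, b4, b5, b6⟩ := I.pending hpd
      exact ⟨b1, b2, b3, b4, b5.trans (Nat.le_succ _), b6⟩ }

end Inv

/-- The situation after the leaf `f` of the current window has been found or created.  The pending
node, if it is not the root, is now the one created for the current window, at depth `h`. -/
structure Ready (z wt : ℕ → ℕ) (q σ M : ℕ) (g : Search) (f : ℕ) : Prop where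
  trie : CompactTrie z q σ (g.i + 1) g.nn g.len g.pos g.ch
  u_lt : g.u < g.nn
  u_le : g.len g.u ≤ g.h
  u_q : g.len g.u < q
  u_agree : Agree z (g.pos g.u) g.i (g.len g.u)
  h_le : g.h ≤ q
  h_occ : g.h = 0 ∨ ∃ a < g.i, Agree z a g.i g.h
  pd_lt : g.pd < g.nn
  link : ∀ v < g.nn, v ≠ g.pd → 0 < g.len v → g.len v < q →
    g.sl v < g.nn ∧ g.len (g.sl v) + 1 = g.len v ∧
      Agree z (g.pos (g.sl v)) (g.pos v + 1) (g.len (g.sl v))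
  pending : g.pd ≠ 0 → g.len g.pd = g.h ∧ g.h < q ∧ Agree z (g.pos g.pd) g.i g.h ∧
    g.len g.u < g.h ∧ ∃ a < g.i, Agree z a g.i g.h ∧ z (a + g.h) ≠ z (g.i + g.h)
  nn_le : g.nn ≤ 2 * g.i + 3
  cnt_leaf : ∀ v < g.nn, g.len v = q → g.cnt v = matchWeight z wt q (g.pos v) (min g.i M)
  cnt_fresh : ∀ v, g.nn ≤ v → g.cnt v = 0
  acc_eq : g.acc = pairWeight z wt q M g.i
  f_lt : f < g.nn
  f_len : g.len f = q
  f_agree : Agree z (g.pos f) g.i q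

/-- The window is in the trie already. -/
theorem Inv.found (I : g.Inv z wt q σ M) (hz : ∀ x, z x < σ)
    (hs : g.pd ≠ 0 → g.len g.u ≠ g.hp) {w : ℕ} (hw : w = g.next z σ) (h0 : w ≠ 0)
    (hle : g.len w ≤ g.h) (hq : g.len w = q) : g.Ready z wt q σ M w := by
  obtain ⟨c1, c2, c3, c4, c5⟩ := I.next_spec hz hw h0
  have ha := I.agree_next hz hw h0
  rw [min_eq_left hle, hq] at ha
  exact
  { I with
    trie := I.trie.extend c1 hq ha
    pending := fun hpd => by
      obtain ⟨b1, b2, b3, b4, b5, b6⟩ := I.pending hpd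
      have := (I.len_next_le hz hs hw hpd).2
      have := I.h_le
      omega
    nn_le := I.nn_le.trans (by omega)
    f_lt := c1
    f_len := hq
    f_agree := ha }

/-- The window leaves the trie at the node `u`. -/
theorem Inv.leaf (I : g.Inv z wt q σ M) (hz : ∀ x, z x < σ)
    (hs : g.pd ≠ 0 → g.len g.u ≠ g.hp) (h0 : g.next z σ = 0) :
    (g.addLeaf z q σ g.u).Ready z wt q σ M g.nn ∧ g.pd = 0 := by
  have hpd : g.pd = 0 := by
    by_contra hpd
    exact (I.len_next_le hz hs rfl hpd).1 h0
  have hh : g.len g.u = g.h := by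
    refine le_antisymm I.u_le (not_lt.mp fun h => ?_)
    rcases I.h_occ with h' | ⟨a, ha, hai⟩
    · omega
    · exact (I.trie.edge I.u_lt I.u_agree ha hai h I.h_le).1 h0
  have h0' : g.ch (g.u * σ + z (g.i + g.len g.u)) = 0 := h0
  have T := I.trie.addLeaf hz I.u_lt I.u_q I.u_agree h0'
  have hne : g.u ≠ g.nn := I.u_lt.ne
  have l1 : ∀ v < g.nn, Function.update g.len g.nn q v = g.len v :=
    fun v hv => Function.update_of_ne hv.ne _ _
  have p1 : ∀ v < g.nn, Function.update g.pos g.nn g.i v = g.pos v :=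
    fun v hv => Function.update_of_ne hv.ne _ _
  refine ⟨?_, hpd⟩
  constructor <;> simp only [Search.addLeaf, hpd]
  · rw [hh] at T; exact T
  · exact I.u_lt.trans (Nat.lt_succ_self _)
  · rw [l1 _ I.u_lt]; exact I.u_le
  · rw [l1 _ I.u_lt]; exact I.u_q
  · rw [l1 _ I.u_lt, p1 _ I.u_lt]; exact I.u_agree
  · exact I.h_le
  · exact I.h_occ
  · exact Nat.succ_pos _
  · intro v hv e1 e2 e3
    rcases Nat.lt_succ_iff_lt_or_eq.mp hv with hv | rfl
    · rw [l1 v hv] at e2 e3 ⊢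
      obtain ⟨d1, d2, d3⟩ := I.link v hv (by rw [hpd]; exact e1) e2 e3
      rw [p1 v hv, l1 _ d1, p1 _ d1]
      exact ⟨by omega, d2, d3⟩
    · rw [Function.update_self] at e3; omega
  · intro h; exact absurd rfl h
  · have := I.nn_le; omega
  · intro v hv e
    rcases Nat.lt_succ_iff_lt_or_eq.mp hv with hv | rfl
    · rw [l1 v hv] at e; rw [p1 v hv]; exact I.cnt_leaf v hv e
    · rw [I.cnt_fresh _ le_rfl, Function.update_self]
      refine (Finset.sum_eq_zero fun x hx => if_neg ?_).symm
      rw [Finset.mem_range] at hx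
      exact I.trie.not_agree I.u_lt I.u_q I.u_agree h0' (by omega)
  · intro v hv; exact I.cnt_fresh v (by omega)
  · exact I.acc_eq
  · exact Nat.lt_succ_self _
  · exact Function.update_self ..
  · rw [Function.update_self]; exact Agree.refl _ _ _

/-- The window leaves the trie inside the edge from `u` to `w`.  If a suffix link is pending, then
it is due exactly at the new inner node. -/
theorem Inv.fork (I : g.Inv z wt q σ M) (hz : ∀ x, z x < σ)
    (hs : g.pd ≠ 0 → g.len g.u ≠ g.hp) {w : ℕ} (hw : w = g.next z σ) (h0 : w ≠ 0)
    (hlt : g.h < g.len w) (hne : z (g.pos w + g.h) ≠ z (g.i + g.h)) :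
    ((g.fork z σ w).addLeaf z q σ g.nn).Ready z wt q σ M (g.nn + 1) := by
  obtain ⟨c1, c2, c3, c4, c5⟩ := I.next_spec hz hw h0
  have ha := I.agree_next hz hw h0
  rw [min_eq_right hlt.le] at ha
  have huh : g.len g.u < g.h := by
    refine lt_of_le_of_ne I.u_le fun e => hne ?_
    rw [← e]; exact c3
  have hpd : g.pd ≠ 0 → g.hp = g.h := fun hpd => by
    obtain ⟨-, -, -, -, b5, -⟩ := I.pending hpd
    have := (I.len_next_le hz hs hw hpd).2
    omega
  have T := I.trie.split hz I.u_lt (hz _) (show g.ch _ = w from hw.symm) h0 huh hlt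
  have l1 : ∀ v < g.nn, Function.update g.len g.nn g.h v = g.len v :=
    fun v hv => Function.update_of_ne hv.ne _ _
  have l2 : Function.update g.len g.nn g.h g.nn = g.h := Function.update_self ..
  have p1 : ∀ v < g.nn, Function.update g.pos g.nn (g.pos w) v = g.pos v :=
    fun v hv => Function.update_of_ne hv.ne _ _
  have p2 : Function.update g.pos g.nn (g.pos w) g.nn = g.pos w := Function.update_self ..
  have hch : Function.update (Function.update g.ch (g.u * σ + z (g.i + g.len g.u)) g.nn)
      (g.nn * σ + z (g.pos w + g.h)) w (g.nn * σ + z (g.i + g.h)) = 0 := by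
    rw [update_cell (hz _) (hz _) (Or.inr hne.symm),
      update_cell (hz _) (hz _) (Or.inl I.u_lt.ne')]
    exact I.trie.fresh _ le_rfl _ (hz _)
  have hxq : g.h < q := by omega
  have T' := T.addLeaf (x := g.nn) hz (Nat.lt_succ_self _) (by rw [l2]; exact hxq)
    (by rw [l2, p2]; exact ha) (by rw [l2]; exact hch)
  have hnew : ∀ j < g.i, ¬ Agree z g.i j q := fun j hj =>
    T.not_agree (x := g.nn) (Nat.lt_succ_self _) (by rw [l2]; exact hxq)
      (by rw [l2, p2]; exact ha) (by rw [l2]; exact hch) hj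
  rw [l2] at T'
  set len' := Function.update g.len g.nn g.h
  set pos' := Function.update g.pos g.nn (g.pos w)
  set ch' := Function.update (Function.update g.ch (g.u * σ + z (g.i + g.len g.u)) g.nn)
      (g.nn * σ + z (g.pos w + g.h)) w
  have l3 : ∀ v < g.nn + 1, Function.update len' (g.nn + 1) q v = len' v :=
    fun v hv => Function.update_of_ne hv.ne _ _
  have p3 : ∀ v < g.nn + 1, Function.update pos' (g.nn + 1) g.i v = pos' v :=
    fun v hv => Function.update_of_ne hv.ne _ _
  have hu := I.u_lt
  constructor <;> simp only [Search.addLeaf, Search.fork]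
  · exact T'
  · omega
  · rw [l3 _ (by omega), l1 _ hu]; exact I.u_le
  · rw [l3 _ (by omega), l1 _ hu]; exact I.u_q
  · rw [l3 _ (by omega), l1 _ hu, p3 _ (by omega), p1 _ hu]; exact I.u_agree
  · exact I.h_le
  · exact I.h_occ
  · omega
  · intro v hv e1 e2 e3
    rcases Nat.lt_succ_iff_lt_or_eq.mp hv with hv | rfl
    · have hv' : v < g.nn := by omega
      rw [l3 v hv, l1 v hv'] at e2 e3 ⊢
      rw [p3 v hv, p1 v hv']
      by_cases e : v = g.pd
      · have hpd0 : g.pd ≠ 0 := by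
          rintro h
          rw [e, h, I.trie.len_root] at e2
          omega
        obtain ⟨b1, -, b3, -⟩ := I.pending hpd0
        rw [hpd hpd0] at b1 b3
        rw [e, Function.update_self, l3 _ (Nat.lt_succ_self _), l2, p3 _ (Nat.lt_succ_self _), p2]
        exact ⟨by omega, b1.symm, ha.trans b3.symm⟩
      · rw [Function.update_of_ne e]
        obtain ⟨d1, d2, d3⟩ := I.link v hv' e e2 e3
        rw [l3 _ (by omega), l1 _ d1, p3 _ (by omega), p1 _ d1]
        exact ⟨by omega, d2, d3⟩
    · rw [Function.update_self] at e3; omega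
  · intro _
    rw [l3 _ (by omega), l2, p3 _ (by omega), p2, l3 _ (by omega), l1 _ hu]
    exact ⟨rfl, hxq, ha, huh, g.pos w, c5, ha, hne⟩
  · have := I.nn_le; omega
  · intro v hv e
    rcases Nat.lt_succ_iff_lt_or_eq.mp hv with hv | rfl
    · rw [l3 v hv] at e
      rw [p3 v hv]
      rcases Nat.lt_succ_iff_lt_or_eq.mp hv with hv | rfl
      · rw [l1 v hv] at e; rw [p1 v hv]; exact I.cnt_leaf v hv e
      · rw [l2] at e; omega
    · rw [I.cnt_fresh _ (by omega), Function.update_self]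
      refine (Finset.sum_eq_zero fun x hx => if_neg ?_).symm
      rw [Finset.mem_range] at hx
      exact hnew x (by omega)
  · intro v hv; exact I.cnt_fresh v (by omega)
  · exact I.acc_eq
  · omega
  · exact Function.update_self ..
  · rw [Function.update_self]; exact Agree.refl _ _ _

/-- After accounting for the current window and following the suffix link of `u`, the invariant
holds for the next window. -/
theorem Ready.finish {f : ℕ} (R : g.Ready z wt q σ M f) :
    (g.finish wt M f).Inv z wt q σ M ∧ g.potential < (g.finish wt M f).potential := by
  have hcnt : g.cnt f = matchWeight z wt q g.i (min g.i M) := by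
    rw [R.cnt_leaf f R.f_lt R.f_len, matchWeight_congr R.f_agree]
  -- the new node on the path: the target of the suffix link of the old one
  have hu : ∃ u', u' = (if g.len g.u = 0 then g.u else g.sl g.u) ∧ u' < g.nn ∧
      g.len u' = g.len g.u - 1 ∧ Agree z (g.pos u') (g.i + 1) (g.len u') := by
    refine ⟨_, rfl, ?_⟩
    split_ifs with h0
    · refine ⟨R.u_lt, by omega, ?_⟩
      rw [h0]; exact Agree.zero
    · have hne : g.u ≠ g.pd := by
        intro e
        have hpd : g.pd ≠ 0 := by
          intro h
          rw [e, h, R.trie.len_root] at h0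
          exact h0 rfl
        obtain ⟨d1, -, -, d4, -⟩ := R.pending hpd
        rw [e] at d4
        omega
      obtain ⟨d1, d2, d3⟩ := R.link g.u R.u_lt hne (by omega) R.u_q
      refine ⟨d1, by omega, d3.trans ?_⟩
      have := R.u_agree.tail
      rwa [show g.len g.u - 1 = g.len (g.sl g.u) by omega] at this
  obtain ⟨u', hu', e1, e2, e3⟩ := hu
  have h_le := R.h_le
  have u_q := R.u_q
  have u_le := R.u_le
  refine ⟨?_, ?_⟩
  · constructor <;> simp only [Search.finish, ← hu']
    · exact R.trie
    · exact e1
    · omega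
    · omega
    · exact e3
    · omega
    · rcases R.h_occ with h | ⟨a, ha, hai⟩
      · left; omega
      · exact Or.inr ⟨a + 1, by omega, hai.tail⟩
    · exact R.pd_lt
    · exact R.link
    · intro hpd
      obtain ⟨d1, d2, d3, d4, a, d5, d6, d7⟩ := R.pending hpd
      refine ⟨by omega, by omega, d3.tail, by omega, le_rfl, a + 1, by omega, d6.tail, ?_⟩
      rwa [show a + 1 + (g.h - 1) = a + g.h by omega,
        show g.i + 1 + (g.h - 1) = g.i + g.h by omega]
    · have := R.nn_le; omega
    · intro v hv hvq
      have hold := R.cnt_leaf v hv hvq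
      split_ifs with hM
      · rw [min_eq_left (by omega : g.i + 1 ≤ M), matchWeight, Finset.sum_range_succ]
        rw [min_eq_left hM.le, matchWeight] at hold hcnt
        by_cases e : v = f
        · rw [e] at hold
          rw [e, Function.update_self, if_pos R.f_agree, hold]
        · rw [Function.update_of_ne e, if_neg, hold, add_zero]
          intro ha
          refine e (R.trie.unique v hv f R.f_lt (hvq.trans R.f_len.symm) ?_)
          rw [hvq]
          exact ha.trans R.f_agree.symm
      · rw [min_eq_right (by omega)] at hold ⊢
        exact hold
    · intro v hv
      have h1 := R.f_lt
      split_ifs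
      · rw [Function.update_of_ne (by omega)]; exact R.cnt_fresh v hv
      · exact R.cnt_fresh v hv
    · rw [pairWeight, Finset.sum_range_succ, ← pairWeight, R.acc_eq]
      split_ifs with h1 h2 h2
      · omega
      · rfl
      · rw [hcnt, min_eq_right h2]
      · omega
  · simp only [potential, Search.finish, ← hu']
    omega

end Search

/-! ### Occurrences of `q`-grams in strings derived by straight line programs -/

/-- The number of occurrences in `T` of the word of length `q` with the letters `p 0, …`. -/
def occNat (q : ℕ) (T : List ℕ) (p : ℕ → ℕ) : ℕ :=
  ((Finset.range T.length).filter fun k =>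
    k + q ≤ T.length ∧ ∀ t < q, T.getD (k + t) 0 = p t).card

theorem take_drop_eq_ofFn_iff {σ q k : ℕ} (hq : 0 < q) (T : List (Fin σ)) (p : Fin q → Fin σ) :
    (T.drop k).take q = List.ofFn p ↔ k + q ≤ T.length ∧
      ∀ t, (h : t < q) → (T.map Fin.val).getD (k + t) 0 = (p ⟨t, h⟩).val := by
  constructor
  · intro h
    have hl := congrArg List.length h
    simp only [List.length_take, List.length_drop, List.length_ofFn] at hl
    refine ⟨by omega, fun t ht => ?_⟩
    have h1 : ((T.drop k).take q)[t]? = (List.ofFn p)[t]? := by rw [h]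
    rw [List.getElem?_take_of_lt ht, List.getElem?_drop, List.getElem?_ofFn, dif_pos ht] at h1
    simp [List.getD_eq_getElem?_getD, h1]
  · rintro ⟨hk, h⟩
    refine List.ext_getElem (by simp; omega) fun t h1 h2 => ?_
    have ht : t < q := by simpa using h2
    have := h t ht
    rw [List.getD_eq_getElem _ _ (by simp; omega)] at this
    simp only [List.getElem_map] at this
    simp only [List.getElem_take, List.getElem_drop, List.getElem_ofFn]
    exact Fin.ext this

theorem qgramFeature_eq {σ q : ℕ} (hq : 0 < q) (T : List (Fin σ)) (p : Fin q → Fin σ) :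
    qgramFeature q T p =
      occNat q (T.map Fin.val) (fun t => if h : t < q then (p ⟨t, h⟩).val else 0) := by
  have key : ∀ k, (T.drop k).take q = List.ofFn p ↔ k + q ≤ T.length ∧
      ∀ t < q, (T.map Fin.val).getD (k + t) 0 = if h : t < q then (p ⟨t, h⟩).val else 0 := by
    intro k
    rw [take_drop_eq_ofFn_iff hq]
    refine and_congr_right fun _ => forall_congr' fun t => forall_congr' fun h => ?_
    rw [dif_pos h]
  unfold qgramFeature occNat Occ
  refine Finset.card_nbij' (fun k => k - 1) (fun k => k + 1) ?_ ?_ ?_ ?_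
  · intro k hk
    simp only [Finset.coe_filter, Finset.mem_Icc, List.length_ofFn, Set.mem_ofPred_eq, key,
      Finset.mem_range, List.length_map] at hk ⊢
    exact ⟨by omega, hk.2⟩
  · intro k hk
    simp only [Finset.coe_filter, Finset.mem_Icc, List.length_ofFn, Set.mem_ofPred_eq, key,
      Finset.mem_range, List.length_map, Nat.add_sub_cancel] at hk ⊢
    exact ⟨by omega, hk.2⟩
  · intro k hk
    simp only [Finset.coe_filter, Finset.mem_Icc, Set.mem_ofPred_eq] at hk
    dsimp only
    omega
  · intro k _
    dsimp only
    omega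

theorem occNat_singleton {q : ℕ} (hq : 0 < q) (a : ℕ) (p : ℕ → ℕ) :
    occNat q [a] p = if q = 1 ∧ a = p 0 then 1 else 0 := by
  unfold occNat
  by_cases h1 : q = 1
  · subst h1
    by_cases h2 : a = p 0 <;> simp [Finset.filter_singleton, h2]
  · rw [if_neg (by tauto), Finset.card_eq_zero, Finset.filter_eq_empty_iff]
    intro k _ hk
    have : k + q ≤ 1 := hk.1
    omega

/-- An occurrence in a concatenation lies in one of the two parts or crosses the boundary. -/
theorem occNat_append (q : ℕ) (A B : List ℕ) (p : ℕ → ℕ) :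
    occNat q (A ++ B) p = occNat q A p + occNat q B p +
      ((Finset.range A.length).filter fun k => A.length < k + q ∧ k + q ≤ A.length + B.length ∧
        ∀ t < q, (A ++ B).getD (k + t) 0 = p t).card := by
  simp only [occNat, Finset.card_filter, List.length_append]
  rw [Finset.sum_range_add, add_right_comm, ← Finset.sum_add_distrib]
  congr 1
  · refine Finset.sum_congr rfl fun k _ => ?_
    by_cases h : k + q ≤ A.length
    · have e : (∀ t < q, (A ++ B).getD (k + t) 0 = p t) ↔ ∀ t < q, A.getD (k + t) 0 = p t := by
        refine forall_congr' fun t => forall_congr' fun ht => ?_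
        rw [List.getD_append _ _ _ _ (by omega)]
      rw [if_neg (fun h' : A.length < k + q ∧ _ => by omega), add_zero]
      simp only [e, h, show k + q ≤ A.length + B.length by omega, true_and]
    · rw [if_neg (fun h' : k + q ≤ A.length ∧ _ => h h'.1), zero_add]
      simp only [show A.length < k + q by omega, true_and]
  · refine Finset.sum_congr rfl fun k _ => ?_
    have e : (∀ t < q, (A ++ B).getD (A.length + k + t) 0 = p t) ↔
        ∀ t < q, B.getD (k + t) 0 = p t := by
      refine forall_congr' fun t => forall_congr' fun ht => ?_
      rw [List.getD_append_right _ _ _ _ (by omega),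
        show A.length + k + t - A.length = k + t by omega]
    simp only [e, show A.length + k + q ≤ A.length + B.length ↔ k + q ≤ B.length by omega]

/-- The arrays `kd`, `lf`, `rt` describe the assignments of two straight line programs, one after
the other: the variables below `n₁` belong to the first one, and those from `n₁` up to `n` to the
second one.  The string derived from the variable `i` is `val i`. -/
structure IsCode (n₁ n : ℕ) (kd lf rt : ℕ → ℕ) (val : ℕ → List ℕ) : Prop where
  pos : 0 < n₁
  lt : n₁ < n
  letter : ∀ i < n, kd i = 0 → val i = [lf i]
  pair : ∀ i < n, kd i ≠ 0 → lf i < i ∧ rt i < i ∧ val i = val (lf i) ++ val (rt i)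
  part : ∀ i < n, kd i ≠ 0 → n₁ ≤ i → n₁ ≤ lf i ∧ n₁ ≤ rt i

theorem IsCode.val_pos {n₁ n : ℕ} {kd lf rt : ℕ → ℕ} {val : ℕ → List ℕ}
    (hc : IsCode n₁ n kd lf rt val) : ∀ i < n, 0 < (val i).length := by
  intro i
  induction i using Nat.strong_induction_on with
  | _ i ih =>
    intro hi
    by_cases h : kd i = 0
    · simp [hc.letter i hi h]
    · obtain ⟨h1, h2, h3⟩ := hc.pair i hi h
      rw [h3, List.length_append]
      have := ih _ h1 (h1.trans hi)
      omega

/-- The function `g` on variables satisfies the recursion `g i = e i + g l + g r` for the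
assignments of pairs, and `g i = e i` for the assignments of letters. -/
def IsAdditive (n : ℕ) (kd lf rt g e : ℕ → ℕ) : Prop :=
  ∀ i < n, g i = e i + if kd i = 0 then 0 else g (lf i) + g (rt i)

/-- `V i` is the multiplicity of the variable `i` in the derivation trees of the two programs,
expressed through its effect on additive functions. -/
def IsMultiplicity (n₁ n : ℕ) (kd lf rt V : ℕ → ℕ) : Prop :=
  ∀ g e, IsAdditive n kd lf rt g e →
    ∑ i ∈ Finset.range n, V i * e i = g (n₁ - 1) + g (n - 1)

/-- In the word `z`, the slot of length `2 * q` of a pair `i` holds the last `q - 1` letters of the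
left part and the first `q - 1` letters of the right part around the position `q - 1`; the slot of
a letter holds this letter at the position `q - 1`.  The windows that start in the slot at the
positions from `lo i` up to `hi i` are the ones inside the string written there. -/
structure IsSlots (q n : ℕ) (kd lf rt : ℕ → ℕ) (val : ℕ → List ℕ) (z lo hi : ℕ → ℕ) : Prop where
  letter : ∀ i < n, kd i = 0 → z (i * (2 * q) + (q - 1)) = lf i ∧ lo i = 0 ∧
    hi i = if q < 2 then 1 else 0
  left : ∀ i < n, kd i ≠ 0 → ∀ t < min (val (lf i)).length (q - 1),
    z (i * (2 * q) + (q - 2 - t)) = (val (lf i)).getD ((val (lf i)).length - 1 - t) 0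
  right : ∀ i < n, kd i ≠ 0 → ∀ t < min (val (rt i)).length (q - 1),
    z (i * (2 * q) + (q - 1 + t)) = (val (rt i)).getD t 0
  lo_eq : ∀ i < n, kd i ≠ 0 → lo i = q - 1 - min (val (lf i)).length (q - 1)
  hi_eq : ∀ i < n, kd i ≠ 0 → hi i = min (val (rt i)).length (q - 1)

/-- The number of occurrences of `p` among the windows of the slot `i`. -/
def slotOcc (q : ℕ) (z lo hi p : ℕ → ℕ) (i : ℕ) : ℕ :=
  ((Finset.range (2 * q)).filter fun j => (j < hi i ∧ lo i < j + 1) ∧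
    ∀ t < q, z (i * (2 * q) + j + t) = p t).card

theorem IsSlots.isAdditive {q n₁ n : ℕ} {kd lf rt : ℕ → ℕ} {val : ℕ → List ℕ} {z lo hi : ℕ → ℕ}
    (hq : 0 < q) (hc : IsCode n₁ n kd lf rt val) (hs : IsSlots q n kd lf rt val z lo hi)
    (p : ℕ → ℕ) :
    IsAdditive n kd lf rt (fun i => occNat q (val i) p) (slotOcc q z lo hi p) := by
  intro i hi'
  by_cases hk : kd i = 0
  · obtain ⟨h1, h2, h3⟩ := hs.letter i hi' hk
    simp only [hk, if_true, add_zero, hc.letter i hi' hk, slotOcc, h2, h3]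
    rw [occNat_singleton hq]
    by_cases hq1 : q = 1
    · subst hq1
      simp only [Nat.sub_self, add_zero] at h1
      by_cases h4 : lf i = p 0
      · rw [if_pos ⟨rfl, h4⟩, eq_comm, Finset.card_eq_one]
        refine ⟨0, ?_⟩
        ext j
        simp only [Finset.mem_filter, Finset.mem_range, Finset.mem_singleton]
        constructor
        · rintro ⟨-, ⟨h, -⟩, -⟩
          simpa using h
        · rintro rfl
          refine ⟨by omega, by simp, fun t ht => ?_⟩
          obtain rfl : t = 0 := by omega
          simpa [h1] using h4
      · rw [if_neg (by tauto), eq_comm, Finset.card_eq_zero, Finset.filter_eq_empty_iff]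
        rintro j - ⟨⟨h, -⟩, h'⟩
        obtain rfl : j = 0 := by simpa using h
        have := h' 0 Nat.one_pos
        simp only [add_zero] at this
        rw [h1] at this
        exact h4 this
    · rw [if_neg (by tauto), eq_comm, Finset.card_eq_zero, Finset.filter_eq_empty_iff]
      rintro j - ⟨⟨h, -⟩, -⟩
      rw [if_neg (by omega)] at h
      omega
  · obtain ⟨-, -, hv⟩ := hc.pair i hi' hk
    have hl := hs.left i hi' hk
    have hr := hs.right i hi' hk
    simp only [hk, if_false, hv, slotOcc, hs.lo_eq i hi' hk, hs.hi_eq i hi' hk]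
    rw [occNat_append, add_comm]
    congr 1
    set A := val (lf i)
    set B := val (rt i)
    -- the slot and the concatenation agree around the boundary
    have hz : ∀ j, j + A.length + 1 ≥ q → j + 1 < q + min B.length (q - 1) →
        q - 1 - min A.length (q - 1) ≤ j →
        z (i * (2 * q) + j) = (A ++ B).getD (j + A.length + 1 - q) 0 := by
      intro j h1 h2 h3
      rcases Nat.lt_or_ge j (q - 1) with h | h
      · have := hl (q - 2 - j) (by omega)
        rw [show q - 2 - (q - 2 - j) = j by omega] at this
        rw [this, List.getD_append _ _ _ _ (by omega)]
        congr 1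
        omega
      · have := hr (j - (q - 1)) (by omega)
        rw [show q - 1 + (j - (q - 1)) = j by omega] at this
        rw [this, List.getD_append_right _ _ _ _ (by omega)]
        congr 1
        omega
    refine Finset.card_nbij' (fun k => k + (q - 1) - A.length) (fun j => j + A.length - (q - 1))
      ?_ ?_ ?_ ?_
    · intro k hk
      simp only [Finset.coe_filter, Finset.mem_range, Set.mem_ofPred_eq] at hk ⊢
      obtain ⟨h1, h2, h3, h4⟩ := hk
      refine ⟨by omega, ⟨by omega, by omega⟩, fun t ht => ?_⟩
      rw [← h4 t ht, add_assoc, hz _ (by omega) (by omega) (by omega)]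
      congr 1
      omega
    · intro j hj
      simp only [Finset.coe_filter, Finset.mem_range, Set.mem_ofPred_eq] at hj ⊢
      obtain ⟨h1, ⟨h2, h3⟩, h4⟩ := hj
      refine ⟨by omega, by omega, by omega, fun t ht => ?_⟩
      rw [← h4 t ht, add_assoc, hz _ (by omega) (by omega) (by omega)]
      congr 1
      omega
    · intro k hk
      simp only [Finset.coe_filter, Finset.mem_range, Set.mem_ofPred_eq] at hk
      dsimp only
      omega
    · intro j hj
      simp only [Finset.coe_filter, Finset.mem_range, Set.mem_ofPred_eq] at hj
      dsimp only
      omega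

/-- The weight of a position of `z`: the multiplicity of the variable of its slot if the window is
valid, and `0` otherwise. -/
def slotWeight (q : ℕ) (V lo hi : ℕ → ℕ) (x : ℕ) : ℕ :=
  V (x / (2 * q)) * ((if x % (2 * q) < hi (x / (2 * q)) then 1 else 0) *
    (if lo (x / (2 * q)) < x % (2 * q) + 1 then 1 else 0))

theorem slotWeight_le {q : ℕ} {V lo hi : ℕ → ℕ} {x b : ℕ} (h : V (x / (2 * q)) ≤ b) :
    slotWeight q V lo hi x ≤ b := by
  unfold slotWeight
  split_ifs <;> simp [h]

/-- Summing over positions is summing over slots and over the positions in each slot. -/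
theorem sum_slotWeight (q : ℕ) (hq : 0 < q) (z V lo hi p : ℕ → ℕ) (n : ℕ) :
    ∑ x ∈ Finset.range (n * (2 * q)),
      (if ∀ t < q, z (x + t) = p t then slotWeight q V lo hi x else 0) =
      ∑ i ∈ Finset.range n, V i * slotOcc q z lo hi p i := by
  induction n with
  | zero => simp
  | succ n ih =>
    rw [Nat.succ_mul, Finset.sum_range_add, ih, Finset.sum_range_succ]
    congr 1
    rw [slotOcc, Finset.card_filter, Finset.mul_sum]
    refine Finset.sum_congr rfl fun j hj => ?_
    rw [Finset.mem_range] at hj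
    have h1 : (n * (2 * q) + j) / (2 * q) = n := by
      rw [Nat.mul_comm n, Nat.mul_add_div (by omega), Nat.div_eq_of_lt hj, add_zero]
    have h2 : (n * (2 * q) + j) % (2 * q) = j := by
      rw [Nat.mul_comm n, Nat.mul_add_mod, Nat.mod_eq_of_lt hj]
    simp only [slotWeight, h1, h2]
    by_cases a : j < hi n <;> by_cases b : lo n < j + 1 <;>
      by_cases c : ∀ t < q, z (n * (2 * q) + j + t) = p t <;> simp [a, b, c]

/-- The weighted number of occurrences of `p` in the slots of the first and of the second program
is the number of its occurrences in the two strings. -/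
theorem sum_slots {q n₁ n : ℕ} {kd lf rt : ℕ → ℕ} {val : ℕ → List ℕ} {z lo hi V : ℕ → ℕ}
    (hq : 0 < q) (hc : IsCode n₁ n kd lf rt val) (hs : IsSlots q n kd lf rt val z lo hi)
    (hV : IsMultiplicity n₁ n kd lf rt V) (p : ℕ → ℕ) :
    (∑ x ∈ Finset.range (n₁ * (2 * q)),
      (if ∀ t < q, z (x + t) = p t then slotWeight q V lo hi x else 0) =
        occNat q (val (n₁ - 1)) p) ∧
    (∑ x ∈ Finset.range (n * (2 * q)), (if n₁ * (2 * q) ≤ x then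
      (if ∀ t < q, z (x + t) = p t then slotWeight q V lo hi x else 0) else 0) =
        occNat q (val (n - 1)) p) := by
  have hadd := hs.isAdditive hq hc p
  have hpos := hc.pos
  have hlt := hc.lt
  -- the variables of the second program do not refer to the first one, so that the occurrences
  -- in the strings of the first program alone, extended by zero, are additive too
  have h1 : ∑ x ∈ Finset.range (n₁ * (2 * q)),
      (if ∀ t < q, z (x + t) = p t then slotWeight q V lo hi x else 0) =
        occNat q (val (n₁ - 1)) p := by
    rw [sum_slotWeight q hq]
    have := hV (fun i => if i < n₁ then occNat q (val i) p else 0)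
      (fun i => if i < n₁ then slotOcc q z lo hi p i else 0) ?_
    · rw [if_pos (by omega), if_neg (by omega), add_zero] at this
      rw [← this]
      refine Finset.sum_subset_zero_on_sdiff (Finset.range_mono hlt.le) (fun i hi => ?_)
        (fun i hi => ?_)
      · simp only [Finset.mem_sdiff, Finset.mem_range] at hi
        rw [if_neg hi.2, mul_zero]
      · rw [if_pos (Finset.mem_range.mp hi)]
    · intro i hi
      by_cases hk : kd i = 0
      · have := hadd i hi
        simp only [hk, if_true, add_zero] at this ⊢
        rw [this]
      · obtain ⟨a1, a2, -⟩ := hc.pair i hi hk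
        have := hadd i hi
        simp only [hk, if_false] at this ⊢
        split_ifs with b1 b2 b3 b3 <;> try omega
        all_goals
          have := hc.part i hi hk (by omega)
          omega
  refine ⟨h1, ?_⟩
  have hall : ∑ x ∈ Finset.range (n * (2 * q)),
      (if ∀ t < q, z (x + t) = p t then slotWeight q V lo hi x else 0) =
        occNat q (val (n₁ - 1)) p + occNat q (val (n - 1)) p := by
    rw [sum_slotWeight q hq]
    exact hV _ _ hadd
  have hle : n₁ * (2 * q) ≤ n * (2 * q) := Nat.mul_le_mul_right _ hlt.le
  obtain ⟨d, hd⟩ := Nat.exists_eq_add_of_le hle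
  rw [hd, Finset.sum_range_add] at hall ⊢
  rw [h1] at hall
  rw [Finset.sum_eq_zero, zero_add]
  · simp only [Nat.le_add_right, if_true]
    omega
  · intro x hx
    rw [Finset.mem_range] at hx
    rw [if_neg (by omega)]

/-- The kernel is the total weight of the pairs of equal windows. -/
theorem pairWeight_eq_spectrumKernel {σ q M N : ℕ} {z wt : ℕ → ℕ}
    (hz : ∀ x, z x < σ) {T₁ T₂ : List (Fin σ)}
    (h₁ : ∀ p : Fin q → Fin σ, ∑ x ∈ Finset.range M, (if ∀ t < q, z (x + t) =
      (if h : t < q then (p ⟨t, h⟩).val else 0) then wt x else 0) = qgramFeature q T₁ p)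
    (h₂ : ∀ p : Fin q → Fin σ, ∑ x ∈ Finset.range N, (if M ≤ x then (if ∀ t < q, z (x + t) =
      (if h : t < q then (p ⟨t, h⟩).val else 0) then wt x else 0) else 0) =
        qgramFeature q T₂ p) :
    pairWeight z wt q M N = spectrumKernel q T₁ T₂ := by
  let win : ℕ → Fin q → Fin σ := fun x t => ⟨z (x + t), hz _⟩
  have hwin : ∀ x (p : Fin q → Fin σ), (∀ t < q, z (x + t) =
      (if h : t < q then (p ⟨t, h⟩).val else 0)) ↔ win x = p := by
    intro x p
    constructor
    · intro h
      funext t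
      have := h t.val t.isLt
      rw [dif_pos t.isLt] at this
      exact Fin.ext this
    · rintro rfl t ht
      rw [dif_pos ht]
  have hag : ∀ x y, Agree z x y q ↔ win y = win x := by
    intro x y
    constructor
    · intro h
      funext t
      exact Fin.ext (h t.val t.isLt).symm
    · intro h t ht
      exact (congrArg Fin.val (congrFun h ⟨t, ht⟩)).symm
  simp only [hwin] at h₁ h₂
  unfold spectrumKernel pairWeight matchWeight
  simp only [← h₁, ← h₂, hag]
  have hcomm : ∀ a b : (Fin q → Fin σ) → ℕ, ∑ p, a p * b p = ∑ p, b p * a p :=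
    fun a b => Finset.sum_congr rfl fun p _ => Nat.mul_comm _ _
  rw [hcomm]
  simp only [Finset.sum_mul]
  rw [Finset.sum_comm]
  refine Finset.sum_congr rfl fun x _ => ?_
  by_cases hx : M ≤ x
  · simp [hx, ite_mul]
  · simp [hx]

/-! ### The search on the word RAM -/

theorem matchWeight_le {z V lo hi : ℕ → ℕ} {q N τ a m : ℕ} (hV : ∀ x < N, V (x / (2 * q)) ≤ τ)
    (hm : m ≤ N) : matchWeight z (slotWeight q V lo hi) q a m ≤ N * τ := by
  refine (Finset.sum_le_card_nsmul (Finset.range m) _ τ fun x hx => ?_).trans ?_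
  · rw [Finset.mem_range] at hx
    have := slotWeight_le (lo := lo) (hi := hi) (hV x (hx.trans_le hm))
    split_ifs <;> omega
  · rw [Finset.card_range, smul_eq_mul]
    exact Nat.mul_le_mul_right _ hm

theorem pairWeight_le {z V lo hi : ℕ → ℕ} {q M N τ i : ℕ} (hV : ∀ x < N, V (x / (2 * q)) ≤ τ)
    (hM : M ≤ N) (hi' : i ≤ N) :
    pairWeight z (slotWeight q V lo hi) q M i ≤ N * τ * (N * τ) := by
  refine (Finset.sum_le_card_nsmul (Finset.range i) _ (τ * (N * τ)) fun x hx => ?_).trans ?_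
  · rw [Finset.mem_range] at hx
    have := slotWeight_le (lo := lo) (hi := hi) (hV x (by omega))
    split_ifs
    · exact Nat.mul_le_mul this (matchWeight_le hV hM)
    · exact Nat.zero_le _
  · rw [Finset.card_range, smul_eq_mul, Nat.mul_assoc]
    exact Nat.mul_le_mul_right _ hi'

namespace WordRAM

/-- `slotWeight` at the position in register `12`.  The two comparisons yield `0` or `1`. -/
def weightTerm : Term :=
  Term.cell 12 (Term.reg 12 / (2 * Term.reg 2)) *
    (Term.op Op.lt (Term.reg 12 % (2 * Term.reg 2))
      (Term.cell 11 (Term.reg 12 / (2 * Term.reg 2))) *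
    Term.op Op.lt (Term.cell 10 (Term.reg 12 / (2 * Term.reg 2)))
      (Term.reg 12 % (2 * Term.reg 2) + 1))

/-- Set the suffix link of the pending node when its depth is reached.  If no node is pending, then
register `16` is `0`, and at most the suffix link of the root is changed, which is never used. -/
def settleProg : Prog :=
  Prog.ite (Term.op Op.eq (Term.cell 13 (Term.reg 13)) (Term.reg 15))
    (Prog.store 15 (Term.reg 16) (Term.reg 13) ;; 16 ::= 0)
    Prog.skip

/-- Go along the path of the current window by one edge or one letter, or find or create its leaf.
Register `20` receives the leaf, or `0` if it is not known yet.  If the window leaves the trie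
inside an edge, then register `19` receives the node that subdivides this edge, and otherwise the
node `u`; the new leaf becomes its child. -/
def probeProg : Prog :=
  18 ::= Term.cell 16 (Term.reg 13 * Term.reg 3 +
    Term.cell 9 (Term.reg 12 + Term.cell 13 (Term.reg 13))) ;;
  20 ::= 0 ;;
  Prog.ite (Term.op Op.lt 0 (Term.reg 18) *
      Term.op Op.lt (Term.cell 13 (Term.reg 18)) (Term.reg 14 + 1))
    (Prog.ite (Term.op Op.eq (Term.cell 13 (Term.reg 18)) (Term.reg 2))
      (20 ::= Term.reg 18)
      (13 ::= Term.reg 18))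
    (Prog.ite (Term.op Op.lt 0 (Term.reg 18) *
        Term.op Op.eq (Term.cell 9 (Term.cell 14 (Term.reg 18) + Term.reg 14))
          (Term.cell 9 (Term.reg 12 + Term.reg 14)))
      (14 ::= Term.reg 14 + 1)
      (Prog.ite (Term.reg 18)
        (19 ::= Term.reg 17 ;;
          Prog.store 16 (Term.reg 13 * Term.reg 3 +
            Term.cell 9 (Term.reg 12 + Term.cell 13 (Term.reg 13))) (Term.reg 19) ;;
          Prog.store 16 (Term.reg 19 * Term.reg 3 +
            Term.cell 9 (Term.cell 14 (Term.reg 18) + Term.reg 14)) (Term.reg 18) ;;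
          Prog.store 13 (Term.reg 19) (Term.reg 14) ;;
          Prog.store 14 (Term.reg 19) (Term.cell 14 (Term.reg 18)) ;;
          Prog.store 15 (Term.reg 16) (Term.reg 19) ;;
          16 ::= Term.reg 19 ;;
          17 ::= Term.reg 17 + 1)
        (19 ::= Term.reg 13) ;;
      20 ::= Term.reg 17 ;;
      Prog.store 16 (Term.reg 19 * Term.reg 3 +
        Term.cell 9 (Term.reg 12 + Term.reg 14)) (Term.reg 20) ;;
      Prog.store 13 (Term.reg 20) (Term.reg 2) ;;
      Prog.store 14 (Term.reg 20) (Term.reg 12) ;;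
      17 ::= Term.reg 17 + 1))

/-- If the leaf of the current window is known, account for the window and pass on to the next. -/
def finishProg : Prog :=
  Prog.ite (Term.reg 20)
    (Prog.ite (Term.op Op.lt (Term.reg 12) (Term.reg 11))
        (Prog.store 17 (Term.reg 20) (Term.cell 17 (Term.reg 20) + weightTerm))
        (21 ::= Term.reg 21 + weightTerm * Term.cell 17 (Term.reg 20)) ;;
      14 ::= Term.reg 14 - 1 ;;
      15 ::= Term.reg 14 ;;
      Prog.ite (Term.cell 13 (Term.reg 13)) (13 ::= Term.cell 15 (Term.reg 13)) Prog.skip ;;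
      12 ::= Term.reg 12 + 1)
    Prog.skip

/-- One step of the search. -/
def searchBody : Prog := settleProg ;; probeProg ;; finishProg

/-- The machine state `s` represents the state `g` of the search. -/
structure SearchState (z V lo hi : ℕ → ℕ) (q σ M N : ℕ) (s : State) (g : Search) : Prop where
  q : s.reg 2 = q
  σ : s.reg 3 = σ
  N : s.reg 10 = N
  M : s.reg 11 = M
  i : s.reg 12 = g.i
  u : s.reg 13 = g.u
  h : s.reg 14 = g.h
  hp : s.reg 15 = g.hp
  pd : s.reg 16 = g.pd
  nn : s.reg 17 = g.nn
  acc : s.reg 21 = g.acc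
  z : s.arr 9 = z
  lo : s.arr 10 = lo
  hi : s.arr 11 = hi
  V : s.arr 12 = V
  len : s.arr 13 = g.len
  pos : s.arr 14 = g.pos
  sl : s.arr 15 = g.sl
  ch : s.arr 16 = g.ch
  cnt : s.arr 17 = g.cnt

variable {z V lo hi : ℕ → ℕ} {q σ M N B : ℕ} {s : State} {g : Search}

/-- After `settleProg`, the depth of `u` is not the one where a suffix link is due. -/
theorem settle_runs (hB : 2 * N + 3 ≤ B) (R : SearchState z V lo hi q σ M N s g)
    (I : g.Inv z (slotWeight q V lo hi) q σ M) (hN : g.i < N) :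
    Runs B settleProg s settleProg.time (fun s' => ∃ g', SearchState z V lo hi q σ M N s' g' ∧
      g'.Inv z (slotWeight q V lo hi) q σ M ∧ (g'.pd ≠ 0 → g'.len g'.u ≠ g'.hp) ∧
      g'.i = g.i ∧ g'.potential = g.potential) := by
  refine Runs.of_wp ?_
  have hu := I.u_lt
  have hnn := I.nn_le
  by_cases h : g.len g.u = g.hp
  · simp [settleProg, R.len, R.u, R.hp, h, R.pd]
    refine ⟨by omega, g.settle, ?_, I.settle h, fun h' => absurd rfl h', rfl, rfl⟩
    constructor <;> simp [R.q, R.σ, R.N, R.M, R.i, R.u, R.h, R.hp, R.pd, R.nn, R.acc, R.z, R.lo,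
      R.hi, R.V, R.len, R.pos, R.sl, R.ch, R.cnt, Search.settle]
  · simp [settleProg, R.len, R.u, R.hp, h]
    exact ⟨g, R, I, fun _ => h, rfl, rfl⟩

/-- `probeProg` either increases the potential or makes the leaf of the current window known. -/
theorem probe_runs (hB : 2 * N + 3 ≤ B) (hqB : q ≤ B) (hz : ∀ x, z x < σ)
    (R : SearchState z V lo hi q σ M N s g)
    (I : g.Inv z (slotWeight q V lo hi) q σ M) (hs : g.pd ≠ 0 → g.len g.u ≠ g.hp)
    (hN : g.i < N) :
    Runs B probeProg s probeProg.time (fun s' => ∃ g', SearchState z V lo hi q σ M N s' g' ∧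
      g'.i = g.i ∧
      ((s'.reg 20 = 0 ∧ g'.Inv z (slotWeight q V lo hi) q σ M ∧ g.potential < g'.potential) ∨
      (s'.reg 20 ≠ 0 ∧ g'.Ready z (slotWeight q V lo hi) q σ M (s'.reg 20) ∧
        g'.potential = g.potential))) := by
  refine Runs.of_wp ?_
  have hu := I.u_lt
  have hnn := I.nn_le
  obtain ⟨w, hw⟩ : ∃ w, w = g.next z σ := ⟨_, rfl⟩
  have hw' : g.ch (g.u * σ + z (g.i + g.len g.u)) = w := hw.symm
  have hh := I.h_le
  have hn0 := I.trie.n_pos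
  simp only [probeProg, wp_seq, wp_assign, ideal_cell, ideal_add, ideal_mul, ideal_reg, R.u, R.σ,
    R.i, R.len, R.z, R.ch, hw', setReg_arr]
  by_cases h0 : w = 0
  · obtain ⟨L, hpd⟩ := I.leaf hz hs (hw ▸ h0)
    subst h0
    simp [R.u, R.σ, R.i, R.len, R.z, R.ch, R.h, R.nn, R.q, R.pos]
    refine ⟨by omega, by omega, by omega, by omega, by omega, _, ?_, ?_, Or.inr ⟨by omega, L, ?_⟩⟩
    · constructor <;> simp [R.q, R.σ, R.N, R.M, R.i, R.u, R.h, R.hp, R.pd, R.nn, R.acc, R.z,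
        R.lo, R.hi, R.V, R.len, R.pos, R.sl, R.ch, R.cnt, Search.addLeaf]
    · rfl
    · simp [Search.potential, Search.addLeaf, Function.update_of_ne hu.ne]
  · obtain ⟨c1, c2, c3, c4, c5⟩ := I.next_spec hz hw h0
    by_cases h1 : g.len w ≤ g.h
    · by_cases h2 : g.len w = q
      · have L := I.found hz hs hw h0 h1 h2
        have h1' : q < g.h + 1 := by omega
        simp [R.len, R.h, R.q, h2, Nat.pos_of_ne_zero h0, h1']
        refine ⟨by omega, _, ?_, rfl, Or.inr ⟨h0, L, rfl⟩⟩
        constructor <;> simp [R.q, R.σ, R.N, R.M, R.i, R.u, R.h, R.hp, R.pd, R.nn, R.acc, R.z,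
          R.lo, R.hi, R.V, R.len, R.pos, R.sl, R.ch, R.cnt]
      · have L := I.descend hz hs hw h0 h1 h2
        simp [R.len, R.h, R.q, h2, Nat.pos_of_ne_zero h0, Nat.lt_succ_iff.mpr h1]
        refine ⟨by omega, g.descend w, ?_, rfl, L, ?_⟩
        · constructor <;> simp [R.q, R.σ, R.N, R.M, R.i, R.u, R.h, R.hp, R.pd, R.nn, R.acc, R.z,
            R.lo, R.hi, R.V, R.len, R.pos, R.sl, R.ch, R.cnt, Search.descend]
        · simp [Search.potential, Search.descend, c2]
    · have h1' : ¬ g.len w < g.h + 1 := by omega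
      by_cases h2 : z (g.pos w + g.h) = z (g.i + g.h)
      · have L := I.extend hz hw h0 (by omega) h2
        simp [R.len, R.h, R.pos, R.z, R.i, h2, Nat.pos_of_ne_zero h0, h1']
        refine ⟨by omega, by omega, g.extend, ?_, rfl, L, ?_⟩
        · constructor <;> simp [R.q, R.σ, R.N, R.M, R.i, R.u, R.h, R.hp, R.pd, R.nn, R.acc, R.z,
            R.lo, R.hi, R.V, R.len, R.pos, R.sl, R.ch, R.cnt, Search.extend]
        · simp [Search.potential, Search.extend]
      · have L := I.fork hz hs hw h0 (by omega) h2
        simp [R.len, R.h, R.pos, R.z, R.i, h2, Nat.pos_of_ne_zero h0, h1', h0, R.u, R.σ, R.nn,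
          R.ch, R.sl, R.pd, R.q]
        refine ⟨by omega, by omega, by omega, by omega, by omega, by omega, by omega,
          by omega, by omega, by omega, _, ?_, ?_, L, ?_⟩
        · constructor <;> simp [R.q, R.σ, R.N, R.M, R.i, R.u, R.h, R.hp, R.pd, R.nn, R.acc, R.z,
            R.lo, R.hi, R.V, R.len, R.pos, R.sl, R.ch, R.cnt, Search.addLeaf, Search.fork]
        · rfl
        · simp [Search.potential, Search.addLeaf, Search.fork, Function.update_of_ne hu.ne,
            Function.update_of_ne (show g.u ≠ g.nn + 1 by omega)]

theorem finish_runs (hB : 2 * N + 3 ≤ B) (hqB : q ≤ B) {τ : ℕ} (hV : ∀ x < N, V (x / (2 * q)) ≤ τ)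
    (hτ : N * τ * (N * τ) + N * τ ≤ B) (hMN : M ≤ N) (R : SearchState z V lo hi q σ M N s g)
    (I : g.Ready z (slotWeight q V lo hi) q σ M (s.reg 20)) (h20 : s.reg 20 ≠ 0) (hN : g.i < N) :
    Runs B finishProg s finishProg.time (fun s' =>
      SearchState z V lo hi q σ M N s' (g.finish (slotWeight q V lo hi) M (s.reg 20))) := by
  refine Runs.of_wp ?_
  obtain ⟨J, -⟩ := I.finish
  have hm : ∀ a m, m ≤ N → matchWeight z (slotWeight q V lo hi) q a m ≤ N * τ := fun a m h =>
    matchWeight_le hV h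
  have hp := pairWeight_le (z := z) (lo := lo) (hi := hi) (i := g.i + 1) hV hMN hN
  have hcnt := I.cnt_leaf _ I.f_lt I.f_len
  have hcnt' := J.cnt_leaf _ I.f_lt I.f_len
  have hacc := J.acc_eq
  have hu := J.u_lt
  have hnn := J.nn_le
  have hh := I.h_le
  have hwt : weightTerm.ideal s = slotWeight q V lo hi g.i := by
    simp [weightTerm, slotWeight, R.i, R.q, R.V, R.lo, R.hi]
  generalize hf : s.reg 20 = f at *
  simp only [Search.finish] at hcnt' hacc hu hnn
  have hm1 := hm (g.pos f) (min (g.i + 1) M) (by omega)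
  by_cases h1 : g.i < M <;> by_cases h2 : g.len g.u = 0
  all_goals
    simp only [h1, h2, if_true, if_false, Function.update_self] at hcnt' hacc hu
    simp [finishProg, hf, h20, h1, h2, R.i, R.M, R.cnt, R.h, R.len, R.u, R.acc, R.sl, hwt]
  · refine ⟨by omega, by omega, by omega, ?_⟩
    constructor <;> simp [R.q, R.σ, R.N, R.M, R.i, R.u, R.h, R.hp, R.pd, R.nn, R.acc,
      R.z, R.lo, R.hi, R.V, R.len, R.pos, R.sl, R.ch, R.cnt, Search.finish, h1, h2]
  · refine ⟨by omega, by omega, by omega, by omega, ?_⟩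
    constructor <;> simp [R.q, R.σ, R.N, R.M, R.i, R.u, R.h, R.hp, R.pd, R.nn, R.acc,
      R.z, R.lo, R.hi, R.V, R.len, R.pos, R.sl, R.ch, R.cnt, Search.finish, h1, h2]
  · refine ⟨by omega, by omega, by omega, ?_⟩
    constructor <;> simp [R.q, R.σ, R.N, R.M, R.i, R.u, R.h, R.hp, R.pd, R.nn, R.acc,
      R.z, R.lo, R.hi, R.V, R.len, R.pos, R.sl, R.ch, R.cnt, Search.finish, h1, h2]
  · refine ⟨by omega, by omega, by omega, by omega, ?_⟩
    constructor <;> simp [R.q, R.σ, R.N, R.M, R.i, R.u, R.h, R.hp, R.pd, R.nn, R.acc,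
      R.z, R.lo, R.hi, R.V, R.len, R.pos, R.sl, R.ch, R.cnt, Search.finish, h1, h2]

theorem searchBody_runs (hB : 2 * N + 3 ≤ B) (hqB : q ≤ B) (hz : ∀ x, z x < σ) {τ : ℕ}
    (hV : ∀ x < N, V (x / (2 * q)) ≤ τ) (hτ : N * τ * (N * τ) + N * τ ≤ B) (hMN : M ≤ N)
    (R : SearchState z V lo hi q σ M N s g) (I : g.Inv z (slotWeight q V lo hi) q σ M)
    (hN : g.i < N) :
    Runs B searchBody s searchBody.time (fun s' => ∃ g', SearchState z V lo hi q σ M N s' g' ∧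
      g'.Inv z (slotWeight q V lo hi) q σ M ∧ g'.i ≤ N ∧ g.potential < g'.potential) := by
  refine Runs.seq (settle_runs hB R I hN) ?_
  rintro s₁ ⟨g₁, R₁, I₁, hs₁, hi₁, hp₁⟩
  rw [← hi₁] at hN
  refine Runs.seq (probe_runs hB hqB hz R₁ I₁ hs₁ hN) ?_
  rintro s₂ ⟨g₂, R₂, hi₂, ⟨h20, I₂, hp₂⟩ | ⟨h20, I₂, hp₂⟩⟩
  · refine Runs.of_wp ?_
    simp [finishProg, h20]
    exact ⟨g₂, R₂, I₂, by omega, by omega⟩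
  · rw [← hi₂] at hN
    refine (finish_runs hB hqB hV hτ hMN R₂ I₂ h20 hN).mono le_rfl fun s₃ R₃ => ?_
    obtain ⟨J, hp₃⟩ := I₂.finish
    exact ⟨_, R₃, J, hN, by omega⟩

/-- The initialisation of the search. -/
def searchInit : Prog :=
  10 ::= Term.reg 4 * (2 * Term.reg 2) ;;
  11 ::= Term.reg 0 * (2 * Term.reg 2) ;;
  12 ::= 0 ;; 13 ::= 0 ;; 14 ::= 0 ;; 15 ::= 0 ;; 16 ::= 0 ;; 17 ::= 1 ;; 21 ::= 0

/-- The search over all windows. -/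
def searchLoop : Prog := Prog.while (Term.op Op.lt (Term.reg 12) (Term.reg 10)) searchBody

/-- The search takes `O(N + q)` steps, because the potential is at most `3 * N + 2 * q` and
increases with every pass through the loop. -/
theorem searchLoop_runs (hB : 2 * N + 3 ≤ B) (hqB : q ≤ B) (hz : ∀ x, z x < σ) {τ : ℕ}
    (hV : ∀ x < N, V (x / (2 * q)) ≤ τ) (hτ : N * τ * (N * τ) + N * τ ≤ B) (hMN : M ≤ N)
    (R : SearchState z V lo hi q σ M N s g) (I : g.Inv z (slotWeight q V lo hi) q σ M)
    (hN : g.i ≤ N) :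
    Runs B searchLoop s ((3 * N + 2 * q + 1) * (4 + searchBody.time))
      (fun s' => s'.reg 21 = pairWeight z (slotWeight q V lo hi) q M N) := by
  refine (Runs.loop (B := B) (e := Term.op Op.lt (Term.reg 12) (Term.reg 10)) (p := searchBody)
    (fun s => ∃ g, SearchState z V lo hi q σ M N s g ∧ g.Inv z (slotWeight q V lo hi) q σ M ∧
      g.i ≤ N)
    (fun s => 3 * N + 2 * q - (3 * s.reg 12 + s.arr 13 (s.reg 13) + s.reg 14)) searchBody.time
    ?_ ⟨g, R, I, hN⟩ (T := (3 * N + 2 * q + 1) * (4 + searchBody.time)) ?_).mono le_rfl ?_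
  · rintro s ⟨g, R, I, -⟩ hlt
    simp [R.i, R.N] at hlt
    refine (searchBody_runs hB hqB hz hV hτ hMN R I hlt).mono le_rfl ?_
    rintro s' ⟨g', R', I', hN', hp⟩
    refine ⟨⟨g', R', I', hN'⟩, ?_⟩
    simp only [R.i, R.u, R.h, R.len, R'.i, R'.u, R'.h, R'.len]
    have h1 := I'.u_q
    have h2 := I'.h_le
    unfold Search.potential at hp
    omega
  · refine Nat.mul_le_mul ?_ (by simp [Term.cost])
    exact Nat.add_le_add_right (Nat.sub_le _ _) 1
  · rintro s' ⟨⟨g', R', I', hN'⟩, he⟩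
    simp [R'.i, R'.N] at he
    rw [R'.acc, I'.acc_eq, le_antisymm hN' he]

end WordRAM

/-! ### Multiplicities on the word RAM -/

theorem sum_update_add {n l c : ℕ} (hl : l < n) (V G : ℕ → ℕ) :
    ∑ i ∈ Finset.range n, Function.update V l (V l + c) i * G i =
      ∑ i ∈ Finset.range n, V i * G i + c * G l := by
  have : ∀ i ∈ Finset.range n, Function.update V l (V l + c) i * G i =
      V i * G i + if i = l then c * G l else 0 := by
    intro i _
    by_cases h : i = l
    · subst h; simp [Nat.add_mul]
    · simp [h]
  rw [Finset.sum_congr rfl this, Finset.sum_add_distrib, Finset.sum_ite_eq']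
  simp [hl]

/-- The multiplicities are final for the variables from `k` on and have been passed on from these
to their parts, but not yet from the variables below `k`.  For `k = 0` this is
`IsMultiplicity`. -/
def IsPartialMultiplicity (n₁ n k : ℕ) (kd lf rt V : ℕ → ℕ) : Prop :=
  ∀ g e, IsAdditive n kd lf rt g e →
    ∑ i ∈ Finset.range n, V i * (if k ≤ i then e i else g i) = g (n₁ - 1) + g (n - 1)

theorem isPartialMultiplicity_init {n₁ n : ℕ} (h0 : 0 < n₁) (h1 : n₁ < n) (kd lf rt : ℕ → ℕ) :
    IsPartialMultiplicity n₁ n n kd lf rt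
      (Function.update (Function.update (fun _ => 0) (n₁ - 1) 1) (n - 1) 1) := by
  intro g e _
  have e1 : Function.update (Function.update (fun _ => 0) (n₁ - 1) 1) (n - 1) 1 =
      Function.update (Function.update (fun _ => 0) (n₁ - 1) ((fun _ => 0) (n₁ - 1) + 1)) (n - 1)
        ((Function.update (fun _ => 0) (n₁ - 1) ((fun _ => 0) (n₁ - 1) + 1)) (n - 1) + 1) := by
    rw [Function.update_of_ne (show n - 1 ≠ n₁ - 1 by omega)]
  rw [e1, sum_update_add (by omega), sum_update_add (by omega), if_neg (by omega),
    if_neg (by omega)]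
  simp

/-- Passing the multiplicity of the pair `k` on to its two parts. -/
def passOn (kd lf rt : ℕ → ℕ) (k : ℕ) (V : ℕ → ℕ) : ℕ → ℕ :=
  if kd k = 0 then V else
    Function.update (Function.update V (lf k) (V (lf k) + V k)) (rt k)
      (Function.update V (lf k) (V (lf k) + V k) (rt k) + V k)

/-- This is the recursion `g k = e k + g l + g r`, applied to the term of `k`. -/
theorem IsPartialMultiplicity.step {n₁ n k : ℕ} {kd lf rt V : ℕ → ℕ} {val : ℕ → List ℕ}
    (hc : IsCode n₁ n kd lf rt val) (hk : k < n)
    (h : IsPartialMultiplicity n₁ n (k + 1) kd lf rt V) :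
    IsPartialMultiplicity n₁ n k kd lf rt (passOn kd lf rt k V) := by
  intro g e hg
  rw [← h g e hg]
  by_cases h0 : kd k = 0
  · rw [passOn, if_pos h0]
    refine Finset.sum_congr rfl fun i _ => ?_
    rcases Nat.lt_trichotomy i k with hi | rfl | hi
    · rw [if_neg (by omega), if_neg (by omega)]
    · rw [if_pos le_rfl, if_neg (by omega), hg i hk, if_pos h0, add_zero]
    · rw [if_pos (by omega), if_pos (by omega)]
  · obtain ⟨hl, hr, -⟩ := hc.pair k hk h0
    rw [passOn, if_neg h0, sum_update_add (by omega), sum_update_add (by omega),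
      if_neg (by omega), if_neg (by omega)]
    have : ∀ i ∈ Finset.range n, V i * (if k + 1 ≤ i then e i else g i) =
        V i * (if k ≤ i then e i else g i) +
          if i = k then V k * g (lf k) + V k * g (rt k) else 0 := by
      intro i _
      rcases Nat.lt_trichotomy i k with hi | rfl | hi
      · rw [if_neg (by omega), if_neg (by omega), if_neg (by omega), add_zero]
      · rw [if_pos le_rfl, if_neg (by omega), if_pos rfl, hg i hk, if_neg h0]
        ring
      · rw [if_pos (by omega), if_pos (by omega), if_neg (by omega), add_zero]
    rw [Finset.sum_congr rfl this, Finset.sum_add_distrib, Finset.sum_ite_eq',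
      if_pos (Finset.mem_range.mpr hk), add_assoc]

/-- The variable `i` has at most as many occurrences as the strings have letters, because each
occurrence derives at least one letter: the length is an additive function. -/
theorem IsPartialMultiplicity.le {n₁ n k : ℕ} {kd lf rt V : ℕ → ℕ} {val : ℕ → List ℕ}
    (hc : IsCode n₁ n kd lf rt val) (h : IsPartialMultiplicity n₁ n k kd lf rt V) {i : ℕ}
    (hi : i < k) (hn : i < n) : V i ≤ (val (n₁ - 1)).length + (val (n - 1)).length := by
  rw [← h (fun i => (val i).length) (fun i => if kd i = 0 then 1 else 0)]
  · calc V i ≤ V i * (val i).length := Nat.le_mul_of_pos_right _ (hc.val_pos i hn)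
      _ = V i * (if k ≤ i then (if kd i = 0 then 1 else 0) else (val i).length) := by
          rw [if_neg (by omega)]
      _ ≤ _ := Finset.single_le_sum
          (f := fun i => V i * (if k ≤ i then (if kd i = 0 then 1 else 0) else (val i).length))
          (fun _ _ => Nat.zero_le _) (Finset.mem_range.mpr hn)
  · intro j hj
    by_cases h0 : kd j = 0
    · simp [h0, hc.letter j hj h0]
    · simp [h0, (hc.pair j hj h0).2.2]

namespace WordRAM

/-- The registers and arrays that describe the input once the two programs have been joined. -/
structure CodeState (n₁ n q σ : ℕ) (kd lf rt : ℕ → ℕ) (s : State) : Prop where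
  n₁ : s.reg 0 = n₁
  q : s.reg 2 = q
  σ : s.reg 3 = σ
  n : s.reg 4 = n
  kd : s.arr 0 = kd
  lf : s.arr 1 = lf
  rt : s.arr 2 = rt

/-- Compute the multiplicities in array `12`, from the last variable down to the first. -/
def multBody : Prog :=
  5 ::= Term.reg 5 - 1 ;;
  Prog.ite (Term.cell 0 (Term.reg 5))
    (Prog.store 12 (Term.cell 1 (Term.reg 5))
        (Term.cell 12 (Term.cell 1 (Term.reg 5)) + Term.cell 12 (Term.reg 5)) ;;
      Prog.store 12 (Term.cell 2 (Term.reg 5))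
        (Term.cell 12 (Term.cell 2 (Term.reg 5)) + Term.cell 12 (Term.reg 5)))
    Prog.skip

/-- Give both roots the multiplicity `1`. -/
def multInit : Prog :=
  Prog.store 12 (Term.reg 0 - 1) 1 ;; Prog.store 12 (Term.reg 4 - 1) 1 ;; 5 ::= Term.reg 4

/-- Compute the multiplicities in array `12`. -/
def multProg : Prog := multInit ;; Prog.while (Term.reg 5) multBody

variable {n₁ n q σ B : ℕ} {kd lf rt : ℕ → ℕ} {val : ℕ → List ℕ} {s : State}

theorem multProg_runs (hc : IsCode n₁ n kd lf rt val) {τ : ℕ} (hB : n ≤ B)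
    (hτ : (val (n₁ - 1)).length + (val (n - 1)).length = τ) (hτB : τ ≤ B)
    (S : CodeState n₁ n q σ kd lf rt s) (h0 : s.arr 12 = fun _ => 0) :
    Runs B multProg s (multInit.time + (n + 1) * (2 + multBody.time)) (fun s' =>
      CodeState n₁ n q σ kd lf rt s' ∧ (∀ a, a ≠ 12 → s'.arr a = s.arr a) ∧
      (∀ i < n, s'.arr 12 i ≤ τ) ∧ IsMultiplicity n₁ n kd lf rt (s'.arr 12)) := by
  have hlt := hc.lt
  have hpos := hc.pos
  have hτ1 : 1 ≤ τ := by have := hc.val_pos (n - 1) (by omega); omega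
  have hstart : Runs B multInit s multInit.time (fun s₁ => CodeState n₁ n q σ kd lf rt s₁ ∧
      (∀ a, a ≠ 12 → s₁.arr a = s.arr a) ∧ s₁.reg 5 = n ∧
      s₁.arr 12 = Function.update (Function.update (fun _ => 0) (n₁ - 1) 1) (n - 1) 1) := by
    refine Runs.of_wp ?_
    simp [multInit, S.n, S.n₁, h0]
    refine ⟨by omega, hB, ?_, fun a ha => ?_⟩
    · constructor <;> simp [S.n₁, S.q, S.σ, S.n, S.kd, S.lf, S.rt]
    · simp [ha]
  refine Runs.seq hstart ?_
  rintro s₁ ⟨S₁, hf₁, h5, h12⟩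
  refine (Runs.loop (B := B) (e := Term.reg 5) (p := multBody)
    (fun s' => CodeState n₁ n q σ kd lf rt s' ∧ (∀ a, a ≠ 12 → s'.arr a = s.arr a) ∧
      s'.reg 5 ≤ n ∧ (∀ i < n, s'.arr 12 i ≤ τ) ∧
      IsPartialMultiplicity n₁ n (s'.reg 5) kd lf rt (s'.arr 12))
    (fun s' => s'.reg 5) multBody.time ?_ ?_ ?_).mono le_rfl ?_
  · rintro s ⟨S, hf, hk, hV, hP⟩ hne
    obtain ⟨k, hk'⟩ : ∃ k, s.reg 5 = k + 1 := Nat.exists_eq_succ_of_ne_zero hne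
    rw [hk'] at hP hk
    have hstep := hP.step hc hk
    have hle : ∀ i < n, passOn kd lf rt k (s.arr 12) i ≤ τ := by
      intro i hi
      rcases Nat.lt_or_ge i k with hik | hik
      · exact hτ ▸ hstep.le hc hik hi
      · unfold passOn
        split_ifs with h0
        · exact hV i hi
        · obtain ⟨hl, hr, -⟩ := hc.pair k hk h0
          rw [Function.update_of_ne (by omega), Function.update_of_ne (by omega)]
          exact hV i hi
    refine Runs.of_wp ?_
    by_cases h0 : kd k = 0
    · rw [passOn, if_pos h0] at hstep
      simp [multBody, hk', S.kd, h0]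
      refine ⟨by omega, ?_, hf, by omega, hV, hstep⟩
      constructor <;> simp [S.n₁, S.q, S.σ, S.n, S.kd, S.lf, S.rt]
    · obtain ⟨hl, hr, -⟩ := hc.pair k hk h0
      have hk1 : k ≠ lf k := by omega
      have hle1 : s.arr 12 (lf k) + s.arr 12 k ≤ τ := by
        refine le_trans ?_ (hle (lf k) (by omega))
        rw [passOn, if_neg h0]
        by_cases e : lf k = rt k
        · rw [← e, Function.update_self, Function.update_self]; omega
        · rw [Function.update_of_ne e, Function.update_self]
      have hle2 := hle (rt k) (by omega)
      rw [passOn, if_neg h0] at hstep hle hle2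
      rw [Function.update_self] at hle2
      simp [multBody, hk', S.kd, S.lf, S.rt, h0, Function.update_of_ne hk1]
      refine ⟨by omega, by omega, by omega, ?_, ?_, by omega, hle, hstep⟩
      · constructor <;> simp [S.n₁, S.q, S.σ, S.n, S.kd, S.lf, S.rt]
      · intro a ha; simp [ha, hf a ha]
  · refine ⟨S₁, hf₁, h5.le, fun i _ => ?_, ?_⟩
    · rw [h12]
      simp only [Function.update_apply]
      split_ifs <;> omega
    · rw [h12, h5]; exact isPartialMultiplicity_init hpos hlt kd lf rt
  · rw [h5]; exact Nat.mul_le_mul_left _ (by simp [Term.cost])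
  · intro s' h
    obtain ⟨⟨S', hf', -, hV', hP'⟩, he⟩ := h
    rw [ideal_reg] at he
    refine ⟨S', hf', hV', fun g e hg => ?_⟩
    rw [← hP' g e hg, he]
    simp

end WordRAM

/-! ### Filling the slots on the word RAM -/

namespace WordRAM

/-- For the pair in register `5`, with the parts in registers `7` and `8`, write the letter with the
number `j` in register `6` to its prefix, to its suffix (from the end), and to the two halves of its
slot (from the boundary).  Array `6` holds the lengths of the parts, truncated at `q - 1`; where the
prefix of the left part ends, the prefix of the pair continues with that of the right part. -/
def copyBody : Prog :=
  Prog.ite (Term.op Op.lt (Term.reg 6) (Term.cell 6 (Term.reg 7)))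
    (Prog.store 7 (Term.reg 5 * Term.reg 2 + Term.reg 6)
        (Term.cell 7 (Term.reg 7 * Term.reg 2 + Term.reg 6)) ;;
      Prog.store 9 (Term.reg 5 * (2 * Term.reg 2) + (Term.reg 2 - 2 - Term.reg 6))
        (Term.cell 8 (Term.reg 7 * Term.reg 2 + Term.reg 6)))
    (Prog.store 7 (Term.reg 5 * Term.reg 2 + Term.reg 6)
      (Term.cell 7 (Term.reg 8 * Term.reg 2 + (Term.reg 6 - Term.cell 6 (Term.reg 7))))) ;;
  Prog.ite (Term.op Op.lt (Term.reg 6) (Term.cell 6 (Term.reg 8)))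
    (Prog.store 8 (Term.reg 5 * Term.reg 2 + Term.reg 6)
        (Term.cell 8 (Term.reg 8 * Term.reg 2 + Term.reg 6)) ;;
      Prog.store 9 (Term.reg 5 * (2 * Term.reg 2) + (Term.reg 2 - 1 + Term.reg 6))
        (Term.cell 7 (Term.reg 8 * Term.reg 2 + Term.reg 6)))
    (Prog.store 8 (Term.reg 5 * Term.reg 2 + Term.reg 6)
      (Term.cell 8 (Term.reg 7 * Term.reg 2 + (Term.reg 6 - Term.cell 6 (Term.reg 8))))) ;;
  6 ::= Term.reg 6 + 1

/-- Write the letters with the numbers below `q - 1` for a pair. -/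
def copyLoop : Prog := Prog.while (Term.op Op.lt (Term.reg 6 + 1) (Term.reg 2)) copyBody

/-- Set up the truncated length and the bounds of the slot for a pair. -/
def pairInit : Prog :=
  7 ::= Term.cell 1 (Term.reg 5) ;;
  8 ::= Term.cell 2 (Term.reg 5) ;;
  9 ::= Term.cell 6 (Term.reg 7) + Term.cell 6 (Term.reg 8) ;;
  Prog.ite (Term.op Op.lt (Term.reg 9) (Term.reg 2)) Prog.skip (9 ::= Term.reg 2 - 1) ;;
  Prog.store 6 (Term.reg 5) (Term.reg 9) ;;
  Prog.store 10 (Term.reg 5) (Term.reg 2 - 1 - Term.cell 6 (Term.reg 7)) ;;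
  Prog.store 11 (Term.reg 5) (Term.cell 6 (Term.reg 8)) ;;
  6 ::= 0

/-- Fill the slot for a letter.  It has a valid window only for `q = 1`. -/
def letterProg : Prog :=
  Prog.store 6 (Term.reg 5) (Term.op Op.lt 1 (Term.reg 2)) ;;
  Prog.store 7 (Term.reg 5 * Term.reg 2) (Term.cell 1 (Term.reg 5)) ;;
  Prog.store 8 (Term.reg 5 * Term.reg 2) (Term.cell 1 (Term.reg 5)) ;;
  Prog.store 9 (Term.reg 5 * (2 * Term.reg 2) + (Term.reg 2 - 1)) (Term.cell 1 (Term.reg 5)) ;;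
  Prog.store 10 (Term.reg 5) 0 ;;
  Prog.store 11 (Term.reg 5) (Term.op Op.lt (Term.reg 2) 2)

/-- Fill the slots of all variables. -/
def slotsProg : Prog :=
  5 ::= 0 ;;
  Prog.while (Term.op Op.lt (Term.reg 5) (Term.reg 4))
    (Prog.ite (Term.cell 0 (Term.reg 5)) (pairInit ;; copyLoop) letterProg ;;
      5 ::= Term.reg 5 + 1)

end WordRAM

/-- The effect of copying the letters below `j` for a pair `i` with the parts `l` and `r`, of
which `a` and `b` letters are stored: `P` and `S` are the prefix and suffix arrays and `Z` is the
array of the slots, and `P₀`, `S₀`, `Z₀` are their contents before. -/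
structure Copied (q σ i l r a b : ℕ) (P₀ S₀ Z₀ P S Z : ℕ → ℕ) (j : ℕ) : Prop where
  P_old : ∀ x < i * q, P x = P₀ x
  S_old : ∀ x < i * q, S x = S₀ x
  Z_old : ∀ x < i * (2 * q), Z x = Z₀ x
  P_lt : ∀ x, P x < σ
  S_lt : ∀ x, S x < σ
  Z_lt : ∀ x, Z x < σ
  P_new : ∀ t < j, P (i * q + t) = if t < a then P₀ (l * q + t) else P₀ (r * q + (t - a))
  S_new : ∀ t < j, S (i * q + t) = if t < b then S₀ (r * q + t) else S₀ (l * q + (t - b))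
  Z_left : ∀ t < j, t < a → Z (i * (2 * q) + (q - 2 - t)) = S₀ (l * q + t)
  Z_right : ∀ t < j, t < b → Z (i * (2 * q) + (q - 1 + t)) = P₀ (r * q + t)

theorem update_lt {f : ℕ → ℕ} {σ k v : ℕ} (hf : ∀ x, f x < σ) (hv : v < σ) (x : ℕ) :
    Function.update f k v x < σ := by
  by_cases h : x = k
  · subst h; simpa using hv
  · simpa [h] using hf x

theorem block_lt {l i q : ℕ} (h : l < i) : l * q + q ≤ i * q := by
  rw [← Nat.succ_mul]; exact Nat.mul_le_mul_right _ h

/-- The cells that are read belong to the blocks of `l` and `r`, which lie below the block of `i`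
that is being written. -/
theorem Copied.step {q σ i l r a b j : ℕ} {P₀ S₀ Z₀ P S Z : ℕ → ℕ} (hl : l < i) (hr : r < i)
    (hj : j + 1 < q) (h : Copied q σ i l r a b P₀ S₀ Z₀ P S Z j) :
    Copied q σ i l r a b P₀ S₀ Z₀
      (Function.update P (i * q + j) (if j < a then P (l * q + j) else P (r * q + (j - a))))
      (Function.update S (i * q + j) (if j < b then S (r * q + j) else S (l * q + (j - b))))
      (let Z' := if j < a then Function.update Z (i * (2 * q) + (q - 2 - j)) (S (l * q + j)) else Z
       if j < b then Function.update Z' (i * (2 * q) + (q - 1 + j)) (P (r * q + j)) else Z')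
      (j + 1) := by
  have bl := block_lt (q := q) hl
  have br := block_lt (q := q) hr
  have hP : (if j < a then P (l * q + j) else P (r * q + (j - a))) =
      if j < a then P₀ (l * q + j) else P₀ (r * q + (j - a)) := by
    rw [h.P_old _ (by omega), h.P_old _ (by omega)]
  have hS : (if j < b then S (r * q + j) else S (l * q + (j - b))) =
      if j < b then S₀ (r * q + j) else S₀ (l * q + (j - b)) := by
    rw [h.S_old _ (by omega), h.S_old _ (by omega)]
  have hZ : ∀ x, x ≠ i * (2 * q) + (q - 2 - j) → x ≠ i * (2 * q) + (q - 1 + j) →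
      (let Z' := if j < a then Function.update Z (i * (2 * q) + (q - 2 - j)) (S (l * q + j)) else Z
       if j < b then Function.update Z' (i * (2 * q) + (q - 1 + j)) (P (r * q + j)) else Z') x =
        Z x := by
    intro x h1 h2
    dsimp only
    split_ifs <;> simp [h1, h2]
  constructor
  · intro x hx; rw [Function.update_of_ne (by omega), h.P_old x hx]
  · intro x hx; rw [Function.update_of_ne (by omega), h.S_old x hx]
  · intro x hx; rw [hZ x (by omega) (by omega), h.Z_old x hx]
  · exact update_lt h.P_lt (by split_ifs <;> exact h.P_lt _)
  · exact update_lt h.S_lt (by split_ifs <;> exact h.S_lt _)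
  · intro x
    split_ifs
    · exact update_lt (update_lt h.Z_lt (h.S_lt _)) (h.P_lt _) x
    · exact update_lt h.Z_lt (h.P_lt _) x
    · exact update_lt h.Z_lt (h.S_lt _) x
    · exact h.Z_lt x
  · intro t ht
    rcases Nat.lt_succ_iff_lt_or_eq.mp ht with ht | rfl
    · rw [Function.update_of_ne (by omega)]; exact h.P_new t ht
    · rw [Function.update_self, hP]
  · intro t ht
    rcases Nat.lt_succ_iff_lt_or_eq.mp ht with ht | rfl
    · rw [Function.update_of_ne (by omega)]; exact h.S_new t ht
    · rw [Function.update_self, hS]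
  · intro t ht hta
    rcases Nat.lt_succ_iff_lt_or_eq.mp ht with ht | rfl
    · rw [hZ _ (by omega) (by omega)]; exact h.Z_left t ht hta
    · rw [← h.S_old _ (by omega)]
      rw [if_pos hta]
      split_ifs
      · rw [Function.update_of_ne (by omega), Function.update_self]
      · rw [Function.update_self]
  · intro t ht htb
    rcases Nat.lt_succ_iff_lt_or_eq.mp ht with ht | rfl
    · rw [hZ _ (by omega) (by omega)]; exact h.Z_right t ht htb
    · rw [← h.P_old _ (by omega)]
      rw [if_pos htb, Function.update_self]

/-- The contents of the arrays when the slots of the variables below `i` are filled: `L` holds the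
truncated lengths, `P` and `S` hold the first letters and, backwards, the last letters. -/
structure Filled (q σ : ℕ) (kd lf rt : ℕ → ℕ) (val : ℕ → List ℕ) (L P S Z lo hi : ℕ → ℕ)
    (i : ℕ) : Prop where
  L_eq : ∀ v < i, L v = min (val v).length (q - 1)
  P_eq : ∀ v < i, ∀ t < min (val v).length (q - 1), P (v * q + t) = (val v).getD t 0
  S_eq : ∀ v < i, ∀ t < min (val v).length (q - 1),
    S (v * q + t) = (val v).getD ((val v).length - 1 - t) 0
  slots : IsSlots q i kd lf rt val Z lo hi
  P_lt : ∀ x, P x < σ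
  S_lt : ∀ x, S x < σ
  Z_lt : ∀ x, Z x < σ

/-- Extending the filled slots by one: the old data persist, and the data of `i` are right. -/
theorem Filled.succ {q σ i : ℕ} {kd lf rt : ℕ → ℕ} {val : ℕ → List ℕ}
    {L P S Z lo hi L' P' S' Z' lo' hi' : ℕ → ℕ} (hq : 0 < q)
    (h : Filled q σ kd lf rt val L P S Z lo hi i)
    (hL : ∀ v < i, L' v = L v) (hP : ∀ x < i * q, P' x = P x) (hS : ∀ x < i * q, S' x = S x)
    (hZ : ∀ x < i * (2 * q), Z' x = Z x) (hlo : ∀ v < i, lo' v = lo v)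
    (hhi : ∀ v < i, hi' v = hi v)
    (hP_lt : ∀ x, P' x < σ) (hS_lt : ∀ x, S' x < σ) (hZ_lt : ∀ x, Z' x < σ)
    (kL : L' i = min (val i).length (q - 1))
    (kP : ∀ t < min (val i).length (q - 1), P' (i * q + t) = (val i).getD t 0)
    (kS : ∀ t < min (val i).length (q - 1),
      S' (i * q + t) = (val i).getD ((val i).length - 1 - t) 0)
    (k0 : kd i = 0 → Z' (i * (2 * q) + (q - 1)) = lf i ∧ lo' i = 0 ∧
      hi' i = if q < 2 then 1 else 0)
    (k1 : kd i ≠ 0 →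
      (∀ t < min (val (lf i)).length (q - 1),
        Z' (i * (2 * q) + (q - 2 - t)) = (val (lf i)).getD ((val (lf i)).length - 1 - t) 0) ∧
      (∀ t < min (val (rt i)).length (q - 1),
        Z' (i * (2 * q) + (q - 1 + t)) = (val (rt i)).getD t 0) ∧
      lo' i = q - 1 - min (val (lf i)).length (q - 1) ∧
      hi' i = min (val (rt i)).length (q - 1)) :
    Filled q σ kd lf rt val L' P' S' Z' lo' hi' (i + 1) := by
  have hs := h.slots
  refine ⟨?_, ?_, ?_, ⟨?_, ?_, ?_, ?_, ?_⟩, hP_lt, hS_lt, hZ_lt⟩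
  · intro v hv
    rcases Nat.lt_succ_iff_lt_or_eq.mp hv with hv | rfl
    · rw [hL v hv, h.L_eq v hv]
    · exact kL
  · intro v hv t ht
    rcases Nat.lt_succ_iff_lt_or_eq.mp hv with hv | rfl
    · have := block_lt (q := q) hv
      rw [hP _ (by omega), h.P_eq v hv t ht]
    · exact kP t ht
  · intro v hv t ht
    rcases Nat.lt_succ_iff_lt_or_eq.mp hv with hv | rfl
    · have := block_lt (q := q) hv
      rw [hS _ (by omega), h.S_eq v hv t ht]
    · exact kS t ht
  · intro v hv h0
    rcases Nat.lt_succ_iff_lt_or_eq.mp hv with hv | rfl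
    · have := block_lt (q := 2 * q) hv
      rw [hZ _ (by omega), hlo v hv, hhi v hv]
      exact hs.letter v hv h0
    · exact k0 h0
  · intro v hv h0 t ht
    rcases Nat.lt_succ_iff_lt_or_eq.mp hv with hv | rfl
    · have := block_lt (q := 2 * q) hv
      rw [hZ _ (by omega)]
      exact hs.left v hv h0 t ht
    · exact (k1 h0).1 t ht
  · intro v hv h0 t ht
    rcases Nat.lt_succ_iff_lt_or_eq.mp hv with hv | rfl
    · have := block_lt (q := 2 * q) hv
      rw [hZ _ (by omega)]
      exact hs.right v hv h0 t ht
    · exact (k1 h0).2.1 t ht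
  · intro v hv h0
    rcases Nat.lt_succ_iff_lt_or_eq.mp hv with hv | rfl
    · rw [hlo v hv]; exact hs.lo_eq v hv h0
    · exact (k1 h0).2.2.1
  · intro v hv h0
    rcases Nat.lt_succ_iff_lt_or_eq.mp hv with hv | rfl
    · rw [hhi v hv]; exact hs.hi_eq v hv h0
    · exact (k1 h0).2.2.2

theorem Filled.letter {q σ n₁ n i : ℕ} {kd lf rt : ℕ → ℕ} {val : ℕ → List ℕ}
    {L P S Z lo hi : ℕ → ℕ} (hq : 0 < q) (hc : IsCode n₁ n kd lf rt val) (hin : i < n)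
    (hlf : lf i < σ) (h0 : kd i = 0) (h : Filled q σ kd lf rt val L P S Z lo hi i) :
    Filled q σ kd lf rt val (Function.update L i (if 1 < q then 1 else 0))
      (Function.update P (i * q) (lf i)) (Function.update S (i * q) (lf i))
      (Function.update Z (i * (2 * q) + (q - 1)) (lf i)) (Function.update lo i 0)
      (Function.update hi i (if q < 2 then 1 else 0)) (i + 1) := by
  have hv := hc.letter i hin h0
  have hlen : (val i).length = 1 := by rw [hv]; rfl
  refine h.succ hq ?_ ?_ ?_ ?_ ?_ ?_ (update_lt h.P_lt hlf) (update_lt h.S_lt hlf)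
    (update_lt h.Z_lt hlf) ?_ ?_ ?_ ?_ fun hk => absurd h0 hk
  · intro v hv; exact Function.update_of_ne (by omega) _ _
  · intro v hv; exact Function.update_of_ne (by omega) _ _
  · intro v hv; exact Function.update_of_ne (by omega) _ _
  · intro v hv; exact Function.update_of_ne (by omega) _ _
  · intro v hv; exact Function.update_of_ne (by omega) _ _
  · intro v hv; exact Function.update_of_ne (by omega) _ _
  · rw [Function.update_self, hlen]; split_ifs <;> omega
  · intro t ht
    obtain rfl : t = 0 := by omega
    rw [add_zero, Function.update_self, hv]; rfl
  · intro t ht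
    obtain rfl : t = 0 := by omega
    rw [add_zero, Function.update_self, hv]; rfl
  · intro _
    simp only [Function.update_self, true_and]

theorem Filled.pair {q σ n₁ n i : ℕ} {kd lf rt : ℕ → ℕ} {val : ℕ → List ℕ}
    {L P S Z lo hi P' S' Z' : ℕ → ℕ} (hq : 0 < q) (hc : IsCode n₁ n kd lf rt val) (hin : i < n)
    (h0 : kd i ≠ 0) (h : Filled q σ kd lf rt val L P S Z lo hi i)
    (hcop : Copied q σ i (lf i) (rt i) (L (lf i)) (L (rt i)) P S Z P' S' Z' (q - 1)) :
    Filled q σ kd lf rt val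
      (Function.update L i (if L (lf i) + L (rt i) < q then L (lf i) + L (rt i) else q - 1))
      P' S' Z' (Function.update lo i (q - 1 - L (lf i))) (Function.update hi i (L (rt i)))
      (i + 1) := by
  obtain ⟨hl, hr, hv⟩ := hc.pair i hin h0
  have La := h.L_eq _ hl
  have Lb := h.L_eq _ hr
  have Pa := h.P_eq _ hl
  have Pb := h.P_eq _ hr
  have Sa := h.S_eq _ hl
  have Sb := h.S_eq _ hr
  rw [La, Lb] at hcop
  have hlen : (val i).length = (val (lf i)).length + (val (rt i)).length := by
    rw [hv, List.length_append]
  refine h.succ hq ?_ hcop.P_old hcop.S_old hcop.Z_old ?_ ?_ hcop.P_lt hcop.S_lt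
    hcop.Z_lt ?_ ?_ ?_ (fun hk => absurd hk h0) fun _ => ⟨?_, ?_, ?_, ?_⟩
  · intro v hv; exact Function.update_of_ne (by omega) _ _
  · intro v hv; exact Function.update_of_ne (by omega) _ _
  · intro v hv; exact Function.update_of_ne (by omega) _ _
  · rw [Function.update_self, La, Lb, hlen]
    split_ifs <;> omega
  · intro t ht
    rw [hcop.P_new t (by omega), hv]
    split_ifs with h1
    · rw [Pa t h1, List.getD_append _ _ _ _ (by omega)]
    · rw [Pb _ (by omega), List.getD_append_right _ _ _ _ (by omega)]
      congr 1
      omega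
  · intro t ht
    rw [hcop.S_new t (by omega), hlen, hv]
    split_ifs with h1
    · rw [Sb t h1, List.getD_append_right _ _ _ _ (by omega)]
      congr 1
      omega
    · rw [Sa _ (by omega), List.getD_append _ _ _ _ (by omega)]
      congr 1
      omega
  · intro t ht
    rw [hcop.Z_left t (by omega) ht, Sa t ht]
  · intro t ht
    rw [hcop.Z_right t (by omega) ht, Pb t ht]
  · rw [Function.update_self, La]
  · rw [Function.update_self, Lb]

namespace WordRAM

variable {n₁ n q σ B : ℕ} {kd lf rt : ℕ → ℕ} {val : ℕ → List ℕ} {s : State}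

theorem copyLoop_runs {i l r : ℕ} {P₀ S₀ Z₀ : ℕ → ℕ} (hq : 0 < q) (hqB : q ≤ B) (hσ : σ ≤ B)
    (hl : l < i) (hr : r < i) (S : CodeState n₁ n q σ kd lf rt s) (h5 : s.reg 5 = i)
    (h6 : s.reg 6 = 0) (h7 : s.reg 7 = l) (h8 : s.reg 8 = r)
    (hC : Copied q σ i l r (s.arr 6 l) (s.arr 6 r) P₀ S₀ Z₀ (s.arr 7) (s.arr 8) (s.arr 9) 0) :
    Runs B copyLoop s (q * (6 + copyBody.time)) (fun s' =>
      CodeState n₁ n q σ kd lf rt s' ∧ s'.reg 5 = i ∧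
      (∀ a, a ≠ 7 → a ≠ 8 → a ≠ 9 → s'.arr a = s.arr a) ∧
      Copied q σ i l r (s.arr 6 l) (s.arr 6 r) P₀ S₀ Z₀ (s'.arr 7) (s'.arr 8) (s'.arr 9)
        (q - 1)) := by
  obtain ⟨a, ha⟩ : ∃ a, a = s.arr 6 l := ⟨_, rfl⟩
  obtain ⟨b, hb⟩ : ∃ b, b = s.arr 6 r := ⟨_, rfl⟩
  rw [← ha, ← hb] at hC ⊢
  refine (Runs.loop (B := B) (e := Term.op Op.lt (Term.reg 6 + 1) (Term.reg 2)) (p := copyBody)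
    (fun s' => CodeState n₁ n q σ kd lf rt s' ∧ s'.reg 5 = i ∧ s'.reg 7 = l ∧ s'.reg 8 = r ∧
      s'.reg 6 ≤ q - 1 ∧ (∀ a, a ≠ 7 → a ≠ 8 → a ≠ 9 → s'.arr a = s.arr a) ∧
      Copied q σ i l r a b P₀ S₀ Z₀ (s'.arr 7) (s'.arr 8) (s'.arr 9) (s'.reg 6))
    (fun s' => q - 1 - s'.reg 6) copyBody.time ?_ ?_ ?_).mono le_rfl ?_
  · rintro s' ⟨S', h5', h7', h8', h6', hf, hC'⟩ hlt
    obtain ⟨j, hj⟩ : ∃ j, s'.reg 6 = j := ⟨_, rfl⟩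
    simp [hj, S'.q] at hlt
    rw [hj] at hC'
    have hC'' := hC'.step hl hr hlt
    have g6 : s'.arr 6 = s.arr 6 := hf 6 (by decide) (by decide) (by decide)
    have bl := block_lt (q := q) hl
    have br := block_lt (q := q) hr
    have hP := fun x => (hC'.P_lt x).le.trans hσ
    have hS := fun x => (hC'.S_lt x).le.trans hσ
    have nr1 : r * q + j ≠ i * q + j := by omega
    refine Runs.of_wp ?_
    by_cases ja : j < a <;> by_cases jb : j < b
    all_goals
      simp only [ja, jb, if_true, if_false] at hC''
      have na : (a ≤ j) = ¬ j < a := propext Nat.not_lt.symm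
      have nb : (b ≤ j) = ¬ j < b := propext Nat.not_lt.symm
      simp only [ja, jb, not_true, not_false_iff] at na nb
      simp [copyBody, hj, h5', h7', h8', S'.q, g6, ← ha, ← hb, hP, hS, na, nb,
        Function.update_of_ne nr1]
      refine ⟨by omega, ⟨?_, by omega, ?_, ?_⟩, by omega⟩
      · constructor <;> simp [S'.n₁, S'.q, S'.σ, S'.n, S'.kd, S'.lf, S'.rt]
      · intro x h1 h2 h3; simp [h1, h2, h3, hf x h1 h2 h3]
      · exact hC''
  · refine ⟨S, h5, h7, h8, by omega, fun _ _ _ _ => rfl, ?_⟩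
    rw [h6]; exact hC
  · exact Nat.mul_le_mul (by omega) (by simp [Term.cost])
  · rintro s' ⟨⟨S', h5', -, -, h6', hf, hC'⟩, he⟩
    simp [S'.q] at he
    rw [show s'.reg 6 = q - 1 by omega] at hC'
    exact ⟨S', h5', hf, hC'⟩

end WordRAM

namespace WordRAM

variable {n₁ n q σ B : ℕ} {kd lf rt : ℕ → ℕ} {val : ℕ → List ℕ} {s : State}

theorem slotsProg_runs (hq : 0 < q) (hσ : 0 < σ) (hqB : 2 * q ≤ B) (hσB : σ ≤ B) (hnB : n ≤ B)
    (hc : IsCode n₁ n kd lf rt val) (hlf : ∀ i < n, kd i = 0 → lf i < σ)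
    (S : CodeState n₁ n q σ kd lf rt s) (hz : ∀ a, 6 ≤ a → s.arr a = fun _ => 0) :
    Runs B slotsProg s
      (2 + (n + 1) * (11 + (pairInit.time + q * (6 + copyBody.time) + letterProg.time)))
      (fun s' => CodeState n₁ n q σ kd lf rt s' ∧ (∀ a, 12 ≤ a → s'.arr a = fun _ => 0) ∧
        IsSlots q n kd lf rt val (s'.arr 9) (s'.arr 10) (s'.arr 11) ∧ ∀ x, s'.arr 9 x < σ) := by
  have hstart : Runs B (5 ::= 0) s 2 (fun s₁ => s₁ = s.setReg 5 0) :=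
    Runs.of_wp ⟨Nat.zero_le _, rfl⟩
  refine Runs.seq hstart ?_
  rintro _ rfl
  refine (Runs.loop (B := B) (e := Term.op Op.lt (Term.reg 5) (Term.reg 4))
    (fun s' => CodeState n₁ n q σ kd lf rt s' ∧ s'.reg 5 ≤ n ∧
      (∀ a, 12 ≤ a → s'.arr a = fun _ => 0) ∧
      Filled q σ kd lf rt val (s'.arr 6) (s'.arr 7) (s'.arr 8) (s'.arr 9) (s'.arr 10)
        (s'.arr 11) (s'.reg 5))
    (fun s' => n - s'.reg 5)
    (7 + (pairInit.time + q * (6 + copyBody.time) + letterProg.time)) ?_ ?_ ?_).mono le_rfl ?_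
  · clear hstart S hz
    rintro s ⟨S, -, hf, hF⟩ hlt
    obtain ⟨i, hi⟩ : ∃ i, s.reg 5 = i := ⟨_, rfl⟩
    simp [hi, S.n] at hlt
    rw [hi] at hF
    have hmid : Runs B (Prog.ite (Term.cell 0 (Term.reg 5)) (pairInit ;; copyLoop) letterProg) s
        (3 + (pairInit.time + q * (6 + copyBody.time) + letterProg.time))
        (fun s' => CodeState n₁ n q σ kd lf rt s' ∧ s'.reg 5 = i ∧
          (∀ a, 12 ≤ a → s'.arr a = fun _ => 0) ∧
          Filled q σ kd lf rt val (s'.arr 6) (s'.arr 7) (s'.arr 8) (s'.arr 9) (s'.arr 10)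
            (s'.arr 11) (i + 1)) := by
      refine Runs.mono (T := (Term.cell 0 (Term.reg 5)).cost + 1 +
        (pairInit.time + q * (6 + copyBody.time) + letterProg.time)) (Runs.ite ?_ ?_)
        (by simp [Term.cost]) fun _ h => h
      · intro h0
        simp [hi, S.kd] at h0
        obtain ⟨hl, hr, -⟩ := hc.pair i hlt h0
        have nl : lf i ≠ i := hl.ne
        have nr : rt i ≠ i := hr.ne
        have La := hF.L_eq _ hl
        have Lb := hF.L_eq _ hr
        have hpair : Runs B pairInit s pairInit.time (fun s₁ =>
            CodeState n₁ n q σ kd lf rt s₁ ∧ s₁.reg 5 = i ∧ s₁.reg 6 = 0 ∧ s₁.reg 7 = lf i ∧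
            s₁.reg 8 = rt i ∧ s₁.arr 6 = Function.update (s.arr 6) i
              (if s.arr 6 (lf i) + s.arr 6 (rt i) < q then s.arr 6 (lf i) + s.arr 6 (rt i)
                else q - 1) ∧ s₁.arr 7 = s.arr 7 ∧ s₁.arr 8 = s.arr 8 ∧ s₁.arr 9 = s.arr 9 ∧
            s₁.arr 10 = Function.update (s.arr 10) i (q - 1 - s.arr 6 (lf i)) ∧
            s₁.arr 11 = Function.update (s.arr 11) i (s.arr 6 (rt i)) ∧
            (∀ a, 12 ≤ a → s₁.arr a = fun _ => 0)) := by
          refine Runs.of_wp ?_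
          have hf' : ∀ a, 12 ≤ a → a ≠ 6 ∧ a ≠ 10 ∧ a ≠ 11 := by omega
          by_cases hs : s.arr 6 (lf i) + s.arr 6 (rt i) < q
          · have hs' : ¬ q ≤ s.arr 6 (lf i) + s.arr 6 (rt i) := by omega
            simp [pairInit, hi, S.lf, S.rt, S.q, hs, hs', nl, nr]
            refine ⟨by omega, by omega, by omega, by omega, by omega, ?_, ?_⟩
            · constructor <;> simp [S.n₁, S.q, S.σ, S.n, S.kd, S.lf, S.rt]
            · intro a ha
              simp [hf' a ha, hf a ha]
          · have hs' : q ≤ s.arr 6 (lf i) + s.arr 6 (rt i) := by omega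
            simp [pairInit, hi, S.lf, S.rt, S.q, hs, hs', nl, nr]
            refine ⟨by omega, by omega, by omega, by omega, by omega, by omega, ?_, ?_⟩
            · constructor <;> simp [S.n₁, S.q, S.σ, S.n, S.kd, S.lf, S.rt]
            · intro a ha
              simp [hf' a ha, hf a ha]
        refine Runs.mono (Runs.seq hpair
          (Q := fun s' => CodeState n₁ n q σ kd lf rt s' ∧ s'.reg 5 = i ∧
            (∀ a, 12 ≤ a → s'.arr a = fun _ => 0) ∧
            Filled q σ kd lf rt val (s'.arr 6) (s'.arr 7) (s'.arr 8) (s'.arr 9) (s'.arr 10)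
              (s'.arr 11) (i + 1)) (T₂ := q * (6 + copyBody.time)) ?_)
          (Nat.le_add_right _ _) fun _ h => h
        rintro s₁ ⟨S₁, h5, h6, h7, h8, e6, e7, e8, e9, e10, e11, hf₁⟩
        have E1 : s₁.arr 6 (lf i) = s.arr 6 (lf i) := by rw [e6, Function.update_of_ne nl]
        have E2 : s₁.arr 6 (rt i) = s.arr 6 (rt i) := by rw [e6, Function.update_of_ne nr]
        refine (copyLoop_runs (P₀ := s.arr 7) (S₀ := s.arr 8) (Z₀ := s.arr 9) hq (by omega) hσB
          hl hr S₁ h5 h6 h7 h8 ?_).mono le_rfl ?_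
        · rw [e7, e8, e9]
          exact ⟨fun _ _ => rfl, fun _ _ => rfl, fun _ _ => rfl, hF.P_lt, hF.S_lt, hF.Z_lt,
            fun _ h => absurd h (Nat.not_lt_zero _), fun _ h => absurd h (Nat.not_lt_zero _),
            fun _ h => absurd h (Nat.not_lt_zero _), fun _ h => absurd h (Nat.not_lt_zero _)⟩
        · rintro s₂ ⟨S₂, h5₂, hf₂, hC⟩
          rw [E1, E2] at hC
          refine ⟨S₂, h5₂, fun a ha => ?_, ?_⟩
          · rw [hf₂ a (by omega) (by omega) (by omega), hf₁ a ha]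
          · rw [hf₂ 6 (by decide) (by decide) (by decide),
              hf₂ 10 (by decide) (by decide) (by decide),
              hf₂ 11 (by decide) (by decide) (by decide), e6, e10, e11]
            exact hF.pair hq hc hlt h0 hC
      · intro h0
        simp [hi, S.kd] at h0
        refine Runs.mono (T := letterProg.time) (Runs.of_wp ?_) (Nat.le_add_left _ _)
          fun _ h => h
        have hlfi := hlf i hlt h0
        have hL := hF.letter hq hc hlt hlfi h0
        have hf' : ∀ a, 12 ≤ a → a ≠ 6 ∧ a ≠ 7 ∧ a ≠ 8 ∧ a ≠ 9 ∧ a ≠ 10 ∧ a ≠ 11 := by omega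
        simp [letterProg, hi, S.lf, S.q]
        refine ⟨by split_ifs <;> omega, by omega, by split_ifs <;> omega, ?_, ?_,
          by simpa [Nat.lt_succ_iff] using hL⟩
        · constructor <;> simp [S.n₁, S.q, S.σ, S.n, S.kd, S.lf, S.rt]
        · intro a ha
          simp [hf' a ha, hf a ha]
    refine Runs.mono (Runs.seq hmid (Q := fun s' => (CodeState n₁ n q σ kd lf rt s' ∧
      s'.reg 5 ≤ n ∧ (∀ a, 12 ≤ a → s'.arr a = fun _ => 0) ∧
      Filled q σ kd lf rt val (s'.arr 6) (s'.arr 7) (s'.arr 8) (s'.arr 9) (s'.arr 10)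
        (s'.arr 11) (s'.reg 5)) ∧ n - s'.reg 5 < n - s.reg 5) (T₂ := 4) ?_) (by omega)
      fun _ h => h
    rintro s₁ ⟨S₁, h5, hf₁, hF₁⟩
    refine Runs.of_wp (p := 5 ::= Term.reg 5 + 1) ?_
    simp [h5, hi]
    refine ⟨by omega, ⟨?_, by omega, hf₁, hF₁⟩, by omega⟩
    constructor <;> simp [S₁.n₁, S₁.q, S₁.σ, S₁.n, S₁.kd, S₁.lf, S₁.rt]
  · refine ⟨?_, by simp, fun a ha => by simp [hz a (by omega)], ?_⟩
    · constructor <;> simp [S.n₁, S.q, S.σ, S.n, S.kd, S.lf, S.rt]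
    · simp [hz]
      have none : ∀ {p : ℕ → Prop}, ∀ v < 0, p v := fun v hv => absurd hv (Nat.not_lt_zero v)
      exact ⟨none, none, none, ⟨none, none, none, none, none⟩, fun _ => hσ, fun _ => hσ,
        fun _ => hσ⟩
  · refine Nat.mul_le_mul ?_ ?_
    · simp
    · simp [Term.cost]; omega
  · intro s' h
    obtain ⟨⟨S', h5, hf, hF⟩, he⟩ := h
    simp [S'.n] at he
    rw [le_antisymm h5 he] at hF
    exact ⟨S', hf, hF.slots, hF.Z_lt⟩

end WordRAM

/-! ### Joining the two programs -/

/-- The array that holds `f` below `m` and `g` from `m` on. -/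
def joinArr (m : ℕ) (f g : ℕ → ℕ) (x : ℕ) : ℕ := if x < m then f x else g (x - m)

/-- The part of `joinArr` below `m + i`, followed by zeros. -/
def joinPart (m : ℕ) (f g : ℕ → ℕ) (i x : ℕ) : ℕ :=
  if x < m then f x else if x < m + i then g (x - m) else 0

theorem update_joinPart (m : ℕ) (f g : ℕ → ℕ) (i : ℕ) :
    Function.update (joinPart m f g i) (m + i) (g i) = joinPart m f g (i + 1) := by
  funext x
  by_cases h : x = m + i
  · subst h; simp [joinPart]
  · rw [Function.update_of_ne h]
    unfold joinPart
    by_cases h1 : x < m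
    · simp [h1]
    · by_cases h2 : x < m + i
      · simp [h1, h2, show x < m + (i + 1) by omega]
      · simp [h1, h2, show ¬ x < m + (i + 1) by omega]

namespace WordRAM

/-- Append one assignment of the second program to the first program.  Variables are shifted by
`n₁`, letters are not: the kind of the assignment, which is `0` or `1`, is a factor of the shift. -/
def appendBody : Prog :=
  Prog.store 0 (Term.reg 0 + Term.reg 5) (Term.cell 3 (Term.reg 5)) ;;
  Prog.store 1 (Term.reg 0 + Term.reg 5)
    (Term.cell 4 (Term.reg 5) + Term.cell 3 (Term.reg 5) * Term.reg 0) ;;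
  Prog.store 2 (Term.reg 0 + Term.reg 5)
    (Term.cell 5 (Term.reg 5) + Term.cell 3 (Term.reg 5) * Term.reg 0) ;;
  5 ::= Term.reg 5 + 1

/-- Append the second program to the first one. -/
def appendProg : Prog :=
  (4 ::= Term.reg 0 + Term.reg 1 ;; 5 ::= 0) ;;
  Prog.while (Term.op Op.lt (Term.reg 5) (Term.reg 1)) appendBody

theorem appendProg_runs {n₁ n₂ q σ B : ℕ} {s : State} {a b c d e f : ℕ → ℕ}
    (h0 : s.reg 0 = n₁) (h1 : s.reg 1 = n₂) (h2 : s.reg 2 = q) (h3 : s.reg 3 = σ)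
    (ha : s.arr 0 = a) (hb : s.arr 1 = b) (hc : s.arr 2 = c) (hd : s.arr 3 = d)
    (he : s.arr 4 = e) (hf : s.arr 5 = f) (hz : ∀ k, 6 ≤ k → s.arr k = fun _ => 0)
    (za : ∀ x, n₁ ≤ x → a x = 0) (zb : ∀ x, n₁ ≤ x → b x = 0) (zc : ∀ x, n₁ ≤ x → c x = 0)
    (zd : ∀ x, n₂ ≤ x → d x = 0) (ze : ∀ x, n₂ ≤ x → e x = 0) (zf : ∀ x, n₂ ≤ x → f x = 0)
    (Bn : n₁ + n₂ ≤ B) (Bd : ∀ x, d x ≤ B) (Be : ∀ x, e x + d x * n₁ ≤ B)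
    (Bf : ∀ x, f x + d x * n₁ ≤ B) :
    Runs B appendProg s (6 + (n₂ + 1) * (4 + appendBody.time)) (fun s' =>
      CodeState n₁ (n₁ + n₂) q σ (joinArr n₁ a d) (joinArr n₁ b fun x => e x + d x * n₁)
        (joinArr n₁ c fun x => f x + d x * n₁) s' ∧ ∀ k, 6 ≤ k → s'.arr k = fun _ => 0) := by
  have hstart : Runs B (4 ::= Term.reg 0 + Term.reg 1 ;; 5 ::= 0) s 6
      (fun s₁ => s₁ = (s.setReg 4 (n₁ + n₂)).setReg 5 0) := by
    refine Runs.of_wp (p := 4 ::= Term.reg 0 + Term.reg 1 ;; 5 ::= 0) ?_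
    simp [h0, h1, Bn]
  refine Runs.seq hstart ?_
  rintro _ rfl
  refine (Runs.loop (B := B) (e := Term.op Op.lt (Term.reg 5) (Term.reg 1)) (p := appendBody)
    (fun s' => s'.reg 0 = n₁ ∧ s'.reg 1 = n₂ ∧ s'.reg 2 = q ∧ s'.reg 3 = σ ∧
      s'.reg 4 = n₁ + n₂ ∧ s'.reg 5 ≤ n₂ ∧ s'.arr 0 = joinPart n₁ a d (s'.reg 5) ∧
      s'.arr 1 = joinPart n₁ b (fun x => e x + d x * n₁) (s'.reg 5) ∧
      s'.arr 2 = joinPart n₁ c (fun x => f x + d x * n₁) (s'.reg 5) ∧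
      s'.arr 3 = d ∧ s'.arr 4 = e ∧ s'.arr 5 = f ∧ ∀ k, 6 ≤ k → s'.arr k = fun _ => 0)
    (fun s' => n₂ - s'.reg 5) appendBody.time ?_ ?_ ?_).mono le_rfl ?_
  · rintro s ⟨g0, g1, g2, g3, g4, g5, ga, gb, gc, gd, ge, gf, gz⟩ hlt
    obtain ⟨i, hi⟩ : ∃ i, s.reg 5 = i := ⟨_, rfl⟩
    rw [hi] at ga gb gc
    simp [g1, hi] at hlt
    have ua := update_joinPart n₁ a d i
    have ub := update_joinPart n₁ b (fun x => e x + d x * n₁) i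
    have uc := update_joinPart n₁ c (fun x => f x + d x * n₁) i
    rw [← ga] at ua
    rw [← gb] at ub
    rw [← gc] at uc
    refine Runs.of_wp ?_
    simp [appendBody, g0, g1, g2, g3, g4, hi, gd, ge, gf, Bd, Be, Bf, ua, ub, uc]
    refine ⟨by omega, ⟨by omega, fun k hk => ?_⟩, by omega⟩
    simp [show k ≠ 0 by omega, show k ≠ 1 by omega, show k ≠ 2 by omega, gz k hk]
  · have key : ∀ u v : ℕ → ℕ, (∀ x, n₁ ≤ x → u x = 0) → u = joinPart n₁ u v 0 := by
      intro u v hu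
      funext x
      unfold joinPart
      split_ifs with h1 h2
      · rfl
      · omega
      · exact hu x (by omega)
    simp [h0, h1, h2, h3, ha, hb, hc, hd, he, hf]
    exact ⟨key _ _ za, key _ _ zb, key _ _ zc, hz⟩
  · exact Nat.mul_le_mul (by simp) (by simp [Term.cost])
  · intro s' h
    obtain ⟨⟨g0, g1, g2, g3, g4, g5, ga, gb, gc, gd, ge, gf, gz⟩, he'⟩ := h
    simp [g1] at he'
    have h5 : s'.reg 5 = n₂ := le_antisymm g5 he'
    have key : ∀ u v : ℕ → ℕ, (∀ x, n₂ ≤ x → v x = 0) → joinPart n₁ u v n₂ = joinArr n₁ u v := by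
      intro u v hv
      funext x
      unfold joinPart joinArr
      split_ifs with h1 h2
      · rfl
      · rfl
      · exact (hv _ (by omega)).symm
    rw [h5, key _ _ zd] at ga
    rw [h5, key _ _ fun x hx => by rw [ze x hx, zd x hx, Nat.zero_mul]] at gb
    rw [h5, key _ _ fun x hx => by rw [zf x hx, zd x hx, Nat.zero_mul]] at gc
    exact ⟨⟨g0, g2, g3, g4, ga, gb, gc⟩, gz⟩

end WordRAM

/-! ### The kernel of two straight line programs -/

namespace SLP

variable {σ : ℕ}

/-- The string derived from the `i`-th variable, as a list of numbers. -/
def str (S : SLP (Fin σ)) (i : ℕ) : List ℕ :=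
  if h : i < S.size then (S.val ⟨i, h⟩).map Fin.val else []

theorem str_last (S : SLP (Fin σ)) : S.str (S.size - 1) = S.text.map Fin.val :=
  dif_pos (Nat.sub_lt S.size_pos Nat.one_pos)

theorem code_eq_zero (S : SLP (Fin σ)) {i : ℕ} (h : S.size ≤ i) : S.code i = (0, 0, 0) :=
  dif_neg (not_lt.mpr h)

theorem code_cases (S : SLP (Fin σ)) {i : ℕ} (h : i < S.size) :
    (∃ a : Fin σ, S.code i = (0, a.val, 0) ∧ S.str i = [a.val]) ∨
    (∃ l r : ℕ, l < i ∧ r < i ∧ S.code i = (1, l, r) ∧ S.str i = S.str l ++ S.str r) := by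
  rcases e : S.rhs ⟨i, h⟩ with a | ⟨l, r⟩
  · refine Or.inl ⟨a, ?_, ?_⟩
    · rw [code, dif_pos h, e]
    · rw [str, dif_pos h, val, e]; rfl
  · refine Or.inr ⟨l.val, r.val, l.isLt, r.isLt, ?_, ?_⟩
    · rw [code, dif_pos h, e]
    · have hl : l.val < S.size := lt_trans l.isLt h
      have hr : r.val < S.size := lt_trans r.isLt h
      rw [str, dif_pos h, val, e, str, dif_pos hl, str, dif_pos hr, ← List.map_append]

/-- The first assignment of a program has no earlier variables to refer to, so it is a letter. -/
theorem alphabet_pos (S : SLP (Fin σ)) : 0 < σ := by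
  rcases S.code_cases S.size_pos with ⟨a, -⟩ | ⟨l, -, hl, -⟩
  · exact a.pos
  · exact absurd hl (Nat.not_lt_zero _)

/-- Bounds that hold for all `i`, also beyond the size of the program, where the code is zero. -/
theorem code_le (S : SLP (Fin σ)) (i : ℕ) : (S.code i).1 ≤ 1 ∧
    ((S.code i).1 = 0 → (S.code i).2.1 < σ) ∧
    (S.code i).2.1 ≤ S.size + σ ∧ (S.code i).2.2 ≤ S.size := by
  rcases Nat.lt_or_ge i S.size with h | h
  · rcases S.code_cases h with ⟨a, e, -⟩ | ⟨l, r, hl, hr, e, -⟩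
    · have := a.isLt
      simp [e]
      omega
    · simp [e]
      omega
  · have := S.alphabet_pos
    simpa [S.code_eq_zero h] using this

end SLP

section Join

variable {σ : ℕ} (S₁ S₂ : SLP (Fin σ))

/-- The kinds of the assignments of the joined programs. -/
def joinKd : ℕ → ℕ := joinArr S₁.size (fun i => (S₁.code i).1) fun i => (S₂.code i).1

/-- The letters and the left parts in the joined programs. -/
def joinLf : ℕ → ℕ := joinArr S₁.size (fun i => (S₁.code i).2.1) fun i =>
  (S₂.code i).2.1 + (S₂.code i).1 * S₁.size

/-- The right parts in the joined programs. -/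
def joinRt : ℕ → ℕ := joinArr S₁.size (fun i => (S₁.code i).2.2) fun i =>
  (S₂.code i).2.2 + (S₂.code i).1 * S₁.size

/-- The strings derived from the variables of the joined programs. -/
def joinStr (i : ℕ) : List ℕ := if i < S₁.size then S₁.str i else S₂.str (i - S₁.size)

theorem isCode_join : IsCode S₁.size (S₁.size + S₂.size) (joinKd S₁ S₂) (joinLf S₁ S₂)
    (joinRt S₁ S₂) (joinStr S₁ S₂) := by
  have h1 := S₁.size_pos
  have h2 := S₂.size_pos
  unfold joinKd joinLf joinRt joinStr joinArr
  refine ⟨h1, by omega, ?_, ?_, ?_⟩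
  · intro i hi h0
    by_cases h : i < S₁.size
    · simp only [h, if_true] at h0 ⊢
      rcases S₁.code_cases h with ⟨a, e, e'⟩ | ⟨l, r, hl, hr, e, e'⟩
      · simp only [e, e']
      · simp [e] at h0
    · simp only [h, if_false] at h0 ⊢
      rcases S₂.code_cases (i := i - S₁.size) (by omega) with ⟨a, e, e'⟩ | ⟨l, r, hl, hr, e, e'⟩
      · simp [e, e']
      · simp [e] at h0
  · intro i hi h0
    by_cases h : i < S₁.size
    · simp only [h, if_true] at h0 ⊢
      rcases S₁.code_cases h with ⟨a, e, e'⟩ | ⟨l, r, hl, hr, e, e'⟩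
      · simp [e] at h0
      · simp only [e, e']
        exact ⟨hl, hr, by rw [if_pos (by omega), if_pos (by omega)]⟩
    · simp only [h, if_false] at h0 ⊢
      rcases S₂.code_cases (i := i - S₁.size) (by omega) with ⟨a, e, e'⟩ | ⟨l, r, hl, hr, e, e'⟩
      · simp [e] at h0
      · simp only [e, e', one_mul]
        exact ⟨by omega, by omega, by
          rw [if_neg (by omega), if_neg (by omega), Nat.add_sub_cancel, Nat.add_sub_cancel]⟩
  · intro i hi h0 h
    simp only [not_lt.mpr h, if_false] at h0 ⊢
    have := (S₂.code_le (i - S₁.size)).1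
    rw [show (S₂.code (i - S₁.size)).1 = 1 by omega]
    omega

theorem joinLf_lt : ∀ i < S₁.size + S₂.size, joinKd S₁ S₂ i = 0 → joinLf S₁ S₂ i < σ := by
  intro i _ h0
  unfold joinKd joinArr at h0
  unfold joinLf joinArr
  split_ifs at h0 ⊢ with h
  · exact (S₁.code_le i).2.1 h0
  · dsimp only at h0 ⊢
    rw [h0, zero_mul, add_zero]
    exact (S₂.code_le _).2.1 h0

theorem joinStr_first : joinStr S₁ S₂ (S₁.size - 1) = S₁.text.map Fin.val := by
  have := S₁.size_pos
  rw [joinStr, if_pos (by omega), S₁.str_last]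

theorem joinStr_second : joinStr S₁ S₂ (S₁.size + S₂.size - 1) = S₂.text.map Fin.val := by
  have := S₂.size_pos
  rw [joinStr, if_neg (by omega), show S₁.size + S₂.size - 1 - S₁.size = S₂.size - 1 by omega,
    S₂.str_last]

end Join

namespace WordRAM

/-- The program that computes the kernel. -/
def kernelProg : Prog :=
  appendProg ;; slotsProg ;; multProg ;; searchInit ;; searchLoop ;; 0 ::= Term.reg 21

/-- A constant factor for the running time of `kernelProg`. -/
def kernelConst : ℕ :=
  (6 + 2 * (4 + appendBody.time)) +
  (2 + 2 * (11 + (pairInit.time + (6 + copyBody.time) + letterProg.time))) +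
  (multInit.time + 2 * (2 + multBody.time)) + searchInit.time + 9 * (4 + searchBody.time) + 2

theorem kernelProg_time {n₁ n₂ q : ℕ} (h₁ : 0 < n₁) (hq : 0 < q) :
    (6 + (n₂ + 1) * (4 + appendBody.time)) +
      ((2 + ((n₁ + n₂) + 1) * (11 + (pairInit.time + q * (6 + copyBody.time) +
        letterProg.time))) +
      ((multInit.time + ((n₁ + n₂) + 1) * (2 + multBody.time)) +
      (searchInit.time +
      ((3 * ((n₁ + n₂) * (2 * q)) + 2 * q + 1) * (4 + searchBody.time) + 2)))) ≤
    kernelConst * (q * (n₁ + n₂)) := by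
  unfold kernelConst
  generalize appendBody.time = A
  generalize pairInit.time = P
  generalize copyBody.time = K
  generalize letterProg.time = L
  generalize multInit.time = I
  generalize multBody.time = M
  generalize searchInit.time = J
  generalize searchBody.time = S
  have hn : 0 < n₁ + n₂ := by omega
  obtain ⟨X, hX⟩ : ∃ X, X = q * (n₁ + n₂) := ⟨_, rfl⟩
  have hX1 : 1 ≤ X := hX ▸ Nat.mul_pos hq hn
  have hqX : q ≤ X := hX ▸ Nat.le_mul_of_pos_right _ hn
  have hnX : n₁ + n₂ ≤ X := hX ▸ Nat.le_mul_of_pos_left _ hq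
  have e1 : (n₂ + 1) * (4 + A) ≤ (2 * X) * (4 + A) := Nat.mul_le_mul_right _ (by omega)
  have e2 : ((n₁ + n₂) + 1) * (11 + (P + q * (6 + K) + L)) ≤
      (2 * X) * (11 + (P + (6 + K) + L)) := by
    have a1 : 11 + (P + q * (6 + K) + L) ≤ q * (11 + (P + (6 + K) + L)) := by
      have b1 : 11 + P + L ≤ q * (11 + P + L) := Nat.le_mul_of_pos_left _ hq
      have b2 : q * (11 + (P + (6 + K) + L)) = q * (11 + P + L) + q * (6 + K) := by ring
      omega
    calc _ ≤ (2 * (n₁ + n₂)) * (q * (11 + (P + (6 + K) + L))) :=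
          Nat.mul_le_mul (by omega) a1
      _ = _ := by rw [hX]; ring
  have e3 : ((n₁ + n₂) + 1) * (2 + M) ≤ (2 * X) * (2 + M) := Nat.mul_le_mul_right _ (by omega)
  have e4 : (3 * ((n₁ + n₂) * (2 * q)) + 2 * q + 1) * (4 + S) ≤ (9 * X) * (4 + S) := by
    refine Nat.mul_le_mul_right _ ?_
    have : (n₁ + n₂) * (2 * q) = 2 * X := by rw [hX]; ring
    omega
  have e5 : I ≤ I * X := Nat.le_mul_of_pos_right _ hX1
  have e6 : J ≤ J * X := Nat.le_mul_of_pos_right _ hX1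
  rw [← hX]
  nlinarith

/-- The bound `B` has to exceed the numbers of windows and nodes, the multiplicities, and all
partial sums of the kernel and of the counters at the leaves. -/
theorem kernelProg_runs {σ : ℕ} (S₁ S₂ : SLP (Fin σ)) {q B : ℕ} (hq : 0 < q)
    (hqB : 2 * q ≤ B) (hnB : S₁.size + S₂.size + σ ≤ B)
    (hτB : S₁.text.length + S₂.text.length ≤ B)
    (hNB : 2 * ((S₁.size + S₂.size) * (2 * q)) + 3 ≤ B)
    (hB : (S₁.size + S₂.size) * (2 * q) * (S₁.text.length + S₂.text.length) *
      ((S₁.size + S₂.size) * (2 * q) * (S₁.text.length + S₂.text.length)) +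
      (S₁.size + S₂.size) * (2 * q) * (S₁.text.length + S₂.text.length) ≤ B) :
    Runs B kernelProg (kernelInput S₁ S₂ q) (kernelConst * (q * (S₁.size + S₂.size)))
      (fun s' => s'.reg 0 = spectrumKernel q S₁.text S₂.text) := by
  have hσ := S₁.alphabet_pos
  have hc := isCode_join S₁ S₂
  have hlf := joinLf_lt S₁ S₂
  have ht₁ := joinStr_first S₁ S₂
  have ht₂ := joinStr_second S₁ S₂
  refine Runs.mono ?_ (kernelProg_time (n₂ := S₂.size) S₁.size_pos hq) fun _ h => h
  refine Runs.seq (appendProg_runs (n₁ := S₁.size) (n₂ := S₂.size) (q := q) (σ := σ)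
    rfl rfl rfl rfl rfl rfl rfl rfl rfl rfl ?_ ?_ ?_ ?_ ?_ ?_ ?_ (by omega) ?_ ?_ ?_) ?_
  · intro k hk
    obtain ⟨k, rfl⟩ := Nat.exists_eq_add_of_le' hk
    rfl
  · intro x hx; exact congrArg (·.1) (S₁.code_eq_zero hx)
  · intro x hx; exact congrArg (·.2.1) (S₁.code_eq_zero hx)
  · intro x hx; exact congrArg (·.2.2) (S₁.code_eq_zero hx)
  · intro x hx; exact congrArg (·.1) (S₂.code_eq_zero hx)
  · intro x hx; exact congrArg (·.2.1) (S₂.code_eq_zero hx)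
  · intro x hx; exact congrArg (·.2.2) (S₂.code_eq_zero hx)
  · intro x; have := (S₂.code_le x).1; change (S₂.code x).1 ≤ B; omega
  · intro x
    change (S₂.code x).2.1 + (S₂.code x).1 * S₁.size ≤ B
    obtain ⟨h1, -, h4, -⟩ := S₂.code_le x
    have := Nat.mul_le_mul_right S₁.size h1
    omega
  · intro x
    change (S₂.code x).2.2 + (S₂.code x).1 * S₁.size ≤ B
    obtain ⟨h1, -, -, h5⟩ := S₂.code_le x
    have := Nat.mul_le_mul_right S₁.size h1
    omega
  rintro s₁ ⟨C₁, hz₁⟩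
  change CodeState S₁.size (S₁.size + S₂.size) q σ (joinKd S₁ S₂) (joinLf S₁ S₂)
    (joinRt S₁ S₂) s₁ at C₁
  refine Runs.seq (slotsProg_runs hq hσ hqB (by omega) (by omega) hc hlf C₁ hz₁) ?_
  rintro s₂ ⟨C₂, hz₂, hslots, hzσ⟩
  refine Runs.seq (multProg_runs hc (τ := S₁.text.length + S₂.text.length) (by omega)
    (by rw [ht₁, ht₂, List.length_map, List.length_map]) hτB C₂ (hz₂ 12 le_rfl)) ?_
  rintro s₃ ⟨C₃, hf₃, hV, hmult⟩
  have g : ∀ a, a ≠ 12 → s₃.arr a = s₂.arr a := hf₃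
  have hinit : Runs B searchInit s₃ searchInit.time (fun s' =>
      SearchState (s₂.arr 9) (s₃.arr 12) (s₂.arr 10) (s₂.arr 11) q σ (S₁.size * (2 * q))
        ((S₁.size + S₂.size) * (2 * q)) s' Search.init) := by
    have hle : S₁.size * (2 * q) ≤ (S₁.size + S₂.size) * (2 * q) :=
      Nat.mul_le_mul_right _ (Nat.le_add_right _ _)
    refine Runs.of_wp ?_
    simp [searchInit, C₃.n, C₃.n₁, C₃.q]
    refine ⟨by omega, by omega, by omega, ?_⟩
    constructor <;> simp [C₃.q, C₃.σ, Search.init, g, hz₂]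
  refine Runs.seq hinit ?_
  intro s₄ R
  refine Runs.seq (searchLoop_runs hNB (by omega) hzσ (τ := S₁.text.length + S₂.text.length)
    (fun x hx => hV _ (Nat.div_lt_of_lt_mul (by rwa [Nat.mul_comm]))) hB
    (Nat.mul_le_mul_right _ (Nat.le_add_right _ _)) R (Search.inv_init hq) (Nat.zero_le _)) ?_
  intro s₅ h₅
  have hle : s₅.reg 21 ≤ B := by
    rw [h₅]
    refine le_trans (pairWeight_le (τ := S₁.text.length + S₂.text.length) (fun x hx => hV _
      (Nat.div_lt_of_lt_mul (by rwa [Nat.mul_comm]))) (Nat.mul_le_mul_right _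
        (Nat.le_add_right _ _)) le_rfl) ?_
    omega
  have hsum := fun p => sum_slots hq hc hslots hmult p
  have hker : s₅.reg 21 = spectrumKernel q S₁.text S₂.text := by
    rw [h₅]
    refine pairWeight_eq_spectrumKernel hzσ (fun p => ?_) (fun p => ?_)
    · rw [qgramFeature_eq hq, ← ht₁]
      exact (hsum _).1
    · rw [qgramFeature_eq hq, ← ht₂]
      exact (hsum _).2
  refine Runs.of_wp (p := 0 ::= Term.reg 21) ?_
  rw [hker] at hle
  simp [hker, hle]

theorem kernelInput_bounded {σ B : ℕ} (S₁ S₂ : SLP (Fin σ)) {q : ℕ} (hq : q ≤ B)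
    (hB : S₁.size + S₂.size + σ ≤ B) : (kernelInput S₁ S₂ q).Bounded B := by
  have hσ := S₁.alphabet_pos
  refine ⟨fun r => ?_, fun a i => ?_⟩
  · match r with
    | 0 => change S₁.size ≤ B; omega
    | 1 => change S₂.size ≤ B; omega
    | 2 => exact hq
    | 3 => change σ ≤ B; omega
    | _ + 4 => exact Nat.zero_le _
  · obtain ⟨a1, -, a2, a3⟩ := S₁.code_le i
    obtain ⟨b1, -, b2, b3⟩ := S₂.code_le i
    match a with
    | 0 => change (S₁.code i).1 ≤ B; omega
    | 1 => change (S₁.code i).2.1 ≤ B; omega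
    | 2 => change (S₁.code i).2.2 ≤ B; omega
    | 3 => change (S₂.code i).1 ≤ B; omega
    | 4 => change (S₂.code i).2.1 ≤ B; omega
    | 5 => change (S₂.code i).2.2 ≤ B; omega
    | _ + 6 => exact Nat.zero_le _

end WordRAM

theorem SLP.text_length_pos {σ : ℕ} (S : SLP (Fin σ)) : 0 < S.text.length := by
  have hc := isCode_join S S
  have := hc.val_pos (S.size - 1) (by have := S.size_pos; omega)
  rwa [joinStr_first, List.length_map] at this

theorem mainTheorem2 :
    ∃ (P : WordRAM.Prog) (C k : ℕ),
      ∀ (σ : ℕ) (S₁ S₂ : SLP (Fin σ)) (q w : ℕ), 0 < q →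
        (S₁.size + S₂.size + S₁.text.length + S₂.text.length + q + σ) ^ k ≤ 2 ^ w →
        ∃ (t : ℕ) (s : WordRAM.State),
          WordRAM.Exec w P (kernelInput S₁ S₂ q) t s ∧
          s.reg 0 = spectrumKernel q S₁.text S₂.text ∧
          t ≤ C * (q * (S₁.size + S₂.size)) := by
  refine ⟨WordRAM.kernelProg, WordRAM.kernelConst, 9 * WordRAM.kernelProg.deg, ?_⟩
  intro σ S₁ S₂ q w hq hw
  have h1 := S₁.size_pos
  have h2 := S₂.size_pos
  have h3 := S₁.text_length_pos
  have h4 := S₂.text_length_pos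
  have h5 := S₁.alphabet_pos
  obtain ⟨m, hm⟩ : ∃ m, m = S₁.size + S₂.size + S₁.text.length + S₂.text.length + q + σ :=
    ⟨_, rfl⟩
  rw [← hm] at hw
  have hm6 : 6 ≤ m := by omega
  -- every stored value is at most `m ^ 8`
  have hN : (S₁.size + S₂.size) * (2 * q) ≤ 2 * m ^ 2 := by
    calc _ ≤ m * (2 * m) := Nat.mul_le_mul (by omega) (by omega)
      _ = _ := by ring
  have hNτ : (S₁.size + S₂.size) * (2 * q) * (S₁.text.length + S₂.text.length) ≤ 2 * m ^ 3 := by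
    calc _ ≤ 2 * m ^ 2 * m := Nat.mul_le_mul hN (by omega)
      _ = _ := by ring
  obtain ⟨B, hB, hB1, hB2, hB3⟩ : ∃ B, B = m ^ 8 ∧ 6 * m ≤ B ∧ 2 * (2 * m ^ 2) + 3 ≤ B ∧
      2 * m ^ 3 * (2 * m ^ 3) + 2 * m ^ 3 ≤ B := by
    have p1 : m ^ 2 * 36 ≤ m ^ 8 := by
      rw [show m ^ 8 = m ^ 2 * m ^ 6 by ring]
      exact Nat.mul_le_mul_left _ ((Nat.pow_le_pow_left hm6 2).trans
        (Nat.pow_le_pow_right (by omega) (by omega)))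
    have p2 : m ^ 6 * 36 ≤ m ^ 8 := by
      rw [show m ^ 8 = m ^ 6 * m ^ 2 by ring]
      exact Nat.mul_le_mul_left _ (Nat.pow_le_pow_left hm6 2)
    have p3 : m ^ 3 ≤ m ^ 6 := Nat.pow_le_pow_right (by omega) (by omega)
    have p4 : m * 6 ≤ m ^ 2 := by rw [pow_two]; exact Nat.mul_le_mul_left _ hm6
    refine ⟨_, rfl, ?_, ?_, ?_⟩
    · linarith
    · linarith
    · rw [show 2 * m ^ 3 * (2 * m ^ 3) = 4 * m ^ 6 by ring]
      linarith
  obtain ⟨t, s, hex, ht, hs⟩ := WordRAM.kernelProg_runs S₁ S₂ (B := B) hq (by omega)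
    (by omega) (by omega) (by linarith)
    ((Nat.add_le_add (Nat.mul_le_mul hNτ hNτ) hNτ).trans hB3)
  have hword : (B + 1) ^ WordRAM.kernelProg.deg ≤ 2 ^ w := by
    refine le_trans ?_ hw
    rw [pow_mul]
    refine Nat.pow_le_pow_left ?_ _
    have h9 : m ^ 9 = B * m := by rw [hB, pow_succ]
    have : B * 2 ≤ B * m := Nat.mul_le_mul_left _ (by omega)
    omega
  obtain ⟨hrun, -⟩ := hex.exec (w := w) (by omega)
    (WordRAM.kernelInput_bounded S₁ S₂ (by omega) (by omega)) hword
  exact ⟨t, s, hrun, hs, ht⟩
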